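/- Let $\mathbb K$ be a field and let $\mathcal A$ be a small $\mathbb K$-linear monoidal category (the tensor product is $\mathbb K$-linear in each variable). Let $\mathcal X$ be a small $\mathbb K$-linear right $\mathcal A$-module category and $\mathcal Y$ a small $\mathbb K$-linear left $\mathcal A$-module category, with action functors $\triangleleft : \mathcal X \times \mathcal A \to \mathcal X$ and $\triangleright : \mathcal A \times \mathcal Y \to \mathcal Y$ that are $\mathbb K$-linear in each variable, and with coherent associators and unitors. For a small $\mathbb K$-linear category $\mathcal Z$, the free cocompletion $\widehat{\mathcal Z}$ is the category of $\mathbb K$-linear functors $\mathcal Z^{\mathrm{op}} \to \mathrm{Vect}_{\mathbb K}$. By Day convolution, $(F \circledast G)(d) = \int^{b,c} \operatorname{Hom}(d, b\otimes c) \otimes_{\mathbb K} F(b) \otimes_{\mathbb K} G(c)$, and similarly with $\triangleleft$ or $\triangleright$ in place of $\otimes$, $\widehat{\mathcal A}$ is a monoidal category, $\widehat{\mathcal X}$ is a right $\widehat{\mathcal A}$-module and $\widehat{\mathcal Y}$ is a left $\widehat{\mathcal A}$-module. The naive tensor product $\mathcal X \otimes_{\mathbb K} \mathcal Y$ has object set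 $\mathrm{ob}(\mathcal X) \times \mathrm{ob}(\mathcal Y)$ and morphism spaces $\operatorname{Hom}((x,y),(x',y')) = \operatorname{Hom}(x,x') \otimes_{\mathbb K} \operatorname{Hom}(y,y')$. The naive balanced tensor product $\mathcal X \otimes_{\mathcal A} \mathcal Y$ is the $\mathbb K$-linear category with the same objects obtained from $\mathcal X \otimes_{\mathbb K} \mathcal Y$ by freely adjoining isomorphisms $\alpha_{x,a,y} : (x \triangleleft a, y) \to (x, a \triangleright y)$, subject to naturality in $(x,a,y)$, the pentagon relation $\alpha_{x,a,b\triangleright y} \circ \alpha_{x \triangleleft a, b, y} = \alpha_{x, a \otimes b, y}$ and the unit relation $\alpha_{x,\mathbf 1,y} = \mathrm{id}$ (both up to the associators and unitors of $\mathcal X$ and $\mathcal Y$). If $\mathcal C$ is a monoidal category, $\mathcal M$ a right and $\mathcal N$ a left $\mathcal C$-module, with $\mathcal M,\mathcal N$ $\mathbb K$-linear, a balanced functor to a $\mathbb K$-linear category $\mathcal E$ is a functor $P : \mathcal M \times \mathcal N \to \mathcal E$, $\mathbb K$-linear and cocontinuous in each variable, with an isomorphism $P(m \triangleleft c, n) \cong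 P(m, c \triangleright n)$, natural in $m,c,n$ and satisfying the pentagon and triangle equations; morphisms are the natural transformations compatible with these isomorphisms. A balanced tensor product $\mathcal M \boxtimes_{\mathcal C} \mathcal N$ is a cocomplete $\mathbb K$-linear category $\mathcal W$ with a balanced functor $P : \mathcal M \times \mathcal N \to \mathcal W$ that is universal: for every cocomplete $\mathbb K$-linear category $\mathcal E$, composition with $P$ is an equivalence from the category of $\mathbb K$-linear cocontinuous functors $\mathcal W \to \mathcal E$ to the category of balanced functors $\mathcal M \times \mathcal N \to \mathcal E$. Then free cocompletion takes naive balanced tensor products to balanced tensor products: $$ \widehat{\mathcal X \otimes_{\mathcal A} \mathcal Y} \simeq \widehat{\mathcal X} \boxtimes_{\widehat{\mathcal A}} \widehat{\mathcal Y}. $$ That is, there is a balanced functor $P : \widehat{\mathcal X} \times \widehat{\mathcal Y} \to \widehat{\mathcal X \otimes_{\mathcal A} \mathcal Y}$ that makes $\widehat{\mathcal X \otimes_{\mathcal A} \mathcal Y}$ a balanced tensor product of $\widehat{\mathcal X}$ and $\widehat{\mathcal Y}$ over $\widehat{\mathcal A}$; and for every balanced tensor product $(\mathcal W, Q)$ of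 $\widehat{\mathcal X}$ and $\widehat{\mathcal Y}$ over $\widehat{\mathcal A}$ there is a $\mathbb K$-linear cocontinuous equivalence $G : \widehat{\mathcal X \otimes_{\mathcal A} \mathcal Y} \to \mathcal W$ with $G \circ P \cong Q$ as balanced functors. -/

import Mathlib

open CategoryTheory CategoryTheory.Limits MonoidalCategory Opposite
universe u v w v₁ v₂ v₃

namespace LinCat

section FreeCocompletion

variable (K : Type u) [Field K]
variable (X : Type u) [SmallCategory X] [Preadditive X] [Linear K X]

/-- The property of a contravariant functor to `K`-vector spaces to be `K`-linear on morphisms. -/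
def isLinearPresheaf : ObjectProperty (Xᵒᵖ ⥤ ModuleCat.{u} K) := fun F =>
  (∀ ⦃x y : X⦄ (f g : x ⟶ y), F.map (f + g).op = F.map f.op + F.map g.op) ∧
  (∀ ⦃x y : X⦄ (r : K) (f : x ⟶ y), F.map (r • f).op = r • F.map f.op)

/-- The free cocompletion of a small `K`-linear category `X`: the category of `K`-linear functors
`Xᵒᵖ ⥤ Vect K` and natural transformations. -/
abbrev FreeCocompletion : Type (u + 1) := (isLinearPresheaf K X).FullSubcategory

end FreeCocompletion

namespace FreeCocompletion

variable {K : Type u} [Field K]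
variable {X : Type u} [SmallCategory X] [Preadditive X] [Linear K X]

/-- The vector space of sections of a presheaf over an object. -/
abbrev sec (F : FreeCocompletion K X) (x : X) : Type u := F.obj.obj (op x)

/-- The action of a morphism on sections. -/
def res (F : FreeCocompletion K X) {x y : X} (f : x ⟶ y) : F.sec y →ₗ[K] F.sec x :=
  (F.obj.map f.op).hom

/-- The components of a natural transformation, as linear maps. -/
def app {F G : FreeCocompletion K X} (η : F ⟶ G) (x : X) : F.sec x →ₗ[K] G.sec x :=
  (η.hom.app (op x)).hom

@[simp] lemma res_id (F : FreeCocompletion K X) (x : X) (s : F.sec x) : F.res (𝟙 x) s = s := by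
  simp [res]

@[simp] lemma res_res (F : FreeCocompletion K X) {x y z : X} (f : x ⟶ y) (g : y ⟶ z)
    (s : F.sec z) : F.res f (F.res g s) = F.res (f ≫ g) s := by
  simp [res]

lemma res_add (F : FreeCocompletion K X) {x y : X} (f g : x ⟶ y) (s : F.sec y) :
    F.res (f + g) s = F.res f s + F.res g s := by
  have h := F.property.1 f g
  simp only [res, h]
  rfl

lemma res_smul (F : FreeCocompletion K X) {x y : X} (r : K) (f : x ⟶ y) (s : F.sec y) :
    F.res (r • f) s = r • F.res f s := by
  have h := F.property.2 r f
  simp only [res, h]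
  rfl

@[simp] lemma app_res {F G : FreeCocompletion K X} (η : F ⟶ G) {x y : X} (f : x ⟶ y)
    (s : F.sec y) : app η x (F.res f s) = G.res f (app η y s) :=
  ConcreteCategory.congr_hom (η.hom.naturality f.op) s

@[simp] lemma app_id (F : FreeCocompletion K X) (x : X) (s : F.sec x) : app (𝟙 F) x s = s := rfl

@[simp] lemma app_comp {F G H : FreeCocompletion K X} (η : F ⟶ G) (θ : G ⟶ H) (x : X)
    (s : F.sec x) : app (η ≫ θ) x s = app θ x (app η x s) := rfl

lemma hom_ext' {F G : FreeCocompletion K X} {η θ : F ⟶ G}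
    (h : ∀ (x : X) (s : F.sec x), app η x s = app θ x s) : η = θ := by
  apply ObjectProperty.hom_ext
  ext x s
  exact h x.unop s

/-- A linear presheaf from its spaces of sections and restriction maps. -/
def mkObj (S : X → Type u) [∀ x, AddCommGroup (S x)] [∀ x, Module K (S x)]
    (r : ∀ {x y : X}, (x ⟶ y) → (S y →ₗ[K] S x))
    (r_id : ∀ x s, r (𝟙 x) s = s)
    (r_comp : ∀ {x y z : X} (f : x ⟶ y) (g : y ⟶ z) s, r (f ≫ g) s = r f (r g s))
    (r_add : ∀ {x y : X} (f g : x ⟶ y) s, r (f + g) s = r f s + r g s)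
    (r_smul : ∀ {x y : X} (c : K) (f : x ⟶ y) s, r (c • f) s = c • r f s) :
    FreeCocompletion K X where
  obj :=
    { obj := fun x => ModuleCat.of K (S x.unop)
      map := fun f => ModuleCat.ofHom (r f.unop)
      map_id := fun x => by ext s; exact r_id _ s
      map_comp := fun f g => by ext s; exact r_comp _ _ s }
  property := ⟨fun x y f g => by ext s; exact r_add f g s,
    fun x y c f => by ext s; exact r_smul c f s⟩

/-- A morphism of linear presheaves from its components. -/
def mkHom {F G : FreeCocompletion K X} (a : ∀ x, F.sec x →ₗ[K] G.sec x)
    (nat : ∀ {x y : X} (f : x ⟶ y) (s : F.sec y), a x (F.res f s) = G.res f (a y s)) :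
    F ⟶ G :=
  ObjectProperty.homMk
    { app := fun x => ModuleCat.ofHom (a x.unop)
      naturality := fun x y f => by ext s; exact nat f.unop s }

@[simp] lemma app_mkHom {F G : FreeCocompletion K X} (a : ∀ x, F.sec x →ₗ[K] G.sec x)
    (nat : ∀ {x y : X} (f : x ⟶ y) (s : F.sec y), a x (F.res f s) = G.res f (a y s)) (x : X)
    (s : F.sec x) : app (mkHom a nat) x s = a x s := rfl

/-- The presheaf represented by an object. -/
def rep (K : Type u) [Field K] {X : Type u} [SmallCategory X] [Preadditive X] [Linear K X]
    (z : X) : FreeCocompletion K X :=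
  mkObj (fun x => x ⟶ z) (fun f => Linear.leftComp K z f) (by simp) (by simp) (by simp) (by simp)

/-- A section of a represented presheaf, as a morphism. -/
def toHom {z x : X} : (rep K z).sec x →ₗ[K] (x ⟶ z) := LinearMap.id (M := x ⟶ z)

/-- A morphism, as a section of a represented presheaf. -/
def ofHom {z x : X} : (x ⟶ z) →ₗ[K] (rep K z).sec x := LinearMap.id (M := x ⟶ z)

@[simp] lemma toHom_ofHom {z x : X} (f : x ⟶ z) : toHom (ofHom (K := K) f) = f := rfl

@[simp] lemma ofHom_toHom {z x : X} (s : (rep K z).sec x) : ofHom (toHom s) = s := rfl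

@[simp] lemma toHom_res {z x y : X} (f : x ⟶ y) (s : (rep K z).sec y) :
    toHom ((rep K z).res f s) = f ≫ toHom s := rfl

lemma res_ofHom {z x y : X} (f : x ⟶ y) (g : y ⟶ z) :
    (rep K z).res f (ofHom g) = ofHom (f ≫ g) := rfl

lemma eq_res {z x : X} (s : (rep K z).sec x) : s = (rep K z).res (toHom s) (ofHom (𝟙 z)) := by
  rw [res_ofHom, Category.comp_id, ofHom_toHom]

end FreeCocompletion

/-! ### Day convolution along a bilinear functor -/

/-- A functor of two variables between `K`-linear categories which is `K`-linear in each. -/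
class IsBilinear (K : Type*) [Field K] {B C D : Type*} [Category* B] [Category* C]
    [Category* D] [Preadditive B] [Preadditive C] [Preadditive D] [Linear K B] [Linear K C]
    [Linear K D] (T : B ⥤ C ⥤ D) : Prop where
  map_add_left : ∀ {b b' : B} (f g : b ⟶ b') (c : C),
    (T.map (f + g)).app c = (T.map f).app c + (T.map g).app c
  map_smul_left : ∀ {b b' : B} (r : K) (f : b ⟶ b') (c : C),
    (T.map (r • f)).app c = r • (T.map f).app c
  map_add_right : ∀ (b : B) {c c' : C} (f g : c ⟶ c'),
    (T.obj b).map (f + g) = (T.obj b).map f + (T.obj b).map g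
  map_smul_right : ∀ (b : B) {c c' : C} (r : K) (f : c ⟶ c'),
    (T.obj b).map (r • f) = r • (T.obj b).map f

namespace Day

open FreeCocompletion

variable {K : Type u} [Field K]
variable {B C D : Type u} [SmallCategory B] [SmallCategory C] [SmallCategory D]
variable [Preadditive B] [Preadditive C] [Preadditive D] [Linear K B] [Linear K C] [Linear K D]
variable (T : B ⥤ C ⥤ D) (F : FreeCocompletion K B) (G : FreeCocompletion K C)

/-- Generators of the coend `∫^{b,c} D(d, T(b,c)) ⊗ F(b) ⊗ G(c)`. -/
structure Gen (d : D) : Type u where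
  /-- the first object -/
  b : B
  /-- the second object -/
  c : C
  /-- the morphism -/
  φ : d ⟶ (T.obj b).obj c
  /-- the section of the first presheaf -/
  s : F.sec b
  /-- the section of the second presheaf -/
  t : G.sec c

/-- The free vector space on the generators. -/
abbrev Pre (d : D) : Type u := Gen T F G d →₀ K

/-- A generator, as a vector. -/
noncomputable def gen {T : B ⥤ C ⥤ D} {F : FreeCocompletion K B} {G : FreeCocompletion K C} {d : D}
    {b : B} {c : C} (φ : d ⟶ (T.obj b).obj c) (s : F.sec b) (t : G.sec c) : Pre T F G d :=
  Finsupp.single ⟨b, c, φ, s, t⟩ 1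

/-- The defining relators of the coend: linearity in each of the three tensor factors, and
dinaturality in the two bound objects. -/
inductive Relator (d : D) : Pre T F G d → Prop
  | add_hom {b c} (φ φ' : d ⟶ (T.obj b).obj c) (s : F.sec b) (t : G.sec c) :
      Relator d (gen (φ + φ') s t - gen φ s t - gen φ' s t)
  | smul_hom {b c} (r : K) (φ : d ⟶ (T.obj b).obj c) (s : F.sec b) (t : G.sec c) :
      Relator d (gen (r • φ) s t - r • gen φ s t)
  | add_left {b c} (φ : d ⟶ (T.obj b).obj c) (s s' : F.sec b) (t : G.sec c) :
      Relator d (gen φ (s + s') t - gen φ s t - gen φ s' t)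
  | smul_left {b c} (r : K) (φ : d ⟶ (T.obj b).obj c) (s : F.sec b) (t : G.sec c) :
      Relator d (gen φ (r • s) t - r • gen φ s t)
  | add_right {b c} (φ : d ⟶ (T.obj b).obj c) (s : F.sec b) (t t' : G.sec c) :
      Relator d (gen φ s (t + t') - gen φ s t - gen φ s t')
  | smul_right {b c} (r : K) (φ : d ⟶ (T.obj b).obj c) (s : F.sec b) (t : G.sec c) :
      Relator d (gen φ s (r • t) - r • gen φ s t)
  | dinat_left {b b' c} (f : b ⟶ b') (φ : d ⟶ (T.obj b).obj c) (s : F.sec b') (t : G.sec c) :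
      Relator d (gen (φ ≫ (T.map f).app c) s t - gen φ (F.res f s) t)
  | dinat_right {b c c'} (g : c ⟶ c') (φ : d ⟶ (T.obj b).obj c) (s : F.sec b) (t : G.sec c') :
      Relator d (gen (φ ≫ (T.obj b).map g) s t - gen φ s (G.res g t))

/-- The coend `∫^{b,c} D(d, T(b,c)) ⊗ F(b) ⊗ G(c)`. -/
abbrev Coend (d : D) : Type u :=
  Pre T F G d ⧸ Submodule.span K {z | Relator T F G d z}

variable {T F G} {d : D}

/-- The class of a generator in the coend. -/
noncomputable def mk {b : B} {c : C} (φ : d ⟶ (T.obj b).obj c) (s : F.sec b) (t : G.sec c) :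
    Coend T F G d :=
  (Submodule.span K {z | Relator T F G d z}).mkQ (gen φ s t)

lemma mkQ_eq_zero {z : Pre T F G d} (h : Relator T F G d z) :
    (Submodule.span K {z | Relator T F G d z}).mkQ z = 0 := by
  rw [Submodule.mkQ_apply, Submodule.Quotient.mk_eq_zero]
  exact Submodule.subset_span h

section

variable {b b' : B} {c c' : C}

lemma mk_add_hom (φ φ' : d ⟶ (T.obj b).obj c) (s : F.sec b) (t : G.sec c) :
    mk (φ + φ') s t = mk φ s t + mk φ' s t := by
  have h := mkQ_eq_zero (Relator.add_hom φ φ' s t)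
  rw [map_sub, map_sub, sub_sub, sub_eq_zero] at h
  exact h

lemma mk_smul_hom (r : K) (φ : d ⟶ (T.obj b).obj c) (s : F.sec b) (t : G.sec c) :
    mk (r • φ) s t = r • mk φ s t := by
  have h := mkQ_eq_zero (Relator.smul_hom r φ s t)
  rw [map_sub, map_smul, sub_eq_zero] at h
  exact h

lemma mk_add_left (φ : d ⟶ (T.obj b).obj c) (s s' : F.sec b) (t : G.sec c) :
    mk φ (s + s') t = mk φ s t + mk φ s' t := by
  have h := mkQ_eq_zero (Relator.add_left φ s s' t)
  rw [map_sub, map_sub, sub_sub, sub_eq_zero] at h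
  exact h

lemma mk_smul_left (r : K) (φ : d ⟶ (T.obj b).obj c) (s : F.sec b) (t : G.sec c) :
    mk φ (r • s) t = r • mk φ s t := by
  have h := mkQ_eq_zero (Relator.smul_left r φ s t)
  rw [map_sub, map_smul, sub_eq_zero] at h
  exact h

lemma mk_add_right (φ : d ⟶ (T.obj b).obj c) (s : F.sec b) (t t' : G.sec c) :
    mk φ s (t + t') = mk φ s t + mk φ s t' := by
  have h := mkQ_eq_zero (Relator.add_right φ s t t')
  rw [map_sub, map_sub, sub_sub, sub_eq_zero] at h
  exact h

lemma mk_smul_right (r : K) (φ : d ⟶ (T.obj b).obj c) (s : F.sec b) (t : G.sec c) :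
    mk φ s (r • t) = r • mk φ s t := by
  have h := mkQ_eq_zero (Relator.smul_right r φ s t)
  rw [map_sub, map_smul, sub_eq_zero] at h
  exact h

lemma mk_res_left (f : b ⟶ b') (φ : d ⟶ (T.obj b).obj c) (s : F.sec b') (t : G.sec c) :
    mk φ (F.res f s) t = mk (φ ≫ (T.map f).app c) s t := by
  have h := mkQ_eq_zero (Relator.dinat_left f φ s t)
  rw [map_sub, sub_eq_zero] at h
  exact h.symm

lemma mk_res_right (g : c ⟶ c') (φ : d ⟶ (T.obj b).obj c) (s : F.sec b) (t : G.sec c') :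
    mk φ s (G.res g t) = mk (φ ≫ (T.obj b).map g) s t := by
  have h := mkQ_eq_zero (Relator.dinat_right g φ s t)
  rw [map_sub, sub_eq_zero] at h
  exact h.symm

end

lemma ind {p : Coend T F G d → Prop}
    (h_mk : ∀ {b : B} {c : C} (φ : d ⟶ (T.obj b).obj c) (s : F.sec b) (t : G.sec c), p (mk φ s t))
    (h_zero : p 0) (h_add : ∀ x y, p x → p y → p (x + y)) (x : Coend T F G d) : p x := by
  obtain ⟨z, rfl⟩ := Submodule.mkQ_surjective _ x
  induction z using Finsupp.induction_linear with
  | zero => rw [map_zero]; exact h_zero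
  | add f g hf hg => rw [map_add]; exact h_add _ _ hf hg
  | single a r =>
    have h : (Submodule.span K {z | Relator T F G d z}).mkQ (Finsupp.single a r)
        = mk (r • a.φ) a.s a.t := by
      have e : Finsupp.single a r = r • gen a.φ a.s a.t := by simp [gen]
      rw [mk_smul_hom, e]
      exact map_smul _ _ _
    rw [h]
    exact h_mk _ _ _

variable (T F G d) in
/-- A trilinear dinatural family of maps `D(d, T(b,c)) × F(b) × G(c) → M`. -/
structure TriMap (M : Type*) [AddCommGroup M] [Module K M] where
  /-- the family of maps -/
  f : ∀ {b : B} {c : C}, (d ⟶ (T.obj b).obj c) → F.sec b → G.sec c → M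
  add_hom : ∀ {b : B} {c : C} (φ φ' : d ⟶ (T.obj b).obj c) (s : F.sec b) (t : G.sec c),
    f (φ + φ') s t = f φ s t + f φ' s t := by simp
  smul_hom : ∀ {b : B} {c : C} (r : K) (φ : d ⟶ (T.obj b).obj c) (s : F.sec b) (t : G.sec c),
    f (r • φ) s t = r • f φ s t := by simp
  add_left : ∀ {b : B} {c : C} (φ : d ⟶ (T.obj b).obj c) (s s' : F.sec b) (t : G.sec c),
    f φ (s + s') t = f φ s t + f φ s' t := by simp
  smul_left : ∀ {b : B} {c : C} (r : K) (φ : d ⟶ (T.obj b).obj c) (s : F.sec b) (t : G.sec c),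
    f φ (r • s) t = r • f φ s t := by simp
  add_right : ∀ {b : B} {c : C} (φ : d ⟶ (T.obj b).obj c) (s : F.sec b) (t t' : G.sec c),
    f φ s (t + t') = f φ s t + f φ s t' := by simp
  smul_right : ∀ {b : B} {c : C} (r : K) (φ : d ⟶ (T.obj b).obj c) (s : F.sec b) (t : G.sec c),
    f φ s (r • t) = r • f φ s t := by simp
  dinat_left : ∀ {b b' : B} {c : C} (g : b ⟶ b') (φ : d ⟶ (T.obj b).obj c) (s : F.sec b')
    (t : G.sec c), f (φ ≫ (T.map g).app c) s t = f φ (F.res g s) t := by simp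
  dinat_right : ∀ {b : B} {c c' : C} (g : c ⟶ c') (φ : d ⟶ (T.obj b).obj c) (s : F.sec b)
    (t : G.sec c'), f (φ ≫ (T.obj b).map g) s t = f φ s (G.res g t) := by simp

/-- The linear map out of the coend determined by its values on generators. -/
noncomputable def lift {M : Type*} [AddCommGroup M] [Module K M] (m : TriMap T F G d M) :
    Coend T F G d →ₗ[K] M :=
  (Submodule.span K {z | Relator T F G d z}).liftQ
    (Finsupp.linearCombination K (fun a : Gen T F G d => m.f a.φ a.s a.t)) (by
      rw [Submodule.span_le]
      intro z hz
      have hg : ∀ {b : B} {c : C} (φ : d ⟶ (T.obj b).obj c) (s : F.sec b) (t : G.sec c),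
        Finsupp.linearCombination K (fun a : Gen T F G d => m.f a.φ a.s a.t) (gen φ s t)
          = m.f φ s t := fun φ s t => by simp [gen]
      rw [SetLike.mem_coe, LinearMap.mem_ker]
      cases hz with
      | add_hom φ φ' s t => simp only [map_sub, hg, m.add_hom]; abel
      | smul_hom r φ s t => simp only [map_sub, map_smul, hg, m.smul_hom, sub_self]
      | add_left φ s s' t => simp only [map_sub, hg, m.add_left]; abel
      | smul_left r φ s t => simp only [map_sub, map_smul, hg, m.smul_left, sub_self]
      | add_right φ s t t' => simp only [map_sub, hg, m.add_right]; abel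
      | smul_right r φ s t => simp only [map_sub, map_smul, hg, m.smul_right, sub_self]
      | dinat_left g φ s t => simp only [map_sub, hg, m.dinat_left, sub_self]
      | dinat_right g φ s t => simp only [map_sub, hg, m.dinat_right, sub_self])

lemma lift_mk {M : Type*} [AddCommGroup M] [Module K M] (m : TriMap T F G d M)
    {b : B} {c : C} (φ : d ⟶ (T.obj b).obj c) (s : F.sec b) (t : G.sec c) :
    lift m (mk φ s t) = m.f φ s t := by
  have h : lift m (mk φ s t) =
      Finsupp.linearCombination K (fun a : Gen T F G d => m.f a.φ a.s a.t) (gen φ s t) :=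
    Submodule.liftQ_apply _ _ _
  rw [h]
  simp [gen]

variable (T F G) in
/-- Restriction maps of the Day convolution. -/
noncomputable def coendRes {d d' : D} (h : d ⟶ d') : Coend T F G d' →ₗ[K] Coend T F G d :=
  lift
    { f := fun φ s t => mk (h ≫ φ) s t
      add_hom := by simp [mk_add_hom]
      smul_hom := by simp [mk_smul_hom]
      add_left := by simp [mk_add_left]
      smul_left := by simp [mk_smul_left]
      add_right := by simp [mk_add_right]
      smul_right := by simp [mk_smul_right]
      dinat_left := by simp [mk_res_left]
      dinat_right := by simp [mk_res_right] }

lemma coendRes_mk {d' : D} (h : d' ⟶ d) {b : B} {c : C} (φ : d ⟶ (T.obj b).obj c)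
    (s : F.sec b) (t : G.sec c) : coendRes T F G h (mk φ s t) = mk (h ≫ φ) s t :=
  lift_mk _ _ _ _

variable (T F G) in
/-- The Day convolution of two linear presheaves along a functor `T` of two variables:
`d ↦ ∫^{b,c} D(d, T(b,c)) ⊗ F(b) ⊗ G(c)`. -/
noncomputable def conv : FreeCocompletion K D :=
  mkObj (fun d => Coend T F G d) (coendRes T F G)
    (fun d s => by
      induction s using ind with
      | h_mk φ s t => rw [coendRes_mk, Category.id_comp]
      | h_zero => simp only [map_zero]
      | h_add x y hx hy => simp only [map_add, hx, hy])
    (fun f g s => by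
      induction s using ind with
      | h_mk φ s t => rw [coendRes_mk, coendRes_mk, coendRes_mk, Category.assoc]
      | h_zero => simp only [map_zero]
      | h_add x y hx hy => simp only [map_add, hx, hy])
    (fun f g s => by
      induction s using ind with
      | h_mk φ s t =>
        rw [coendRes_mk, coendRes_mk, coendRes_mk, Preadditive.add_comp, mk_add_hom]
      | h_zero => simp only [map_zero, add_zero]
      | h_add x y hx hy => simp only [map_add, hx, hy]; abel)
    (fun r f s => by
      induction s using ind with
      | h_mk φ s t => rw [coendRes_mk, coendRes_mk, Linear.smul_comp, mk_smul_hom]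
      | h_zero => simp only [map_zero, smul_zero]
      | h_add x y hx hy => simp only [map_add, hx, hy, smul_add])

/-- A generator, as a section of the Day convolution. -/
noncomputable def cmk {b : B} {c : C} (φ : d ⟶ (T.obj b).obj c) (s : F.sec b) (t : G.sec c) :
    (conv T F G).sec d := mk φ s t

@[simp] lemma res_cmk {d' : D} (h : d' ⟶ d) {b : B} {c : C} (φ : d ⟶ (T.obj b).obj c)
    (s : F.sec b) (t : G.sec c) :
    (conv T F G).res h (cmk φ s t) = cmk (h ≫ φ) s t :=
  coendRes_mk _ _ _ _

lemma cind {p : (conv T F G).sec d → Prop}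
    (h_mk : ∀ {b : B} {c : C} (φ : d ⟶ (T.obj b).obj c) (s : F.sec b) (t : G.sec c),
      p (cmk φ s t))
    (h_zero : p 0) (h_add : ∀ x y, p x → p y → p (x + y)) (x : (conv T F G).sec d) : p x :=
  ind h_mk h_zero h_add x

/-- The linear map out of the sections of the Day convolution determined by a trilinear dinatural
family of maps. -/
noncomputable def clift {M : Type*} [AddCommGroup M] [Module K M] (m : TriMap T F G d M) :
    (conv T F G).sec d →ₗ[K] M :=
  lift m

@[simp] lemma clift_cmk {M : Type*} [AddCommGroup M] [Module K M] (m : TriMap T F G d M)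
    {b : B} {c : C} (φ : d ⟶ (T.obj b).obj c) (s : F.sec b) (t : G.sec c) :
    clift m (cmk φ s t) = m.f φ s t :=
  lift_mk _ _ _ _

section

variable {b b' : B} {c c' : C}

@[simp] lemma cmk_add_hom (φ φ' : d ⟶ (T.obj b).obj c) (s : F.sec b) (t : G.sec c) :
    cmk (φ + φ') s t = cmk φ s t + cmk φ' s t := mk_add_hom φ φ' s t

@[simp] lemma cmk_smul_hom (r : K) (φ : d ⟶ (T.obj b).obj c) (s : F.sec b) (t : G.sec c) :
    cmk (r • φ) s t = r • cmk φ s t := mk_smul_hom r φ s t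

@[simp] lemma cmk_add_left (φ : d ⟶ (T.obj b).obj c) (s s' : F.sec b) (t : G.sec c) :
    cmk φ (s + s') t = cmk φ s t + cmk φ s' t := mk_add_left φ s s' t

@[simp] lemma cmk_smul_left (r : K) (φ : d ⟶ (T.obj b).obj c) (s : F.sec b) (t : G.sec c) :
    cmk φ (r • s) t = r • cmk φ s t := mk_smul_left r φ s t

@[simp] lemma cmk_add_right (φ : d ⟶ (T.obj b).obj c) (s : F.sec b) (t t' : G.sec c) :
    cmk φ s (t + t') = cmk φ s t + cmk φ s t' := mk_add_right φ s t t'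

@[simp] lemma cmk_smul_right (r : K) (φ : d ⟶ (T.obj b).obj c) (s : F.sec b) (t : G.sec c) :
    cmk φ s (r • t) = r • cmk φ s t := mk_smul_right r φ s t

@[simp] lemma cmk_zero_left (φ : d ⟶ (T.obj b).obj c) (t : G.sec c) :
    cmk (F := F) φ 0 t = 0 := by
  simpa using cmk_smul_left (F := F) 0 φ 0 t

@[simp] lemma cmk_zero_right (φ : d ⟶ (T.obj b).obj c) (s : F.sec b) :
    cmk (G := G) φ s 0 = 0 := by
  simpa using cmk_smul_right (G := G) 0 φ s 0

@[simp] lemma cmk_res_left (f : b ⟶ b') (φ : d ⟶ (T.obj b).obj c) (s : F.sec b') (t : G.sec c) :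
    cmk φ (F.res f s) t = cmk (φ ≫ (T.map f).app c) s t := mk_res_left f φ s t

@[simp] lemma cmk_res_right (g : c ⟶ c') (φ : d ⟶ (T.obj b).obj c) (s : F.sec b)
    (t : G.sec c') :
    cmk φ s (G.res g t) = cmk (φ ≫ (T.obj b).map g) s t := mk_res_right g φ s t

end

/-- A morphism out of a Day convolution, from compatible trilinear dinatural families. -/
noncomputable def desc {H : FreeCocompletion K D} (m : ∀ d, TriMap T F G d (H.sec d))
    (nat : ∀ {d d' : D} (h : d ⟶ d') {b : B} {c : C} (φ : d' ⟶ (T.obj b).obj c) (s : F.sec b)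
      (t : G.sec c), (m d).f (h ≫ φ) s t = H.res h ((m d').f φ s t)) : conv T F G ⟶ H :=
  mkHom (fun d => clift (m d)) (fun f s => by
      induction s using cind with
      | h_mk φ s t => rw [res_cmk, clift_cmk, clift_cmk, nat]
      | h_zero => simp only [map_zero]
      | h_add x y hx hy => simp only [map_add, hx, hy])

@[simp] lemma app_desc {H : FreeCocompletion K D} (m : ∀ d, TriMap T F G d (H.sec d)) (nat)
    {b : B} {c : C} (φ : d ⟶ (T.obj b).obj c) (s : F.sec b) (t : G.sec c) :
    app (desc m nat) d (cmk φ s t) = (m d).f φ s t :=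
  clift_cmk _ _ _ _

/-- Functoriality of the Day convolution in both presheaves. -/
noncomputable def map (T : B ⥤ C ⥤ D) {F F' : FreeCocompletion K B} {G G' : FreeCocompletion K C}
    (η : F ⟶ F') (θ : G ⟶ G') : conv T F G ⟶ conv T F' G' :=
  desc (fun d => { f := fun {b c} φ s t => cmk φ (app η b s) (app θ c t) }) (by simp)

@[simp] lemma app_map_cmk {F F' : FreeCocompletion K B} {G G' : FreeCocompletion K C}
    (η : F ⟶ F') (θ : G ⟶ G') {b : B} {c : C} (φ : d ⟶ (T.obj b).obj c) (s : F.sec b)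
    (t : G.sec c) : app (map T η θ) d (cmk φ s t) = cmk φ (app η b s) (app θ c t) :=
  app_desc _ _ _ _ _

lemma conv_hom_ext {H : FreeCocompletion K D} {η θ : conv T F G ⟶ H}
    (h : ∀ {d : D} {b : B} {c : C} (φ : d ⟶ (T.obj b).obj c) (s : F.sec b) (t : G.sec c),
      app η d (cmk φ s t) = app θ d (cmk φ s t)) : η = θ := by
  apply hom_ext'
  intro x s
  induction s using cind with
  | h_mk φ s t => exact h φ s t
  | h_zero => simp
  | h_add x y hx hy => rw [map_add, map_add, hx, hy]

lemma map_id : map T (𝟙 F) (𝟙 G) = 𝟙 _ := conv_hom_ext (by simp)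

lemma map_comp {F F' F'' : FreeCocompletion K B} {G G' G'' : FreeCocompletion K C}
    (η : F ⟶ F') (η' : F' ⟶ F'') (θ : G ⟶ G') (θ' : G' ⟶ G'') :
    map T (η ≫ η') (θ ≫ θ') = map T η θ ≫ map T η' θ' := conv_hom_ext (by simp)

/-! #### Unit constraints -/

section Unitors

variable {Y A : Type u} [SmallCategory Y] [SmallCategory A]

/-- A natural family of isomorphisms `T(e, y) ≅ y`. -/
structure LeftUnit (T : A ⥤ Y ⥤ Y) (e : A) where
  /-- the isomorphisms -/
  iso : ∀ y, (T.obj e).obj y ≅ y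
  nat : ∀ {y y' : Y} (f : y ⟶ y'), (T.obj e).map f ≫ (iso y').hom = (iso y).hom ≫ f

/-- A natural family of isomorphisms `T(y, e) ≅ y`. -/
structure RightUnit (T : Y ⥤ A ⥤ Y) (e : A) where
  /-- the isomorphisms -/
  iso : ∀ y, (T.obj y).obj e ≅ y
  nat : ∀ {y y' : Y} (f : y ⟶ y'), (T.map f).app e ≫ (iso y').hom = (iso y).hom ≫ f

variable [Preadditive Y] [Preadditive A] [Linear K Y] [Linear K A]

/-- The map `Hom(-, e) ⊛ F ⟶ F` induced by `T(e, y) ≅ y`. -/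
noncomputable def leftUnitHom (T : A ⥤ Y ⥤ Y) [IsBilinear K T] (e : A) (l : LeftUnit T e)
    (F : FreeCocompletion K Y) : conv T (rep K e) F ⟶ F :=
  desc (fun d =>
    { f := fun {b c} φ u t => F.res (φ ≫ (T.map (toHom u)).app c ≫ (l.iso c).hom) t
      add_hom := by simp [res_add]
      smul_hom := by simp [res_smul]
      add_left := by simp [res_add, IsBilinear.map_add_left (K := K)]
      smul_left := by simp [res_smul, IsBilinear.map_smul_left (K := K)]
      dinat_right := by simp [← l.nat] }) (by simp)

/-- The map `F ⟶ Hom(-, e) ⊛ F` induced by `T(e, y) ≅ y`. -/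
noncomputable def leftUnitInv (T : A ⥤ Y ⥤ Y) (e : A) (l : LeftUnit T e)
    (F : FreeCocompletion K Y) : F ⟶ conv T (rep K e) F :=
  mkHom (fun d =>
    { toFun := fun s => cmk (l.iso d).inv (ofHom (𝟙 e)) s
      map_add' := by simp
      map_smul' := by simp }) (fun {x y} f s => by
        have h : (l.iso x).inv ≫ (T.obj e).map f = f ≫ (l.iso y).inv := by
          rw [Iso.inv_comp_eq, ← Category.assoc, ← l.nat, Category.assoc, Iso.hom_inv_id,
            Category.comp_id]
        simp [h])

section

variable (T : A ⥤ Y ⥤ Y) (e : A) (l : LeftUnit T e) (F : FreeCocompletion K Y)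

@[simp] lemma app_leftUnitInv {d : Y} (s : F.sec d) :
    app (leftUnitInv T e l F) d s = cmk (l.iso d).inv (ofHom (𝟙 e)) s := rfl

variable [IsBilinear K T]

@[simp] lemma app_leftUnitHom {d : Y} {b : A} {c : Y} (φ : d ⟶ (T.obj b).obj c)
    (u : (rep K e).sec b) (t : F.sec c) : app (leftUnitHom T e l F) d (cmk φ u t) =
      F.res (φ ≫ (T.map (toHom u)).app c ≫ (l.iso c).hom) t := by
  rw [leftUnitHom, app_desc]

/-- A unit isomorphism `T(e, y) ≅ y` induces `Hom(-, e) ⊛ F ≅ F`. -/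
noncomputable def leftUnit : conv T (rep K e) F ≅ F where
  hom := leftUnitHom T e l F
  inv := leftUnitInv T e l F
  hom_inv_id := conv_hom_ext (fun φ s t => by
    rw [eq_res s]
    simp)
  inv_hom_id := hom_ext' (by simp)

end

/-- The map `F ⊛ Hom(-, e) ⟶ F` induced by `T(y, e) ≅ y`. -/
noncomputable def rightUnitHom (T : Y ⥤ A ⥤ Y) [IsBilinear K T] (e : A) (l : RightUnit T e)
    (F : FreeCocompletion K Y) : conv T F (rep K e) ⟶ F :=
  desc (fun d =>
    { f := fun {b c} φ t u => F.res (φ ≫ (T.obj b).map (toHom u) ≫ (l.iso b).hom) t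
      add_hom := by simp [res_add]
      smul_hom := by simp [res_smul]
      add_right := by simp [res_add, IsBilinear.map_add_right (K := K)]
      smul_right := by simp [res_smul, IsBilinear.map_smul_right (K := K)]
      dinat_left := fun g φ s t => by
        rw [res_res]
        simp only [Category.assoc]
        rw [← l.nat, ← NatTrans.naturality_assoc] }) (by simp)

/-- The map `F ⟶ F ⊛ Hom(-, e)` induced by `T(y, e) ≅ y`. -/
noncomputable def rightUnitInv (T : Y ⥤ A ⥤ Y) (e : A) (l : RightUnit T e)
    (F : FreeCocompletion K Y) : F ⟶ conv T F (rep K e) :=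
  mkHom (fun d =>
    { toFun := fun s => cmk (l.iso d).inv s (ofHom (𝟙 e))
      map_add' := by simp
      map_smul' := by simp }) (fun {x y} f s => by
        have h : (l.iso x).inv ≫ (T.map f).app e = f ≫ (l.iso y).inv := by
          rw [Iso.inv_comp_eq, ← Category.assoc, ← l.nat, Category.assoc, Iso.hom_inv_id,
            Category.comp_id]
        simp [h])

section

variable (T : Y ⥤ A ⥤ Y) (e : A) (l : RightUnit T e) (F : FreeCocompletion K Y)

@[simp] lemma app_rightUnitInv {d : Y} (s : F.sec d) :
    app (rightUnitInv T e l F) d s = cmk (l.iso d).inv s (ofHom (𝟙 e)) := rfl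

variable [IsBilinear K T]

@[simp] lemma app_rightUnitHom {d : Y} {b : Y} {c : A} (φ : d ⟶ (T.obj b).obj c)
    (t : F.sec b) (u : (rep K e).sec c) : app (rightUnitHom T e l F) d (cmk φ t u) =
      F.res (φ ≫ (T.obj b).map (toHom u) ≫ (l.iso b).hom) t := by
  rw [rightUnitHom, app_desc]

/-- A unit isomorphism `T(y, e) ≅ y` induces `F ⊛ Hom(-, e) ≅ F`. -/
noncomputable def rightUnit : conv T F (rep K e) ≅ F where
  hom := rightUnitHom T e l F
  inv := rightUnitInv T e l F
  hom_inv_id := conv_hom_ext (fun φ s t => by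
    rw [eq_res t]
    simp)
  inv_hom_id := hom_ext' (by simp)

end

end Unitors

/-! #### Associativity constraints -/

section Associators

variable {B₁ B₂ B₃ B₁₂ B₂₃ E : Type u} [SmallCategory B₁] [SmallCategory B₂] [SmallCategory B₃]
variable [SmallCategory B₁₂] [SmallCategory B₂₃] [SmallCategory E]

/-- A family of associativity isomorphisms `T(S(b₁,b₂),b₃) ≅ V(b₁,U(b₂,b₃))`, natural in all three
variables. -/
structure Assoc (S : B₁ ⥤ B₂ ⥤ B₁₂) (T : B₁₂ ⥤ B₃ ⥤ E) (U : B₂ ⥤ B₃ ⥤ B₂₃)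
    (V : B₁ ⥤ B₂₃ ⥤ E) where
  /-- the isomorphisms -/
  iso : ∀ b₁ b₂ b₃, (T.obj ((S.obj b₁).obj b₂)).obj b₃ ≅ (V.obj b₁).obj ((U.obj b₂).obj b₃)
  nat₁ : ∀ {b₁ b₁' : B₁} (f : b₁ ⟶ b₁') (b₂ : B₂) (b₃ : B₃),
    (T.map ((S.map f).app b₂)).app b₃ ≫ (iso b₁' b₂ b₃).hom =
      (iso b₁ b₂ b₃).hom ≫ (V.map f).app ((U.obj b₂).obj b₃)
  nat₂ : ∀ (b₁ : B₁) {b₂ b₂' : B₂} (f : b₂ ⟶ b₂') (b₃ : B₃),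
    (T.map ((S.obj b₁).map f)).app b₃ ≫ (iso b₁ b₂' b₃).hom =
      (iso b₁ b₂ b₃).hom ≫ (V.obj b₁).map ((U.map f).app b₃)
  nat₃ : ∀ (b₁ : B₁) (b₂ : B₂) {b₃ b₃' : B₃} (f : b₃ ⟶ b₃'),
    (T.obj ((S.obj b₁).obj b₂)).map f ≫ (iso b₁ b₂ b₃').hom =
      (iso b₁ b₂ b₃).hom ≫ (V.obj b₁).map ((U.obj b₂).map f)

namespace Assoc

variable {S : B₁ ⥤ B₂ ⥤ B₁₂} {T : B₁₂ ⥤ B₃ ⥤ E} {U : B₂ ⥤ B₃ ⥤ B₂₃} {V : B₁ ⥤ B₂₃ ⥤ E}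

section

variable (a : Assoc S T U V)

lemma inv_nat₁ {b₁ b₁' : B₁} (f : b₁ ⟶ b₁') (b₂ : B₂) (b₃ : B₃) :
    (V.map f).app ((U.obj b₂).obj b₃) ≫ (a.iso b₁' b₂ b₃).inv =
      (a.iso b₁ b₂ b₃).inv ≫ (T.map ((S.map f).app b₂)).app b₃ := by
  rw [Iso.eq_inv_comp, ← Category.assoc, ← a.nat₁, Category.assoc, Iso.hom_inv_id,
    Category.comp_id]

lemma inv_nat₂ (b₁ : B₁) {b₂ b₂' : B₂} (f : b₂ ⟶ b₂') (b₃ : B₃) :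
    (V.obj b₁).map ((U.map f).app b₃) ≫ (a.iso b₁ b₂' b₃).inv =
      (a.iso b₁ b₂ b₃).inv ≫ (T.map ((S.obj b₁).map f)).app b₃ := by
  rw [Iso.eq_inv_comp, ← Category.assoc, ← a.nat₂, Category.assoc, Iso.hom_inv_id,
    Category.comp_id]

lemma inv_nat₃ (b₁ : B₁) (b₂ : B₂) {b₃ b₃' : B₃} (f : b₃ ⟶ b₃') :
    (V.obj b₁).map ((U.obj b₂).map f) ≫ (a.iso b₁ b₂ b₃').inv =
      (a.iso b₁ b₂ b₃).inv ≫ (T.obj ((S.obj b₁).obj b₂)).map f := by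
  rw [Iso.eq_inv_comp, ← Category.assoc, ← a.nat₃, Category.assoc, Iso.hom_inv_id,
    Category.comp_id]

end

variable [Preadditive B₁] [Preadditive B₂] [Preadditive B₃] [Preadditive B₁₂] [Preadditive B₂₃]
variable [Preadditive E] [Linear K B₁] [Linear K B₂] [Linear K B₃] [Linear K B₁₂] [Linear K B₂₃]
variable [Linear K E]
variable (a : Assoc S T U V)
variable (F₁ : FreeCocompletion K B₁) (F₂ : FreeCocompletion K B₂) (F₃ : FreeCocompletion K B₃)

section

variable [IsBilinear K T]

/-- Auxiliary map for `Assoc.hom`: the morphism `φ` and the third section are fixed. -/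
noncomputable def homAux {e : E} {x : B₁₂} {b₃ : B₃} (φ : e ⟶ (T.obj x).obj b₃) (s₃ : F₃.sec b₃) :
    (conv S F₁ F₂).sec x →ₗ[K] (conv V F₁ (conv U F₂ F₃)).sec e :=
  clift
    { f := fun {b₁ b₂} ψ s₁ s₂ => cmk (φ ≫ (T.map ψ).app b₃ ≫ (a.iso b₁ b₂ b₃).hom) s₁
        (cmk (𝟙 _) s₂ s₃)
      add_hom := by simp [IsBilinear.map_add_left (K := K)]
      smul_hom := by simp [IsBilinear.map_smul_left (K := K)]
      dinat_left := by simp [a.nat₁]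
      dinat_right := fun g ψ s t => by
        have h : cmk (T := U) (𝟙 _) (F₂.res g t) s₃ =
          (conv U F₂ F₃).res ((U.map g).app b₃) (cmk (𝟙 _) t s₃) := by simp
        rw [h, cmk_res_right]
        simp [a.nat₂] }

@[simp] lemma homAux_cmk {e : E} {x : B₁₂} {b₃ : B₃} (φ : e ⟶ (T.obj x).obj b₃) (s₃ : F₃.sec b₃)
    {b₁ : B₁} {b₂ : B₂} (ψ : x ⟶ (S.obj b₁).obj b₂) (s₁ : F₁.sec b₁) (s₂ : F₂.sec b₂) :
    a.homAux F₁ F₂ F₃ φ s₃ (cmk ψ s₁ s₂) =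
      cmk (φ ≫ (T.map ψ).app b₃ ≫ (a.iso b₁ b₂ b₃).hom) s₁ (cmk (𝟙 _) s₂ s₃) := by
  rw [homAux, clift_cmk]

lemma homAux_add_hom {e : E} {x : B₁₂} {b₃ : B₃} (φ φ' : e ⟶ (T.obj x).obj b₃)
    (P : (conv S F₁ F₂).sec x) (s₃ : F₃.sec b₃) :
    a.homAux F₁ F₂ F₃ (φ + φ') s₃ P = a.homAux F₁ F₂ F₃ φ s₃ P + a.homAux F₁ F₂ F₃ φ' s₃ P := by
  induction P using cind with
  | h_mk ψ s t => simp
  | h_zero => simp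
  | h_add x y hx hy => simp only [map_add, hx, hy]; abel

lemma homAux_smul_hom {e : E} {x : B₁₂} {b₃ : B₃} (r : K) (φ : e ⟶ (T.obj x).obj b₃)
    (P : (conv S F₁ F₂).sec x) (s₃ : F₃.sec b₃) :
    a.homAux F₁ F₂ F₃ (r • φ) s₃ P = r • a.homAux F₁ F₂ F₃ φ s₃ P := by
  induction P using cind with
  | h_mk ψ s t => simp
  | h_zero => simp
  | h_add x y hx hy => simp only [map_add, hx, hy, smul_add]

lemma homAux_add_right {e : E} {x : B₁₂} {b₃ : B₃} (φ : e ⟶ (T.obj x).obj b₃)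
    (P : (conv S F₁ F₂).sec x) (s₃ s₃' : F₃.sec b₃) :
    a.homAux F₁ F₂ F₃ φ (s₃ + s₃') P =
      a.homAux F₁ F₂ F₃ φ s₃ P + a.homAux F₁ F₂ F₃ φ s₃' P := by
  induction P using cind with
  | h_mk ψ s t => simp
  | h_zero => simp
  | h_add x y hx hy => simp only [map_add, hx, hy]; abel

lemma homAux_smul_right {e : E} {x : B₁₂} {b₃ : B₃} (r : K) (φ : e ⟶ (T.obj x).obj b₃)
    (P : (conv S F₁ F₂).sec x) (s₃ : F₃.sec b₃) :
    a.homAux F₁ F₂ F₃ φ (r • s₃) P = r • a.homAux F₁ F₂ F₃ φ s₃ P := by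
  induction P using cind with
  | h_mk ψ s t => simp
  | h_zero => simp
  | h_add x y hx hy => simp only [map_add, hx, hy, smul_add]

lemma homAux_left {e : E} {x x' : B₁₂} {b₃ : B₃} (g : x ⟶ x') (φ : e ⟶ (T.obj x).obj b₃)
    (P : (conv S F₁ F₂).sec x') (s₃ : F₃.sec b₃) :
    a.homAux F₁ F₂ F₃ (φ ≫ (T.map g).app b₃) s₃ P =
      a.homAux F₁ F₂ F₃ φ s₃ ((conv S F₁ F₂).res g P) := by
  induction P using cind with
  | h_mk ψ s t => simp
  | h_zero => simp
  | h_add x y hx hy => simp only [map_add, hx, hy]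

lemma homAux_right {e : E} {x : B₁₂} {b₃ b₃' : B₃} (g : b₃ ⟶ b₃') (φ : e ⟶ (T.obj x).obj b₃)
    (P : (conv S F₁ F₂).sec x) (s₃ : F₃.sec b₃') :
    a.homAux F₁ F₂ F₃ (φ ≫ (T.obj x).map g) s₃ P =
      a.homAux F₁ F₂ F₃ φ (F₃.res g s₃) P := by
  induction P using cind with
  | @h_mk b₁ b₂ ψ s t =>
    have h : cmk (T := U) (𝟙 _) t (F₃.res g s₃) =
      (conv U F₂ F₃).res ((U.obj b₂).map g) (cmk (𝟙 _) t s₃) := by simp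
    rw [homAux_cmk, homAux_cmk, h, cmk_res_right]
    simp [← a.nat₃]
  | h_zero => simp
  | h_add x y hx hy => simp only [map_add, hx, hy]

lemma homAux_res {e e' : E} {x : B₁₂} {b₃ : B₃} (h : e ⟶ e') (φ : e' ⟶ (T.obj x).obj b₃)
    (P : (conv S F₁ F₂).sec x) (s₃ : F₃.sec b₃) :
    a.homAux F₁ F₂ F₃ (h ≫ φ) s₃ P =
      (conv V F₁ (conv U F₂ F₃)).res h (a.homAux F₁ F₂ F₃ φ s₃ P) := by
  induction P using cind with
  | h_mk ψ s t => simp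
  | h_zero => simp
  | h_add x y hx hy => simp only [map_add, hx, hy]

/-- The map `(F₁ ⊛ F₂) ⊛ F₃ ⟶ F₁ ⊛ (F₂ ⊛ F₃)`. -/
noncomputable def hom : conv T (conv S F₁ F₂) F₃ ⟶ conv V F₁ (conv U F₂ F₃) :=
  desc (fun _ =>
    { f := fun φ P s₃ => a.homAux F₁ F₂ F₃ φ s₃ P
      add_hom := fun φ φ' P s₃ => a.homAux_add_hom F₁ F₂ F₃ φ φ' P s₃
      smul_hom := fun r φ P s₃ => a.homAux_smul_hom F₁ F₂ F₃ r φ P s₃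
      add_right := fun φ P s₃ s₃' => a.homAux_add_right F₁ F₂ F₃ φ P s₃ s₃'
      smul_right := fun r φ P s₃ => a.homAux_smul_right F₁ F₂ F₃ r φ P s₃
      dinat_left := fun g φ P s₃ => a.homAux_left F₁ F₂ F₃ g φ P s₃
      dinat_right := fun g φ P s₃ => a.homAux_right F₁ F₂ F₃ g φ P s₃ })
    (fun h _ _ φ P s₃ => a.homAux_res F₁ F₂ F₃ h φ P s₃)

@[simp] lemma app_hom {e : E} {x : B₁₂} {b₃ : B₃} (φ : e ⟶ (T.obj x).obj b₃)
    {b₁ : B₁} {b₂ : B₂} (ψ : x ⟶ (S.obj b₁).obj b₂) (s₁ : F₁.sec b₁) (s₂ : F₂.sec b₂)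
    (s₃ : F₃.sec b₃) :
    app (a.hom F₁ F₂ F₃) e (cmk φ (cmk ψ s₁ s₂) s₃) =
      cmk (φ ≫ (T.map ψ).app b₃ ≫ (a.iso b₁ b₂ b₃).hom) s₁ (cmk (𝟙 _) s₂ s₃) := by
  rw [hom, app_desc]
  exact a.homAux_cmk F₁ F₂ F₃ φ s₃ ψ s₁ s₂

end

section

variable [IsBilinear K V]

/-- Auxiliary map for `Assoc.inv`: the morphism `φ` and the first section are fixed. -/
noncomputable def invAux {e : E} {b₁ : B₁} {x : B₂₃} (φ : e ⟶ (V.obj b₁).obj x) (s₁ : F₁.sec b₁) :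
    (conv U F₂ F₃).sec x →ₗ[K] (conv T (conv S F₁ F₂) F₃).sec e :=
  clift
    { f := fun {b₂ b₃} ψ s₂ s₃ => cmk (φ ≫ (V.obj b₁).map ψ ≫ (a.iso b₁ b₂ b₃).inv)
        (cmk (𝟙 _) s₁ s₂) s₃
      add_hom := by simp [IsBilinear.map_add_right (K := K)]
      smul_hom := by simp [IsBilinear.map_smul_right (K := K)]
      dinat_left := fun g ψ s t => by
        have h : cmk (T := S) (𝟙 _) s₁ (F₂.res g s) =
          (conv S F₁ F₂).res ((S.obj b₁).map g) (cmk (𝟙 _) s₁ s) := by simp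
        rw [h, cmk_res_left]
        simp [a.inv_nat₂]
      dinat_right := by simp [a.inv_nat₃] }

@[simp] lemma invAux_cmk {e : E} {b₁ : B₁} {x : B₂₃} (φ : e ⟶ (V.obj b₁).obj x) (s₁ : F₁.sec b₁)
    {b₂ : B₂} {b₃ : B₃} (ψ : x ⟶ (U.obj b₂).obj b₃) (s₂ : F₂.sec b₂) (s₃ : F₃.sec b₃) :
    a.invAux F₁ F₂ F₃ φ s₁ (cmk ψ s₂ s₃) =
      cmk (φ ≫ (V.obj b₁).map ψ ≫ (a.iso b₁ b₂ b₃).inv) (cmk (𝟙 _) s₁ s₂) s₃ := by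
  rw [invAux, clift_cmk]

lemma invAux_add_hom {e : E} {b₁ : B₁} {x : B₂₃} (φ φ' : e ⟶ (V.obj b₁).obj x)
    (s₁ : F₁.sec b₁) (P : (conv U F₂ F₃).sec x) :
    a.invAux F₁ F₂ F₃ (φ + φ') s₁ P = a.invAux F₁ F₂ F₃ φ s₁ P + a.invAux F₁ F₂ F₃ φ' s₁ P := by
  induction P using cind with
  | h_mk ψ s t => simp
  | h_zero => simp
  | h_add x y hx hy => simp only [map_add, hx, hy]; abel

lemma invAux_smul_hom {e : E} {b₁ : B₁} {x : B₂₃} (r : K) (φ : e ⟶ (V.obj b₁).obj x)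
    (s₁ : F₁.sec b₁) (P : (conv U F₂ F₃).sec x) :
    a.invAux F₁ F₂ F₃ (r • φ) s₁ P = r • a.invAux F₁ F₂ F₃ φ s₁ P := by
  induction P using cind with
  | h_mk ψ s t => simp
  | h_zero => simp
  | h_add x y hx hy => simp only [map_add, hx, hy, smul_add]

lemma invAux_add_left {e : E} {b₁ : B₁} {x : B₂₃} (φ : e ⟶ (V.obj b₁).obj x)
    (s₁ s₁' : F₁.sec b₁) (P : (conv U F₂ F₃).sec x) :
    a.invAux F₁ F₂ F₃ φ (s₁ + s₁') P =
      a.invAux F₁ F₂ F₃ φ s₁ P + a.invAux F₁ F₂ F₃ φ s₁' P := by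
  induction P using cind with
  | h_mk ψ s t => simp
  | h_zero => simp
  | h_add x y hx hy => simp only [map_add, hx, hy]; abel

lemma invAux_smul_left {e : E} {b₁ : B₁} {x : B₂₃} (r : K) (φ : e ⟶ (V.obj b₁).obj x)
    (s₁ : F₁.sec b₁) (P : (conv U F₂ F₃).sec x) :
    a.invAux F₁ F₂ F₃ φ (r • s₁) P = r • a.invAux F₁ F₂ F₃ φ s₁ P := by
  induction P using cind with
  | h_mk ψ s t => simp
  | h_zero => simp
  | h_add x y hx hy => simp only [map_add, hx, hy, smul_add]

lemma invAux_left {e : E} {b₁ b₁' : B₁} {x : B₂₃} (g : b₁ ⟶ b₁') (φ : e ⟶ (V.obj b₁).obj x)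
    (s₁ : F₁.sec b₁') (P : (conv U F₂ F₃).sec x) :
    a.invAux F₁ F₂ F₃ (φ ≫ (V.map g).app x) s₁ P =
      a.invAux F₁ F₂ F₃ φ (F₁.res g s₁) P := by
  induction P using cind with
  | @h_mk b₂ b₃ ψ s t =>
    have h : cmk (T := S) (𝟙 _) (F₁.res g s₁) s =
      (conv S F₁ F₂).res ((S.map g).app b₂) (cmk (𝟙 _) s₁ s) := by simp
    rw [invAux_cmk, invAux_cmk, h, cmk_res_left]
    simp [← a.inv_nat₁]
  | h_zero => simp
  | h_add x y hx hy => simp only [map_add, hx, hy]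

lemma invAux_right {e : E} {b₁ : B₁} {x x' : B₂₃} (g : x ⟶ x') (φ : e ⟶ (V.obj b₁).obj x)
    (s₁ : F₁.sec b₁) (P : (conv U F₂ F₃).sec x') :
    a.invAux F₁ F₂ F₃ (φ ≫ (V.obj b₁).map g) s₁ P =
      a.invAux F₁ F₂ F₃ φ s₁ ((conv U F₂ F₃).res g P) := by
  induction P using cind with
  | h_mk ψ s t => simp
  | h_zero => simp
  | h_add x y hx hy => simp only [map_add, hx, hy]

lemma invAux_res {e e' : E} {b₁ : B₁} {x : B₂₃} (h : e ⟶ e') (φ : e' ⟶ (V.obj b₁).obj x)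
    (s₁ : F₁.sec b₁) (P : (conv U F₂ F₃).sec x) :
    a.invAux F₁ F₂ F₃ (h ≫ φ) s₁ P =
      (conv T (conv S F₁ F₂) F₃).res h (a.invAux F₁ F₂ F₃ φ s₁ P) := by
  induction P using cind with
  | h_mk ψ s t => simp
  | h_zero => simp
  | h_add x y hx hy => simp only [map_add, hx, hy]

/-- The map `F₁ ⊛ (F₂ ⊛ F₃) ⟶ (F₁ ⊛ F₂) ⊛ F₃`. -/
noncomputable def inv : conv V F₁ (conv U F₂ F₃) ⟶ conv T (conv S F₁ F₂) F₃ :=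
  desc (fun _ =>
    { f := fun φ s₁ P => a.invAux F₁ F₂ F₃ φ s₁ P
      add_hom := fun φ φ' s₁ P => a.invAux_add_hom F₁ F₂ F₃ φ φ' s₁ P
      smul_hom := fun r φ s₁ P => a.invAux_smul_hom F₁ F₂ F₃ r φ s₁ P
      add_left := fun φ s₁ s₁' P => a.invAux_add_left F₁ F₂ F₃ φ s₁ s₁' P
      smul_left := fun r φ s₁ P => a.invAux_smul_left F₁ F₂ F₃ r φ s₁ P
      dinat_left := fun g φ s₁ P => a.invAux_left F₁ F₂ F₃ g φ s₁ P
      dinat_right := fun g φ s₁ P => a.invAux_right F₁ F₂ F₃ g φ s₁ P })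
    (fun h _ _ φ s₁ P => a.invAux_res F₁ F₂ F₃ h φ s₁ P)

@[simp] lemma app_inv {e : E} {b₁ : B₁} {x : B₂₃} (φ : e ⟶ (V.obj b₁).obj x)
    {b₂ : B₂} {b₃ : B₃} (ψ : x ⟶ (U.obj b₂).obj b₃) (s₁ : F₁.sec b₁) (s₂ : F₂.sec b₂)
    (s₃ : F₃.sec b₃) :
    app (a.inv F₁ F₂ F₃) e (cmk φ s₁ (cmk ψ s₂ s₃)) =
      cmk (φ ≫ (V.obj b₁).map ψ ≫ (a.iso b₁ b₂ b₃).inv) (cmk (𝟙 _) s₁ s₂) s₃ := by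
  rw [inv, app_desc]
  exact a.invAux_cmk F₁ F₂ F₃ φ s₁ ψ s₂ s₃

end

lemma ext_left {H : FreeCocompletion K E} {η θ : conv T (conv S F₁ F₂) F₃ ⟶ H}
    (h : ∀ {e : E} {x : B₁₂} {b₃ : B₃} (φ : e ⟶ (T.obj x).obj b₃)
      {b₁ : B₁} {b₂ : B₂} (ψ : x ⟶ (S.obj b₁).obj b₂) (s₁ : F₁.sec b₁) (s₂ : F₂.sec b₂)
      (s₃ : F₃.sec b₃), app η e (cmk φ (cmk ψ s₁ s₂) s₃) = app θ e (cmk φ (cmk ψ s₁ s₂) s₃)) :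
    η = θ := by
  apply conv_hom_ext
  intro d b c φ P s₃
  induction P using cind with
  | h_mk ψ s t => exact h _ _ _ _ _
  | h_zero => simp
  | h_add x y hx hy => simp only [cmk_add_left, map_add, hx, hy]

lemma ext_right {H : FreeCocompletion K E} {η θ : conv V F₁ (conv U F₂ F₃) ⟶ H}
    (h : ∀ {e : E} {b₁ : B₁} {x : B₂₃} (φ : e ⟶ (V.obj b₁).obj x)
      {b₂ : B₂} {b₃ : B₃} (ψ : x ⟶ (U.obj b₂).obj b₃) (s₁ : F₁.sec b₁) (s₂ : F₂.sec b₂)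
      (s₃ : F₃.sec b₃), app η e (cmk φ s₁ (cmk ψ s₂ s₃)) = app θ e (cmk φ s₁ (cmk ψ s₂ s₃))) :
    η = θ := by
  apply conv_hom_ext
  intro d b c φ s₁ P
  induction P using cind with
  | h_mk ψ s t => exact h _ _ _ _ _
  | h_zero => simp
  | h_add x y hx hy => simp only [cmk_add_right, map_add, hx, hy]

end Assoc

section

variable {S : B₁ ⥤ B₂ ⥤ B₁₂} {T : B₁₂ ⥤ B₃ ⥤ E} {U : B₂ ⥤ B₃ ⥤ B₂₃} {V : B₁ ⥤ B₂₃ ⥤ E}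
variable [Preadditive B₁] [Preadditive B₂] [Preadditive B₃] [Preadditive B₁₂] [Preadditive B₂₃]
variable [Preadditive E] [Linear K B₁] [Linear K B₂] [Linear K B₃] [Linear K B₁₂] [Linear K B₂₃]
variable [Linear K E]
variable {F₁ : FreeCocompletion K B₁} {F₂ : FreeCocompletion K B₂} {F₃ : FreeCocompletion K B₃}

lemma cmk_cmk_right {e : E} {b₁ : B₁} {x : B₂₃} (φ : e ⟶ (V.obj b₁).obj x) {b₂ : B₂} {b₃ : B₃}
    (ψ : x ⟶ (U.obj b₂).obj b₃) (s₁ : F₁.sec b₁) (s₂ : F₂.sec b₂) (s₃ : F₃.sec b₃) :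
    cmk φ s₁ (cmk ψ s₂ s₃) = cmk (φ ≫ (V.obj b₁).map ψ) s₁ (cmk (T := U) (𝟙 _) s₂ s₃) := by
  rw [← cmk_res_right, res_cmk, Category.comp_id]

lemma cmk_cmk_left {e : E} {x : B₁₂} {b₃ : B₃} (φ : e ⟶ (T.obj x).obj b₃) {b₁ : B₁} {b₂ : B₂}
    (ψ : x ⟶ (S.obj b₁).obj b₂) (s₁ : F₁.sec b₁) (s₂ : F₂.sec b₂) (s₃ : F₃.sec b₃) :
    cmk φ (cmk ψ s₁ s₂) s₃ = cmk (φ ≫ (T.map ψ).app b₃) (cmk (T := S) (𝟙 _) s₁ s₂) s₃ := by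
  rw [← cmk_res_left, res_cmk, Category.comp_id]

end

namespace Assoc

variable {S : B₁ ⥤ B₂ ⥤ B₁₂} {T : B₁₂ ⥤ B₃ ⥤ E} {U : B₂ ⥤ B₃ ⥤ B₂₃} {V : B₁ ⥤ B₂₃ ⥤ E}
variable [Preadditive B₁] [Preadditive B₂] [Preadditive B₃] [Preadditive B₁₂] [Preadditive B₂₃]
variable [Preadditive E] [Linear K B₁] [Linear K B₂] [Linear K B₃] [Linear K B₁₂] [Linear K B₂₃]
variable [Linear K E] [IsBilinear K T] [IsBilinear K V]
variable (a : Assoc S T U V)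
variable (F₁ : FreeCocompletion K B₁) (F₂ : FreeCocompletion K B₂) (F₃ : FreeCocompletion K B₃)

/-- The associativity isomorphism `(F₁ ⊛ F₂) ⊛ F₃ ≅ F₁ ⊛ (F₂ ⊛ F₃)` induced by a natural
isomorphism `T(S(b₁,b₂),b₃) ≅ V(b₁,U(b₂,b₃))`. -/
noncomputable def convIso : conv T (conv S F₁ F₂) F₃ ≅ conv V F₁ (conv U F₂ F₃) where
  hom := a.hom F₁ F₂ F₃
  inv := a.inv F₁ F₂ F₃
  hom_inv_id := by
    apply ext_left
    intro e x b₃ φ b₁ b₂ ψ s₁ s₂ s₃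
    rw [app_comp, app_hom, app_inv, cmk_cmk_left φ ψ]
    simp
  inv_hom_id := by
    apply ext_right
    intro e b₁ x φ b₂ b₃ ψ s₁ s₂ s₃
    rw [app_comp, app_inv, app_hom, cmk_cmk_right φ ψ]
    simp

@[simp] lemma convIso_hom : (a.convIso F₁ F₂ F₃).hom = a.hom F₁ F₂ F₃ := rfl

@[simp] lemma convIso_inv : (a.convIso F₁ F₂ F₃).inv = a.inv F₁ F₂ F₃ := rfl

lemma hom_naturality {F₁' : FreeCocompletion K B₁} {F₂' : FreeCocompletion K B₂}
    {F₃' : FreeCocompletion K B₃} (η₁ : F₁ ⟶ F₁') (η₂ : F₂ ⟶ F₂') (η₃ : F₃ ⟶ F₃') :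
    map T (map S η₁ η₂) η₃ ≫ a.hom F₁' F₂' F₃' = a.hom F₁ F₂ F₃ ≫ map V η₁ (map U η₂ η₃) := by
  apply ext_left
  intros
  simp

end Assoc

end Associators

end Day

/-! ### Linear modules over a linear monoidal category -/

open MonoidalLeftAction MonoidalRightAction

/-- A right action of a monoidal category on a category is `K`-linear if the action bifunctor is
`K`-linear in each variable. -/
class LinearRightAction (K : Type*) [Field K] (A X : Type*) [Category* A] [Category* X]
    [Preadditive A] [Preadditive X] [Linear K A] [Linear K X] [MonoidalCategory A]
    [MonoidalRightAction A X] : Prop where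
  add_left : ∀ {x x' : X} (f g : x ⟶ x') (a : A), (f + g) ⊵ᵣ a = f ⊵ᵣ a + g ⊵ᵣ a
  smul_left : ∀ {x x' : X} (r : K) (f : x ⟶ x') (a : A), (r • f) ⊵ᵣ a = r • f ⊵ᵣ a
  add_right : ∀ (x : X) {a a' : A} (f g : a ⟶ a'), x ⊴ᵣ (f + g) = x ⊴ᵣ f + x ⊴ᵣ g
  smul_right : ∀ (x : X) {a a' : A} (r : K) (f : a ⟶ a'), x ⊴ᵣ (r • f) = r • x ⊴ᵣ f

/-- A left action of a monoidal category on a category is `K`-linear if the action bifunctor is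
`K`-linear in each variable. -/
class LinearLeftAction (K : Type*) [Field K] (A Y : Type*) [Category* A] [Category* Y]
    [Preadditive A] [Preadditive Y] [Linear K A] [Linear K Y] [MonoidalCategory A]
    [MonoidalLeftAction A Y] : Prop where
  add_left : ∀ {a a' : A} (f g : a ⟶ a') (y : Y), (f + g) ⊵ₗ y = f ⊵ₗ y + g ⊵ₗ y
  smul_left : ∀ {a a' : A} (r : K) (f : a ⟶ a') (y : Y), (r • f) ⊵ₗ y = r • f ⊵ₗ y
  add_right : ∀ (a : A) {y y' : Y} (f g : y ⟶ y'), a ⊴ₗ (f + g) = a ⊴ₗ f + a ⊴ₗ g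
  smul_right : ∀ (a : A) {y y' : Y} (r : K) (f : y ⟶ y'), a ⊴ₗ (r • f) = r • a ⊴ₗ f

/-- The bifunctor `(x, a) ↦ x ◁ a` of a right action. -/
@[simps]
def rightActionBifunctor (A X : Type*) [Category* A] [Category* X] [MonoidalCategory A]
    [MonoidalRightAction A X] : X ⥤ A ⥤ X where
  obj x := { obj := fun a => x ⊙ᵣ a, map := fun f => x ⊴ᵣ f }
  map f := { app := fun a => f ⊵ᵣ a, naturality := fun _ _ g => action_exchange _ _ }

/-- The bifunctor `(a, y) ↦ a ▷ y` of a left action. -/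
@[simps]
def leftActionBifunctor (A Y : Type*) [Category* A] [Category* Y] [MonoidalCategory A]
    [MonoidalLeftAction A Y] : A ⥤ Y ⥤ Y where
  obj a := { obj := fun y => a ⊙ₗ y, map := fun f => a ⊴ₗ f }
  map f := { app := fun y => f ⊵ₗ y, naturality := fun _ _ g => by simp [MonoidalLeftAction.action_exchange] }

section BaseCoherence

variable {A X Y : Type*} [Category* A] [Category* X] [Category* Y] [MonoidalCategory A]
variable [MonoidalRightAction A X] [MonoidalLeftAction A Y]

lemma right_pentagon_inv (x : X) (a b c : A) :
    (αᵣ x a b).inv ⊵ᵣ c ≫ (αᵣ x (a ⊗ b) c).inv ≫ x ⊴ᵣ (α_ a b c).hom =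
      (αᵣ (x ⊙ᵣ a) b c).inv ≫ (αᵣ x a (b ⊗ c)).inv := by
  rw [← cancel_mono (αᵣ x a (b ⊗ c)).hom, ← cancel_mono (αᵣ (x ⊙ᵣ a) b c).hom]
  simp only [Category.assoc]
  rw [MonoidalRightAction.actionHom_associator, Iso.inv_hom_id_assoc, Iso.inv_hom_id_assoc,
    Iso.inv_hom_id]
  simp

lemma right_pentagon_aux {e x b₁ c₁ : X} {c₂ b₂ b₃ : A} (φ : e ⟶ x ⊙ᵣ b₃) (ψ : x ⟶ b₁ ⊙ᵣ b₂)
    (χ : b₁ ⟶ c₁ ⊙ᵣ c₂) :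
    (φ ≫ (ψ ≫ χ ⊵ᵣ b₂ ≫ (αᵣ c₁ c₂ b₂).inv) ⊵ᵣ b₃ ≫ (αᵣ c₁ (c₂ ⊗ b₂) b₃).inv) ≫
      c₁ ⊴ᵣ (𝟙 ((c₂ ⊗ b₂) ⊗ b₃) ≫ (𝟙 (c₂ ⊗ b₂)) ▷ b₃ ≫ (α_ c₂ b₂ b₃).hom) =
      (φ ≫ ψ ⊵ᵣ b₃ ≫ (αᵣ b₁ b₂ b₃).inv) ≫ χ ⊵ᵣ (b₂ ⊗ b₃) ≫ (αᵣ c₁ c₂ (b₂ ⊗ b₃)).inv := by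
  simp [right_pentagon_inv]

lemma right_leftUnitor_aux {e x b₁ : X} {b₂ b₃ : A} (φ : e ⟶ x ⊙ᵣ b₃) (ψ : x ⟶ b₁ ⊙ᵣ b₂)
    (s : b₂ ⟶ 𝟙_ A) :
    (φ ≫ ψ ⊵ᵣ b₃ ≫ (αᵣ b₁ b₂ b₃).inv) ≫ b₁ ⊴ᵣ (𝟙 (b₂ ⊗ b₃) ≫ s ▷ b₃ ≫ (λ_ b₃).hom) =
      φ ≫ (ψ ≫ b₁ ⊴ᵣ s ≫ (ρᵣ b₁).hom) ⊵ᵣ b₃ := by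
  simp

lemma right_rightUnitor_aux {e x b₁ : X} {b₂ b₃ : A} (φ : e ⟶ x ⊙ᵣ b₃) (ψ : x ⟶ b₁ ⊙ᵣ b₂)
    (s : b₃ ⟶ 𝟙_ A) :
    (φ ≫ ψ ⊵ᵣ b₃ ≫ (αᵣ b₁ b₂ b₃).inv) ≫ b₁ ⊴ᵣ (𝟙 (b₂ ⊗ b₃) ≫ b₂ ◁ s ≫ (ρ_ b₂).hom) =
      (φ ≫ x ⊴ᵣ s ≫ (ρᵣ x).hom) ≫ ψ := by
  have h := MonoidalRightAction.action_exchange_assoc ψ s (ρᵣ (b₁ ⊙ᵣ b₂)).hom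
  rw [← MonoidalRightAction.actionUnitIso_hom_naturality] at h
  simp [h]

lemma left_pentagon_aux {e b₃ : Y} {x b₁ c₁ c₂ b₂ : A} (φ : e ⟶ x ⊙ₗ b₃) (ψ : x ⟶ b₁ ⊗ b₂)
    (χ : b₁ ⟶ c₁ ⊗ c₂) :
    (φ ≫ (ψ ≫ χ ▷ b₂ ≫ (α_ c₁ c₂ b₂).hom) ⊵ₗ b₃ ≫ (αₗ c₁ (c₂ ⊗ b₂) b₃).hom) ≫
      c₁ ⊴ₗ (𝟙 ((c₂ ⊗ b₂) ⊙ₗ b₃) ≫ (𝟙 (c₂ ⊗ b₂)) ⊵ₗ b₃ ≫ (αₗ c₂ b₂ b₃).hom) =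
      (φ ≫ ψ ⊵ₗ b₃ ≫ (αₗ b₁ b₂ b₃).hom) ≫ χ ⊵ₗ (b₂ ⊙ₗ b₃) ≫ (αₗ c₁ c₂ (b₂ ⊙ₗ b₃)).hom := by
  simp

lemma left_leftUnitor_aux {e b₃ : Y} {x b₁ b₂ : A} (φ : e ⟶ x ⊙ₗ b₃) (ψ : x ⟶ b₁ ⊗ b₂)
    (s : b₁ ⟶ 𝟙_ A) :
    φ ≫ (ψ ≫ s ▷ b₂ ≫ (λ_ b₂).hom) ⊵ₗ b₃ =
      (φ ≫ ψ ⊵ₗ b₃ ≫ (αₗ b₁ b₂ b₃).hom) ≫ s ⊵ₗ (b₂ ⊙ₗ b₃) ≫ (λₗ (b₂ ⊙ₗ b₃)).hom := by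
  simp

lemma left_rightUnitor_aux {e b₃ : Y} {x b₁ b₂ : A} (φ : e ⟶ x ⊙ₗ b₃) (ψ : x ⟶ b₁ ⊗ b₂)
    (s : b₂ ⟶ 𝟙_ A) :
    φ ≫ (ψ ≫ b₁ ◁ s ≫ (ρ_ b₁).hom) ⊵ₗ b₃ =
      (φ ≫ ψ ⊵ₗ b₃ ≫ (αₗ b₁ b₂ b₃).hom) ≫
        b₁ ⊴ₗ (𝟙 (b₂ ⊙ₗ b₃) ≫ s ⊵ₗ b₃ ≫ (λₗ b₃).hom) := by
  simp

end BaseCoherence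

section DayStructures

open FreeCocompletion Day

variable {K : Type u} [Field K]
variable {A X Y : Type u} [SmallCategory A] [SmallCategory X] [SmallCategory Y]
variable [Preadditive A] [Preadditive X] [Preadditive Y] [Linear K A] [Linear K X] [Linear K Y]
variable [MonoidalCategory A] [MonoidalPreadditive A] [MonoidalLinear K A]
variable [MonoidalRightAction A X] [LinearRightAction K A X]
variable [MonoidalLeftAction A Y] [LinearLeftAction K A Y]

instance : IsBilinear K (curriedTensor A) where
  map_add_left := by simp
  map_smul_left := by simp
  map_add_right := by simp
  map_smul_right := by simp

instance : IsBilinear K (rightActionBifunctor A X) where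
  map_add_left := LinearRightAction.add_left (K := K)
  map_smul_left := LinearRightAction.smul_left
  map_add_right := LinearRightAction.add_right (K := K)
  map_smul_right := LinearRightAction.smul_right

instance : IsBilinear K (leftActionBifunctor A Y) where
  map_add_left := LinearLeftAction.add_left (K := K)
  map_smul_left := LinearLeftAction.smul_left
  map_add_right := LinearLeftAction.add_right (K := K)
  map_smul_right := LinearLeftAction.smul_right

variable (A) in
/-- The associativity isomorphisms of the monoidal category. -/
def tensorAssoc : Assoc (curriedTensor A) (curriedTensor A) (curriedTensor A) (curriedTensor A) where
  iso a b c := α_ a b c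
  nat₁ := by simp
  nat₂ := by simp
  nat₃ := by simp

variable (A X) in
/-- The associativity isomorphisms of the right action. -/
def rightAssoc : Assoc (rightActionBifunctor A X) (rightActionBifunctor A X) (curriedTensor A)
    (rightActionBifunctor A X) where
  iso x a b := (αᵣ x a b).symm
  nat₁ {x x'} f a b := by
    change (f ⊵ᵣ a) ⊵ᵣ b ≫ (αᵣ x' a b).inv = (αᵣ x a b).inv ≫ f ⊵ᵣ (a ⊗ b)
    simp
  nat₂ x {a a'} f b := by
    change (x ⊴ᵣ f) ⊵ᵣ b ≫ (αᵣ x a' b).inv = (αᵣ x a b).inv ≫ x ⊴ᵣ (f ▷ b)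
    simp
  nat₃ x a {b b'} f := by
    change (x ⊙ᵣ a) ⊴ᵣ f ≫ (αᵣ x a b').inv = (αᵣ x a b).inv ≫ x ⊴ᵣ (a ◁ f)
    simp

variable (A Y) in
/-- The associativity isomorphisms of the left action. -/
def leftAssoc : Assoc (curriedTensor A) (leftActionBifunctor A Y) (leftActionBifunctor A Y)
    (leftActionBifunctor A Y) where
  iso a b y := αₗ a b y
  nat₁ {a a'} f b y := by
    change (f ▷ b) ⊵ₗ y ≫ (αₗ a' b y).hom = (αₗ a b y).hom ≫ f ⊵ₗ (b ⊙ₗ y)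
    simp
  nat₂ a {b b'} f y := by
    change (a ◁ f) ⊵ₗ y ≫ (αₗ a b' y).hom = (αₗ a b y).hom ≫ a ⊴ₗ (f ⊵ₗ y)
    simp
  nat₃ a b {y y'} f := by
    change (a ⊗ b) ⊴ₗ f ≫ (αₗ a b y').hom = (αₗ a b y).hom ≫ a ⊴ₗ (b ⊴ₗ f)
    simp

variable (A) in
/-- The left unit isomorphisms of the monoidal category. -/
def tensorLeftUnit : LeftUnit (curriedTensor A) (𝟙_ A) where
  iso a := λ_ a
  nat := by simp

variable (A) in
/-- The right unit isomorphisms of the monoidal category. -/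
def tensorRightUnit : RightUnit (curriedTensor A) (𝟙_ A) where
  iso a := ρ_ a
  nat := by simp

variable (A X) in
/-- The unit isomorphisms of the right action. -/
def rightActionUnit : RightUnit (rightActionBifunctor A X) (𝟙_ A) where
  iso x := ρᵣ x
  nat {x x'} f := by
    change f ⊵ᵣ (𝟙_ A) ≫ (ρᵣ x').hom = (ρᵣ x).hom ≫ f
    simp

variable (A Y) in
/-- The unit isomorphisms of the left action. -/
def leftActionUnit : LeftUnit (leftActionBifunctor A Y) (𝟙_ A) where
  iso y := λₗ y
  nat {y y'} f := by
    change (𝟙_ A) ⊴ₗ f ≫ (λₗ y').hom = (λₗ y).hom ≫ f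
    simp

/-- The Day convolution monoidal structure on the free cocompletion of a small `K`-linear monoidal
category. -/
noncomputable instance dayMonoidalCategoryStruct :
    MonoidalCategoryStruct (FreeCocompletion K A) where
  tensorObj F G := conv (curriedTensor A) F G
  whiskerLeft F _ _ η := map (curriedTensor A) (𝟙 F) η
  whiskerRight η G := map (curriedTensor A) η (𝟙 G)
  tensorHom η θ := map (curriedTensor A) η θ
  tensorUnit := rep K (𝟙_ A)
  associator F G H := (tensorAssoc A).convIso F G H
  leftUnitor F := leftUnit (curriedTensor A) (𝟙_ A) (tensorLeftUnit A) F
  rightUnitor F := rightUnit (curriedTensor A) (𝟙_ A) (tensorRightUnit A) F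

/-- Day convolution is a monoidal structure. -/
noncomputable instance dayMonoidalCategory : MonoidalCategory (FreeCocompletion K A) where
  tensorHom_def η θ := by
    change map _ η θ = map _ η (𝟙 _) ≫ map _ (𝟙 _) θ
    rw [← map_comp, Category.comp_id, Category.id_comp]
  id_tensorHom_id F G := map_id
  tensorHom_comp_tensorHom η₁ η₂ θ₁ θ₂ := (map_comp _ _ _ _).symm
  whiskerLeft_id F G := map_id
  id_whiskerRight F G := map_id
  associator_naturality η₁ η₂ η₃ := (tensorAssoc A).hom_naturality _ _ _ η₁ η₂ η₃
  leftUnitor_naturality {F G} η := by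
    change map _ (𝟙 _) η ≫ leftUnitHom _ _ (tensorLeftUnit A) G = leftUnitHom _ _ (tensorLeftUnit A) F ≫ η
    exact conv_hom_ext (by simp)
  rightUnitor_naturality {F G} η := by
    change map _ η (𝟙 _) ≫ rightUnitHom _ _ (tensorRightUnit A) G = rightUnitHom _ _ (tensorRightUnit A) F ≫ η
    exact conv_hom_ext (by simp)
  pentagon F G H L := by
    change map _ ((tensorAssoc A).hom F G H) (𝟙 L) ≫ (tensorAssoc A).hom F _ L ≫
      map _ (𝟙 F) ((tensorAssoc A).hom G H L) =
      (tensorAssoc A).hom _ H L ≫ (tensorAssoc A).hom F G _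
    apply Assoc.ext_left
    intro e x b₃ φ b₁ b₂ ψ P s₂ s₃
    induction P using cind with
    | h_mk χ s t =>
      simp only [app_comp, app_map_cmk, Assoc.app_hom, app_id]
      rw [cmk_cmk_right (s₁ := s)]
      congr 1
      simp [tensorAssoc]
    | h_zero => simp
    | h_add x y hx hy => simp only [cmk_add_left, map_add, hx, hy]
  triangle F G := by
    change (tensorAssoc A).hom F _ G ≫ map _ (𝟙 F) (leftUnitHom _ _ (tensorLeftUnit A) G) =
      map _ (rightUnitHom _ _ (tensorRightUnit A) F) (𝟙 G)
    apply Assoc.ext_left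
    intro e x b₃ φ b₁ b₂ ψ s₁ s₂ s₃
    simp only [app_comp, app_map_cmk, Assoc.app_hom, app_id, app_rightUnitHom, app_leftUnitHom,
      cmk_res_left, cmk_res_right]
    congr 1
    simp [tensorAssoc, tensorLeftUnit, tensorRightUnit]

/-- The right action of the free cocompletion of `A` on that of a right `A`-module `X`, by Day
convolution. -/
noncomputable instance dayRightActionStruct :
    MonoidalRightActionStruct (FreeCocompletion K A) (FreeCocompletion K X) where
  actionObj F G := conv (rightActionBifunctor A X) F G
  actionHomRight F _ _ η := map (rightActionBifunctor A X) (𝟙 F) η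
  actionHomLeft η G := map (rightActionBifunctor A X) η (𝟙 G)
  actionHom η θ := map (rightActionBifunctor A X) η θ
  actionAssocIso F G H := ((rightAssoc A X).convIso F G H).symm
  actionUnitIso F := rightUnit (rightActionBifunctor A X) (𝟙_ A) (rightActionUnit A X) F

lemma rightAssoc_pentagon (L : FreeCocompletion K X) (F G H : FreeCocompletion K A) :
    map _ ((rightAssoc A X).hom L F G) (𝟙 H) ≫ (rightAssoc A X).hom L (conv _ F G) H ≫
      map _ (𝟙 L) ((tensorAssoc A).hom F G H) =
    (rightAssoc A X).hom (conv _ L F) G H ≫ (rightAssoc A X).hom L F (conv _ G H) := by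
  apply Assoc.ext_left
  intro e x b₃ φ b₁ b₂ ψ P s₂ s₃
  induction P using cind with
  | @h_mk c₁ c₂ χ s t =>
    simp only [app_comp, app_map_cmk, Assoc.app_hom, app_id]
    rw [cmk_cmk_right (s₁ := s)]
    congr 1
    exact right_pentagon_aux φ ψ χ
  | h_zero => simp
  | h_add x y hx hy => simp only [cmk_add_left, map_add, hx, hy]

/-- Day convolution is a right action. -/
noncomputable instance dayRightAction :
    MonoidalRightAction (FreeCocompletion K A) (FreeCocompletion K X) where
  actionHom_def η θ := by
    change map _ η θ = map _ η (𝟙 _) ≫ map _ (𝟙 _) θ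
    rw [← map_comp, Category.comp_id, Category.id_comp]
  actionHomRight_id F G := map_id
  id_actionHomLeft F G := map_id
  actionHom_comp η₁ η₂ θ₁ θ₂ := map_comp _ _ _ _
  actionAssocIso_hom_naturality {F₁ F₂ G₁ G₂ H₁ H₂} η₁ η₂ η₃ := by
    change map _ η₁ (map _ η₂ η₃) ≫ ((rightAssoc A X).convIso F₂ G₂ H₂).inv =
      ((rightAssoc A X).convIso F₁ G₁ H₁).inv ≫ map _ (map _ η₁ η₂) η₃
    rw [Iso.comp_inv_eq, Category.assoc, Iso.eq_inv_comp]
    exact ((rightAssoc A X).hom_naturality _ _ _ η₁ η₂ η₃).symm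
  actionUnitIso_hom_naturality {F G} η := by
    change rightUnitHom _ _ (rightActionUnit A X) F ≫ η =
      map _ η (𝟙 _) ≫ rightUnitHom _ _ (rightActionUnit A X) G
    exact conv_hom_ext (by simp)
  actionHomRight_whiskerRight {G G'} η H F := by
    change map _ (𝟙 F) (map _ η (𝟙 H)) = ((rightAssoc A X).convIso F G H).inv ≫
      map _ (map _ (𝟙 F) η) (𝟙 H) ≫ ((rightAssoc A X).convIso F G' H).hom
    rw [Iso.eq_inv_comp]
    exact ((rightAssoc A X).hom_naturality _ _ _ (𝟙 F) η (𝟙 H)).symm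
  whiskerRight_actionHomLeft G {H H'} η F := by
    change map _ (𝟙 F) (map _ (𝟙 G) η) = ((rightAssoc A X).convIso F G H).inv ≫
      map _ (𝟙 (conv _ F G)) η ≫ ((rightAssoc A X).convIso F G H').hom
    rw [Iso.eq_inv_comp, ← map_id]
    exact ((rightAssoc A X).hom_naturality _ _ _ (𝟙 F) (𝟙 G) η).symm
  actionHom_associator F G H L := by
    change map _ (𝟙 L) ((tensorAssoc A).hom F G H) ≫
      ((rightAssoc A X).convIso L F (conv _ G H)).inv ≫
        ((rightAssoc A X).convIso (conv _ L F) G H).inv =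
      ((rightAssoc A X).convIso L (conv _ F G) H).inv ≫
        map _ ((rightAssoc A X).convIso L F G).inv (𝟙 H)
    rw [← Category.assoc, Iso.comp_inv_eq, Iso.comp_inv_eq, Category.assoc, Category.assoc,
      Iso.eq_inv_comp]
    have h := rightAssoc_pentagon (X := X) L F G H
    have h' : map (rightActionBifunctor A X) ((rightAssoc A X).convIso L F G).inv (𝟙 H) ≫
        map (rightActionBifunctor A X) ((rightAssoc A X).hom L F G) (𝟙 H) = 𝟙 _ := by
      rw [← map_comp, ← Assoc.convIso_hom, Iso.inv_hom_id, Category.comp_id, map_id]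
    rw [Assoc.convIso_hom, Assoc.convIso_hom, Assoc.convIso_hom, ← h, reassoc_of% h']
  actionHom_leftUnitor F G := by
    change map _ (𝟙 G) (leftUnitHom _ _ (tensorLeftUnit A) F) =
      ((rightAssoc A X).convIso G _ F).inv ≫
        map _ (rightUnitHom _ _ (rightActionUnit A X) G) (𝟙 F)
    rw [Iso.eq_inv_comp]
    apply Assoc.ext_left
    intro e x b₃ φ b₁ b₂ ψ s₁ s₂ s₃
    simp only [app_comp, app_map_cmk, Assoc.convIso_hom, Assoc.app_hom, app_id, app_rightUnitHom,
      app_leftUnitHom, cmk_res_left, cmk_res_right]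
    congr 1
    exact right_leftUnitor_aux φ ψ (toHom s₂)
  actionHom_rightUnitor F G := by
    change map _ (𝟙 G) (rightUnitHom _ _ (tensorRightUnit A) F) =
      ((rightAssoc A X).convIso G F _).inv ≫ rightUnitHom _ _ (rightActionUnit A X) _
    rw [Iso.eq_inv_comp]
    apply Assoc.ext_left
    intro e x b₃ φ b₁ b₂ ψ s₁ s₂ s₃
    simp only [app_comp, app_map_cmk, Assoc.convIso_hom, Assoc.app_hom, app_id, app_rightUnitHom,
      cmk_res_right, res_cmk]
    congr 1
    exact right_rightUnitor_aux φ ψ (toHom s₃)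

/-- The left action of the free cocompletion of `A` on that of a left `A`-module `Y`, by Day
convolution. -/
noncomputable instance dayLeftActionStruct :
    MonoidalLeftActionStruct (FreeCocompletion K A) (FreeCocompletion K Y) where
  actionObj F G := conv (leftActionBifunctor A Y) F G
  actionHomRight F _ _ η := map (leftActionBifunctor A Y) (𝟙 F) η
  actionHomLeft η G := map (leftActionBifunctor A Y) η (𝟙 G)
  actionHom η θ := map (leftActionBifunctor A Y) η θ
  actionAssocIso F G H := (leftAssoc A Y).convIso F G H
  actionUnitIso F := leftUnit (leftActionBifunctor A Y) (𝟙_ A) (leftActionUnit A Y) F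

/-- Day convolution is a left action. -/
noncomputable instance dayLeftAction :
    MonoidalLeftAction (FreeCocompletion K A) (FreeCocompletion K Y) where
  actionHom_def η θ := by
    change map _ η θ = map _ η (𝟙 _) ≫ map _ (𝟙 _) θ
    rw [← map_comp, Category.comp_id, Category.id_comp]
  actionHomRight_id F G := map_id
  id_actionHomLeft F G := map_id
  actionHom_comp η₁ η₂ θ₁ θ₂ := map_comp _ _ _ _
  actionAssocIso_hom_naturality η₁ η₂ η₃ := (leftAssoc A Y).hom_naturality _ _ _ η₁ η₂ η₃
  actionUnitIso_hom_naturality {F G} η := by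
    change leftUnitHom _ _ (leftActionUnit A Y) F ≫ η =
      map _ (𝟙 _) η ≫ leftUnitHom _ _ (leftActionUnit A Y) G
    exact conv_hom_ext (by simp)
  whiskerLeft_actionHomLeft F {G G'} η H := by
    change map _ (map _ (𝟙 F) η) (𝟙 H) = ((leftAssoc A Y).convIso F G H).hom ≫
      map _ (𝟙 F) (map _ η (𝟙 H)) ≫ ((leftAssoc A Y).convIso F G' H).inv
    rw [← Category.assoc, Iso.eq_comp_inv]
    exact (leftAssoc A Y).hom_naturality _ _ _ (𝟙 F) η (𝟙 H)
  whiskerRight_actionHomLeft {F F'} G η H := by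
    change map _ (map _ η (𝟙 G)) (𝟙 H) = ((leftAssoc A Y).convIso F G H).hom ≫
      map _ η (𝟙 (conv _ G H)) ≫ ((leftAssoc A Y).convIso F' G H).inv
    rw [← Category.assoc, Iso.eq_comp_inv, ← map_id]
    exact (leftAssoc A Y).hom_naturality _ _ _ η (𝟙 G) (𝟙 H)
  associator_actionHom F G H L := by
    change map _ ((tensorAssoc A).hom F G H) (𝟙 L) ≫ (leftAssoc A Y).hom F _ L ≫
      map _ (𝟙 F) ((leftAssoc A Y).hom G H L) =
      (leftAssoc A Y).hom _ H L ≫ (leftAssoc A Y).hom F G _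
    apply Assoc.ext_left
    intro e x b₃ φ b₁ b₂ ψ P s₂ s₃
    induction P using cind with
    | @h_mk c₁ c₂ χ s t =>
      simp only [app_comp, app_map_cmk, Assoc.app_hom, app_id]
      rw [cmk_cmk_right (s₁ := s)]
      congr 1
      exact left_pentagon_aux φ ψ χ
    | h_zero => simp
    | h_add x y hx hy => simp only [cmk_add_left, map_add, hx, hy]
  leftUnitor_actionHom F G := by
    change map _ (leftUnitHom _ _ (tensorLeftUnit A) F) (𝟙 G) =
      (leftAssoc A Y).hom _ F G ≫ leftUnitHom _ _ (leftActionUnit A Y) _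
    apply Assoc.ext_left
    intro e x b₃ φ b₁ b₂ ψ s₁ s₂ s₃
    simp only [app_comp, app_map_cmk, Assoc.app_hom, app_id, app_leftUnitHom,
      cmk_res_left, res_cmk, Category.comp_id]
    exact congrArg (fun χ => cmk χ s₂ s₃) (left_leftUnitor_aux φ ψ (toHom s₁))
  rightUnitor_actionHom F G := by
    change map _ (rightUnitHom _ _ (tensorRightUnit A) F) (𝟙 G) =
      (leftAssoc A Y).hom F _ G ≫ map _ (𝟙 F) (leftUnitHom _ _ (leftActionUnit A Y) G)
    apply Assoc.ext_left
    intro e x b₃ φ b₁ b₂ ψ s₁ s₂ s₃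
    simp only [app_comp, app_map_cmk, Assoc.app_hom, app_id, app_rightUnitHom, app_leftUnitHom,
      cmk_res_left, cmk_res_right]
    congr 1
    exact left_rightUnitor_aux φ ψ (toHom s₂)

end DayStructures

/-! ### The naive tensor product -/

/-- The objects of the naive tensor product `X ⊗_K Y`: pairs of objects. -/
structure NaiveTensor (K X Y : Type*) where
  /-- the first component -/
  fst : X
  /-- the second component -/
  snd : Y

namespace NaiveTensor

variable {K : Type u} [Field K] {X Y : Type u} [SmallCategory X] [SmallCategory Y]
variable [Preadditive X] [Preadditive Y] [Linear K X] [Linear K Y]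

/-- The morphisms of the naive tensor product. -/
abbrev Mor (p q : NaiveTensor K X Y) : Type u :=
  TensorProduct K (p.fst ⟶ q.fst) (p.snd ⟶ q.snd)

/-- The composition of the naive tensor product:
`(f ⊗ g) ≫ (f' ⊗ g') = (f ≫ f') ⊗ (g ≫ g')`. -/
noncomputable def compMap (p q r : NaiveTensor K X Y) : Mor p q →ₗ[K] Mor q r →ₗ[K] Mor p r :=
  TensorProduct.map₂ (Linear.comp p.fst q.fst r.fst) (Linear.comp p.snd q.snd r.snd)

@[simp] lemma compMap_tmul {p q r : NaiveTensor K X Y} (f : p.fst ⟶ q.fst) (g : p.snd ⟶ q.snd)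
    (f' : q.fst ⟶ r.fst) (g' : q.snd ⟶ r.snd) :
    compMap p q r (f ⊗ₜ[K] g) (f' ⊗ₜ[K] g') = (f ≫ f') ⊗ₜ[K] (g ≫ g') := by
  simp [compMap]

noncomputable instance category : SmallCategory (NaiveTensor K X Y) where
  Hom p q := Mor p q
  id p := 𝟙 p.fst ⊗ₜ[K] 𝟙 p.snd
  comp {p q r} f g := compMap p q r f g
  id_comp {p q} f := by
    induction f using TensorProduct.induction_on with
    | zero => simp
    | tmul f g => simp
    | add x y hx hy => rw [map_add, hx, hy]
  comp_id {p q} f := by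
    induction f using TensorProduct.induction_on with
    | zero => simp
    | tmul f g => simp
    | add x y hx hy => rw [map_add, LinearMap.add_apply, hx, hy]
  assoc {p q r s} f g h := by
    induction f using TensorProduct.induction_on with
    | zero => simp
    | add x y hx hy => simp only [map_add, LinearMap.add_apply, hx, hy]
    | tmul f₁ f₂ =>
      induction g using TensorProduct.induction_on with
      | zero => simp
      | add x y hx hy => simp only [map_add, LinearMap.add_apply, hx, hy]
      | tmul g₁ g₂ =>
        induction h using TensorProduct.induction_on with
        | zero => simp
        | add x y hx hy => simp only [map_add, hx, hy]
        | tmul h₁ h₂ => simp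

noncomputable instance (p q : NaiveTensor K X Y) : AddCommGroup (p ⟶ q) :=
  inferInstanceAs (AddCommGroup (Mor p q))

noncomputable instance (p q : NaiveTensor K X Y) : Module K (p ⟶ q) :=
  inferInstanceAs (Module K (Mor p q))

noncomputable instance preadditive : Preadditive (NaiveTensor K X Y) where
  add_comp p q r f f' g := by
    change compMap p q r (f + f') g = compMap p q r f g + compMap p q r f' g
    rw [map_add, LinearMap.add_apply]
  comp_add p q r f g g' := map_add (compMap p q r f) g g'

noncomputable instance linear : Linear K (NaiveTensor K X Y) where
  smul_comp p q r c f g := by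
    change compMap p q r (c • f) g = c • compMap p q r f g
    rw [map_smul, LinearMap.smul_apply]
  comp_smul p q r f c g := map_smul (compMap p q r f) c g

/-- The morphism `f ⊗ g` of the naive tensor product. -/
noncomputable def tmul {x x' : X} {y y' : Y} (f : x ⟶ x') (g : y ⟶ y') :
    (⟨x, y⟩ : NaiveTensor K X Y) ⟶ ⟨x', y'⟩ := f ⊗ₜ[K] g

end NaiveTensor

/-! ### The naive balanced tensor product -/

/-- The objects of the naive balanced tensor product `X ⊗_A Y`, which are those of `X ⊗_K Y`. -/
structure NaiveBalancedTensor (K A X Y : Type*) where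
  /-- the underlying object of the naive tensor product -/
  obj : NaiveTensor K X Y

section NaiveBalanced

variable (K : Type u) [Field K] (A X Y : Type u)
variable [SmallCategory A] [SmallCategory X] [SmallCategory Y]
variable [Preadditive X] [Preadditive Y] [Linear K X] [Linear K Y]
variable [MonoidalCategory A] [MonoidalRightAction A X] [MonoidalLeftAction A Y]

namespace NaiveBalancedTensor

/-- Formal expressions for the morphisms of the naive balanced tensor product: they are generated
under composition and linear combinations by the morphisms of `X ⊗_K Y` and by new morphisms
`(x ◁ a, y) → (x, a ▷ y)` and `(x, a ▷ y) → (x ◁ a, y)`. -/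
inductive Word : NaiveTensor K X Y → NaiveTensor K X Y → Type u
  | of {p q : NaiveTensor K X Y} (f : p ⟶ q) : Word p q
  | bal (x : X) (a : A) (y : Y) : Word ⟨x ⊙ᵣ a, y⟩ ⟨x, a ⊙ₗ y⟩
  | balInv (x : X) (a : A) (y : Y) : Word ⟨x, a ⊙ₗ y⟩ ⟨x ⊙ᵣ a, y⟩
  | comp {p q r : NaiveTensor K X Y} (f : Word p q) (g : Word q r) : Word p r
  | add {p q : NaiveTensor K X Y} (f g : Word p q) : Word p q
  | smul {p q : NaiveTensor K X Y} (c : K) (f : Word p q) : Word p q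

variable {K A X Y}

open Word NaiveTensor

/-- The relations between formal expressions: the laws of a `K`-linear category, linear
functoriality of the inclusion of `X ⊗_K Y`, and, for the new morphisms, invertibility,
naturality, the pentagon relation and the unit relation. -/
inductive Rel : ∀ {p q : NaiveTensor K X Y}, Word K A X Y p q → Word K A X Y p q → Prop
  -- equivalence relation
  | refl {p q} (f : Word K A X Y p q) : Rel f f
  | symm {p q} {f g : Word K A X Y p q} : Rel f g → Rel g f
  | trans {p q} {f g h : Word K A X Y p q} : Rel f g → Rel g h → Rel f h
  -- congruence
  | comp_congr {p q r} {f f' : Word K A X Y p q} {g g' : Word K A X Y q r} :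
      Rel f f' → Rel g g' → Rel (comp f g) (comp f' g')
  | add_congr {p q} {f f' g g' : Word K A X Y p q} :
      Rel f f' → Rel g g' → Rel (add f g) (add f' g')
  | smul_congr {p q} (c : K) {f f' : Word K A X Y p q} :
      Rel f f' → Rel (smul c f) (smul c f')
  -- category
  | id_comp {p q} (f : Word K A X Y p q) : Rel (comp (of (𝟙 p)) f) f
  | comp_id {p q} (f : Word K A X Y p q) : Rel (comp f (of (𝟙 q))) f
  | assoc {p q r s} (f : Word K A X Y p q) (g : Word K A X Y q r) (h : Word K A X Y r s) :
      Rel (comp (comp f g) h) (comp f (comp g h))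
  -- vector space of morphisms
  | add_assoc {p q} (f g h : Word K A X Y p q) : Rel (add (add f g) h) (add f (add g h))
  | add_comm {p q} (f g : Word K A X Y p q) : Rel (add f g) (add g f)
  | zero_add {p q} (f : Word K A X Y p q) : Rel (add (of 0) f) f
  | neg_add {p q} (f : Word K A X Y p q) : Rel (add (smul (-1) f) f) (of 0)
  | one_smul {p q} (f : Word K A X Y p q) : Rel (smul 1 f) f
  | mul_smul {p q} (c c' : K) (f : Word K A X Y p q) :
      Rel (smul (c * c') f) (smul c (smul c' f))
  | smul_add {p q} (c : K) (f g : Word K A X Y p q) :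
      Rel (smul c (add f g)) (add (smul c f) (smul c g))
  | add_smul {p q} (c c' : K) (f : Word K A X Y p q) :
      Rel (smul (c + c') f) (add (smul c f) (smul c' f))
  -- bilinearity of composition
  | add_comp {p q r} (f f' : Word K A X Y p q) (g : Word K A X Y q r) :
      Rel (comp (add f f') g) (add (comp f g) (comp f' g))
  | comp_add {p q r} (f : Word K A X Y p q) (g g' : Word K A X Y q r) :
      Rel (comp f (add g g')) (add (comp f g) (comp f g'))
  | smul_comp {p q r} (c : K) (f : Word K A X Y p q) (g : Word K A X Y q r) :
      Rel (comp (smul c f) g) (smul c (comp f g))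
  | comp_smul {p q r} (c : K) (f : Word K A X Y p q) (g : Word K A X Y q r) :
      Rel (comp f (smul c g)) (smul c (comp f g))
  -- the inclusion of `X ⊗_K Y` is a linear functor
  | of_comp {p q r : NaiveTensor K X Y} (f : p ⟶ q) (g : q ⟶ r) :
      Rel (of (f ≫ g)) (comp (of f) (of g))
  | of_add {p q : NaiveTensor K X Y} (f g : p ⟶ q) : Rel (of (f + g)) (add (of f) (of g))
  | of_smul {p q : NaiveTensor K X Y} (c : K) (f : p ⟶ q) : Rel (of (c • f)) (smul c (of f))
  -- the new morphisms are mutually inverse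
  | bal_balInv (x : X) (a : A) (y : Y) : Rel (comp (bal x a y) (balInv x a y)) (of (𝟙 _))
  | balInv_bal (x : X) (a : A) (y : Y) : Rel (comp (balInv x a y) (bal x a y)) (of (𝟙 _))
  -- naturality
  | bal_nat {x x' : X} {a a' : A} {y y' : Y} (f : x ⟶ x') (g : a ⟶ a') (h : y ⟶ y') :
      Rel (comp (of (tmul (f ⊙ᵣₘ g) h)) (bal x' a' y'))
        (comp (bal x a y) (of (tmul f (g ⊙ₗₘ h))))
  -- pentagon
  | pentagon (x : X) (a b : A) (y : Y) :
      Rel (comp (bal (x ⊙ᵣ a) b y) (bal x a (b ⊙ₗ y)))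
        (comp (of (tmul (αᵣ x a b).inv (𝟙 y)))
          (comp (bal x (a ⊗ b) y) (of (tmul (𝟙 x) (αₗ a b y).hom))))
  -- unit
  | unit (x : X) (y : Y) :
      Rel (comp (bal x (𝟙_ A) y) (of (tmul (𝟙 x) (λₗ y).hom))) (of (tmul (ρᵣ x).hom (𝟙 y)))

variable (K A X Y) in
/-- Formal expressions modulo the relations. -/
instance setoid (p q : NaiveTensor K X Y) : Setoid (Word K A X Y p q) where
  r := Rel
  iseqv := ⟨Rel.refl, Rel.symm, Rel.trans⟩

/-- The morphisms of the naive balanced tensor product. -/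
def Mor (p q : NaiveBalancedTensor K A X Y) : Type u :=
  _root_.Quotient (setoid K A X Y p.obj q.obj)

noncomputable instance category : SmallCategory (NaiveBalancedTensor K A X Y) where
  Hom p q := Mor p q
  id p := Quotient.mk (setoid K A X Y _ _) (of (𝟙 p.obj))
  comp f g := Quotient.map₂ comp (fun _ _ h _ _ h' => Rel.comp_congr h h') f g
  id_comp f := by
    induction f using Quotient.ind
    exact Quotient.sound (Rel.id_comp _)
  comp_id f := by
    induction f using Quotient.ind
    exact Quotient.sound (Rel.comp_id _)
  assoc f g h := by
    induction f using Quotient.ind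
    induction g using Quotient.ind
    induction h using Quotient.ind
    exact Quotient.sound (Rel.assoc _ _ _)

/-- The class of a formal expression. -/
def homMk {p q : NaiveBalancedTensor K A X Y} (f : Word K A X Y p.obj q.obj) : p ⟶ q :=
  Quotient.mk (setoid K A X Y _ _) f

lemma homMk_surjective {p q : NaiveBalancedTensor K A X Y} (f : p ⟶ q) :
    ∃ w, f = homMk w := by
  obtain ⟨w, rfl⟩ := Quotient.exists_rep f
  exact ⟨w, rfl⟩

lemma homMk_eq {p q : NaiveBalancedTensor K A X Y} {f g : Word K A X Y p.obj q.obj}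
    (h : Rel f g) : homMk f = homMk g := Quotient.sound h

/-- Addition of morphisms. -/
noncomputable instance (p q : NaiveBalancedTensor K A X Y) : Add (p ⟶ q) where
  add f g := Quotient.map₂ add (fun _ _ h _ _ h' => Rel.add_congr h h') f g

/-- The zero morphism. -/
noncomputable instance (p q : NaiveBalancedTensor K A X Y) : Zero (p ⟶ q) where
  zero := homMk (of 0)

/-- Negation of morphisms. -/
noncomputable instance (p q : NaiveBalancedTensor K A X Y) : Neg (p ⟶ q) where
  neg f := Quotient.map (smul (-1)) (fun _ _ h => Rel.smul_congr (-1) h) f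

noncomputable instance (p q : NaiveBalancedTensor K A X Y) : AddCommGroup (p ⟶ q) where
  add_assoc f g h := by
    obtain ⟨f, rfl⟩ := homMk_surjective f
    obtain ⟨g, rfl⟩ := homMk_surjective g
    obtain ⟨h, rfl⟩ := homMk_surjective h
    exact homMk_eq (Rel.add_assoc f g h)
  zero_add f := by
    obtain ⟨f, rfl⟩ := homMk_surjective f
    exact homMk_eq (Rel.zero_add f)
  add_zero f := by
    obtain ⟨f, rfl⟩ := homMk_surjective f
    exact homMk_eq ((Rel.add_comm _ _).trans (Rel.zero_add f))
  neg_add_cancel f := by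
    obtain ⟨f, rfl⟩ := homMk_surjective f
    exact homMk_eq (Rel.neg_add f)
  add_comm f g := by
    obtain ⟨f, rfl⟩ := homMk_surjective f
    obtain ⟨g, rfl⟩ := homMk_surjective g
    exact homMk_eq (Rel.add_comm f g)
  nsmul := nsmulRec
  zsmul := zsmulRec

lemma homMk_add {p q : NaiveBalancedTensor K A X Y} (f g : Word K A X Y p.obj q.obj) :
    homMk (add f g) = homMk f + homMk g := rfl

/-- Scalar multiplication of morphisms. -/
noncomputable instance (p q : NaiveBalancedTensor K A X Y) : SMul K (p ⟶ q) where
  smul c f := Quotient.map (smul c) (fun _ _ h => Rel.smul_congr c h) f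

lemma homMk_smul {p q : NaiveBalancedTensor K A X Y} (c : K) (f : Word K A X Y p.obj q.obj) :
    homMk (smul c f) = c • homMk f := rfl

protected lemma smul_add' {p q : NaiveBalancedTensor K A X Y} (c : K) (f g : p ⟶ q) :
    c • (f + g) = c • f + c • g := by
  obtain ⟨f, rfl⟩ := homMk_surjective f
  obtain ⟨g, rfl⟩ := homMk_surjective g
  exact homMk_eq (Rel.smul_add c f g)

protected lemma add_smul' {p q : NaiveBalancedTensor K A X Y} (c c' : K) (f : p ⟶ q) :
    (c + c') • f = c • f + c' • f := by
  obtain ⟨f, rfl⟩ := homMk_surjective f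
  exact homMk_eq (Rel.add_smul c c' f)

noncomputable instance (p q : NaiveBalancedTensor K A X Y) : Module K (p ⟶ q) where
  one_smul f := by
    obtain ⟨f, rfl⟩ := homMk_surjective f
    exact homMk_eq (Rel.one_smul f)
  mul_smul c c' f := by
    obtain ⟨f, rfl⟩ := homMk_surjective f
    exact homMk_eq (Rel.mul_smul c c' f)
  smul_zero c := by
    have h := NaiveBalancedTensor.smul_add' c (0 : p ⟶ q) 0
    rw [add_zero] at h
    exact left_eq_add.mp h
  zero_smul f := by
    have h := NaiveBalancedTensor.add_smul' (0 : K) 0 f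
    rw [add_zero] at h
    exact left_eq_add.mp h
  smul_add := NaiveBalancedTensor.smul_add'
  add_smul := NaiveBalancedTensor.add_smul'

noncomputable instance preadditive : Preadditive (NaiveBalancedTensor K A X Y) where
  add_comp _ _ _ f f' g := by
    obtain ⟨f, rfl⟩ := homMk_surjective f
    obtain ⟨f', rfl⟩ := homMk_surjective f'
    obtain ⟨g, rfl⟩ := homMk_surjective g
    exact homMk_eq (Rel.add_comp f f' g)
  comp_add _ _ _ f g g' := by
    obtain ⟨f, rfl⟩ := homMk_surjective f
    obtain ⟨g, rfl⟩ := homMk_surjective g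
    obtain ⟨g', rfl⟩ := homMk_surjective g'
    exact homMk_eq (Rel.comp_add f g g')

noncomputable instance linear : Linear K (NaiveBalancedTensor K A X Y) where
  smul_comp _ _ _ c f g := by
    obtain ⟨f, rfl⟩ := homMk_surjective f
    obtain ⟨g, rfl⟩ := homMk_surjective g
    exact homMk_eq (Rel.smul_comp c f g)
  comp_smul _ _ _ f c g := by
    obtain ⟨f, rfl⟩ := homMk_surjective f
    obtain ⟨g, rfl⟩ := homMk_surjective g
    exact homMk_eq (Rel.comp_smul c f g)

end NaiveBalancedTensor

end NaiveBalanced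

/-! ### Balanced tensor products of cocomplete categories -/

/-- The property of a functor between `K`-linear categories to be a 1-morphism of cocomplete
`K`-linear categories, that is, `K`-linear and cocontinuous. -/
def isLinearCocontinuous (K : Type u) [Field K] (W : Type v) [Category.{u} W] [Preadditive W]
    [Linear K W] (E : Type w) [Category.{u} E] [Preadditive E] [Linear K E] :
    ObjectProperty (W ⥤ E) := fun F =>
  (∀ ⦃x y : W⦄ (f g : x ⟶ y), F.map (f + g) = F.map f + F.map g) ∧
  (∀ ⦃x y : W⦄ (r : K) (f : x ⟶ y), F.map (r • f) = r • F.map f) ∧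
  PreservesColimits F

/-- The category of `K`-linear cocontinuous functors and natural transformations. -/
abbrev CocontFunctor (K : Type u) [Field K] (W : Type v) [Category.{u} W] [Preadditive W]
    [Linear K W] (E : Type w) [Category.{u} E] [Preadditive E] [Linear K E] :=
  (isLinearCocontinuous K W E).FullSubcategory

section Balanced

variable (K : Type u) [Field K]
variable (C : Type v₁) [Category.{u} C] [MonoidalCategory C]
variable (X : Type v₂) [Category.{u} X] [Preadditive X] [Linear K X] [MonoidalRightAction C X]
variable (Y : Type v₃) [Category.{u} Y] [Preadditive Y] [Linear K Y] [MonoidalLeftAction C Y]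
variable (E : Type w) [Category.{u} E] [Preadditive E] [Linear K E]

/-- A `C`-balanced functor `P : X ⊠ Y → E`: a functor of two variables which is `K`-linear and
cocontinuous in each variable, with an isomorphism `P(x ◁ c, y) ≅ P(x, c ▷ y)` natural in `x`, `c`
and `y` and satisfying the pentagon and triangle equations. -/
structure BalancedFunctor where
  /-- the functor of two variables -/
  functor : X ⥤ Y ⥤ E
  bilinear : IsBilinear K functor
  cocont_left : ∀ y : Y, PreservesColimits (functor.flip.obj y)
  cocont_right : ∀ x : X, PreservesColimits (functor.obj x)
  /-- the balancing isomorphism -/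
  bal : ∀ (x : X) (c : C) (y : Y),
    (functor.obj (x ⊙ᵣ c)).obj y ≅ (functor.obj x).obj (c ⊙ₗ y)
  bal_nat : ∀ {x x' : X} {c c' : C} {y y' : Y} (f : x ⟶ x') (g : c ⟶ c') (h : y ⟶ y'),
    ((functor.map (f ⊙ᵣₘ g)).app y ≫ (functor.obj (x' ⊙ᵣ c')).map h) ≫ (bal x' c' y').hom =
      (bal x c y).hom ≫ (functor.map f).app (c ⊙ₗ y) ≫ (functor.obj x').map (g ⊙ₗₘ h)
  pentagon : ∀ (x : X) (c d : C) (y : Y),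
    (bal (x ⊙ᵣ c) d y).hom ≫ (bal x c (d ⊙ₗ y)).hom =
      (functor.map (αᵣ x c d).inv).app y ≫ (bal x (c ⊗ d) y).hom ≫
        (functor.obj x).map (αₗ c d y).hom
  triangle : ∀ (x : X) (y : Y),
    (bal x (𝟙_ C) y).hom ≫ (functor.obj x).map (λₗ y).hom = (functor.map (ρᵣ x).hom).app y

namespace BalancedFunctor

variable {K C X Y E}

/-- A morphism of balanced functors: a natural transformation compatible with the balancing
isomorphisms. -/
@[ext]
structure Hom (P Q : BalancedFunctor K C X Y E) where
  /-- the natural transformation -/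
  hom : P.functor ⟶ Q.functor
  comm : ∀ (x : X) (c : C) (y : Y),
    (hom.app (x ⊙ᵣ c)).app y ≫ (Q.bal x c y).hom = (P.bal x c y).hom ≫ (hom.app x).app (c ⊙ₗ y)

instance category : Category (BalancedFunctor K C X Y E) where
  Hom P Q := Hom P Q
  id P := { hom := 𝟙 _, comm := by simp }
  comp η θ :=
    { hom := η.hom ≫ θ.hom
      comm := fun x c y => by
        simp only [NatTrans.comp_app, Category.assoc, θ.comm]
        rw [← Category.assoc, η.comm, Category.assoc] }
  id_comp η := Hom.ext (Category.id_comp _)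
  comp_id η := Hom.ext (Category.comp_id _)
  assoc η θ κ := Hom.ext (Category.assoc _ _ _)

/-- The balanced functor obtained from a balanced functor by composing it with a `K`-linear
cocontinuous functor. -/
def postcomp {W : Type v} [Category.{u} W] [Preadditive W] [Linear K W]
    (P : BalancedFunctor K C X Y W) (G : CocontFunctor K W E) : BalancedFunctor K C X Y E where
  functor := P.functor ⋙ (Functor.whiskeringRight Y W E).obj G.obj
  bilinear :=
    { map_add_left := fun f g y => by
        simp [P.bilinear.map_add_left, G.property.1]
      map_smul_left := fun r f y => by
        simp [P.bilinear.map_smul_left, G.property.2.1]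
      map_add_right := fun x _ _ f g => by
        simp [P.bilinear.map_add_right, G.property.1]
      map_smul_right := fun x _ _ r f => by
        simp [P.bilinear.map_smul_right, G.property.2.1] }
  cocont_left y := by
    have h₁ := P.cocont_left y
    have h₂ := G.property.2.2
    exact inferInstanceAs (PreservesColimits (P.functor.flip.obj y ⋙ G.obj))
  cocont_right x := by
    have h₁ := P.cocont_right x
    have h₂ := G.property.2.2
    exact inferInstanceAs (PreservesColimits (P.functor.obj x ⋙ G.obj))
  bal x c y := G.obj.mapIso (P.bal x c y)
  bal_nat f g h := by
    simpa using congrArg G.obj.map (P.bal_nat f g h)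
  pentagon x c d y := by
    simpa using congrArg G.obj.map (P.pentagon x c d y)
  triangle x y := by
    simpa using congrArg G.obj.map (P.triangle x y)

/-- Composition with a balanced functor `P : X ⊠ Y → W`, as a functor from `K`-linear cocontinuous
functors `W ⥤ E` to balanced functors `X ⊠ Y → E`. -/
def postcompFunctor {W : Type v} [Category.{u} W] [Preadditive W] [Linear K W]
    (P : BalancedFunctor K C X Y W) (E : Type w) [Category.{u} E] [Preadditive E] [Linear K E] :
    CocontFunctor K W E ⥤ BalancedFunctor K C X Y E where
  obj G := P.postcomp G
  map η :=
    { hom := Functor.whiskerLeft P.functor ((Functor.whiskeringRight Y W E).map η.hom)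
      comm := fun x c y => (η.hom.naturality (P.bal x c y).hom).symm }
  map_id _ := rfl
  map_comp _ _ := rfl

/-- A balanced functor `P : X ⊠ Y → W` exhibits `W` as the balanced tensor product `X ⊠_C Y` if `W`
is cocomplete and `P` is universal among balanced functors to cocomplete `K`-linear categories:
composition with `P` is an equivalence from `K`-linear cocontinuous functors `W ⥤ E` to balanced
functors `X ⊠ Y → E`. -/
structure IsBalancedTensorProduct {W : Type v} [Category.{u} W] [Preadditive W] [Linear K W]
    (P : BalancedFunctor K C X Y W) : Prop where
  cocomplete : HasColimits W
  universal : ∀ (E : Type w) [Category.{u} E] [Preadditive E] [Linear K E] [HasColimits E],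
    (P.postcompFunctor E).IsEquivalence

end BalancedFunctor

end Balanced

end LinCat

set_option linter.unusedSectionVars false

/-! A linear presheaf on `Z` is the coequalizer of two maps between coproducts of representables:
one generator for each section, and relations expressing additivity, homogeneity and restriction of
sections (`presIsColimit`). A linear cocontinuous functor out of the presheaf category is therefore
controlled by its values on representables, for testing equality (`cocont_hom_ext`), for building
transformations (`exists_extend_natTrans`) and for detecting invertibility
(`isIso_app_of_isIso_app_rep`). Conversely, every linear functor `q : Z ⥤ E` to a cocomplete
category extends to a cocontinuous one, the left adjoint of the nerve `e ↦ Hom(q -, e)`.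

Linear functors out of the naive balanced tensor product are, by generators and relations, bilinear
functors on `X × Y` with a balancing. Cocontinuous functors out of its free cocompletion thus amount
to such naive balanced functors. Balanced functors on the presheaf categories should amount to the
same data, by restriction to representables, since they are cocontinuous in each variable.

The universal functor is Day convolution along `incl`, the canonical functor from `X × Y`. The
adjoined isomorphisms have the shape of an associativity constraint between the right action, `incl`
and the left action, so the general construction of `Assoc` turns them into a balancing; pentagon
and triangle are checked on generators of the coends. The link with representables is `repHom`:
convolving two representables gives a representable (`isIso_repHom`), and on these the balancing
becomes the adjoined isomorphism (`inclRep_bal`).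

For full faithfulness, a morphism between composites with Day convolution gives a family on
representables. It commutes with `f ⊗ g` by naturality and with the adjoined isomorphisms by
compatibility with balancings, hence with all morphisms (`naturality_of_generators`), and so it
extends. For essential surjectivity, a balanced functor `Q` is restricted to representables
(`restrict`), lifted to the naive balanced tensor product and extended. The comparison `lanHom` with
`Q` is invertible on pairs of representables, then everywhere by cocontinuity in one variable at a
time. Uniqueness of the balanced tensor product is the usual formal argument. -/

namespace LinCat

/-! ### The Yoneda embedding and nerves -/

namespace FreeCocompletion

variable {K : Type u} [Field K]
variable {Z : Type u} [SmallCategory Z] [Preadditive Z] [Linear K Z]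
variable {F G : FreeCocompletion K Z}

@[simp] lemma app_add (η θ : F ⟶ G) (z : Z) (s : F.sec z) :
    app (η + θ) z s = app η z s + app θ z s := rfl

@[simp] lemma app_smul (r : K) (η : F ⟶ G) (z : Z) (s : F.sec z) :
    app (r • η) z s = r • app η z s := rfl

/-- The morphism out of a represented presheaf classifying a section. -/
def ofSec {z : Z} (s : F.sec z) : rep K z ⟶ F :=
  mkHom (fun x =>
    { toFun := fun f => F.res (toHom f) s
      map_add' := by simp [res_add]
      map_smul' := by simp [res_smul] }) (by simp)

@[simp] lemma app_ofSec {z : Z} (s : F.sec z) (x : Z) (f : (rep K z).sec x) :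
    app (ofSec s) x f = F.res (toHom f) s := rfl

/-- Yoneda: every section of a representable is a restriction of the identity. Most identities
between maps out of representables are proved by evaluating there. -/
lemma rep_hom_ext {z : Z} {η θ : rep K z ⟶ F}
    (h : app η z (ofHom (𝟙 z)) = app θ z (ofHom (𝟙 z))) : η = θ := by
  apply hom_ext'
  intro x s
  rw [eq_res s, app_res, app_res, h]

@[simp] lemma ofSec_app {z : Z} (η : rep K z ⟶ F) : ofSec (app η z (ofHom (𝟙 z))) = η :=
  rep_hom_ext (by simp)

@[simp] lemma ofSec_comp {z : Z} (s : F.sec z) (η : F ⟶ G) :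
    ofSec s ≫ η = ofSec (app η z s) :=
  rep_hom_ext (by simp)

lemma ofSec_add {z : Z} (s t : F.sec z) : ofSec (s + t) = ofSec s + ofSec t :=
  rep_hom_ext (by simp)

lemma ofSec_smul {z : Z} (r : K) (s : F.sec z) : ofSec (r • s) = r • ofSec s :=
  rep_hom_ext (by simp)

variable (K Z) in
/-- The Yoneda embedding. -/
abbrev yoneda : Z ⥤ FreeCocompletion K Z where
  obj z := rep K z
  map f := ofSec (ofHom f)
  map_id z := rep_hom_ext (by simp)
  map_comp f g := rep_hom_ext (by simp [res_ofHom])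

/-- This turns restriction of sections into precomposition with a Yoneda morphism, the form in which
the restriction relations of a presentation appear. -/
lemma ofSec_ofHom_comp_ofSec {y z : Z} (f : y ⟶ z) (s : F.sec z) :
    ofSec (ofHom f) ≫ ofSec s = ofSec (F.res f s) :=
  rep_hom_ext (by simp)

instance : (yoneda K Z).Additive where
  map_add {_ _ f g} := (congrArg ofSec (map_add ofHom f g)).trans (ofSec_add _ _)

instance : (yoneda K Z).Linear K where
  map_smul f r := (congrArg ofSec (map_smul ofHom r f)).trans (ofSec_smul _ _)

section Nerve

variable {E : Type w} [Category.{u} E] [Preadditive E] [Linear K E]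
variable (q : Z ⥤ E) [q.Additive] [q.Linear K]

variable (K) in
/-- The nerve of a linear functor `q : Z ⥤ E`: an object `e` is sent to the presheaf
`Hom(q(-), e)`. -/
def nerve : E ⥤ FreeCocompletion K Z where
  obj e := mkObj (fun z => q.obj z ⟶ e) (fun f => Linear.leftComp K e (q.map f)) (by simp)
    (by simp) (by simp) (by simp [q.map_smul])
  map g := mkHom (fun z => Linear.rightComp K (q.obj z) g) (fun f s => Category.assoc _ _ _)
  map_id e := hom_ext' (fun z s => Category.comp_id _)
  map_comp f g := hom_ext' (fun z s => (Category.assoc _ _ _).symm)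

variable {q}

/-- A section of a nerve, as a morphism. -/
def unnerve {e : E} {z : Z} : ((nerve K q).obj e).sec z →ₗ[K] (q.obj z ⟶ e) :=
  LinearMap.id (M := q.obj z ⟶ e)

/-- A morphism, as a section of a nerve. -/
def ennerve {e : E} {z : Z} : (q.obj z ⟶ e) →ₗ[K] ((nerve K q).obj e).sec z :=
  LinearMap.id (M := q.obj z ⟶ e)

@[simp] lemma unnerve_res {e : E} {y z : Z} (f : y ⟶ z) (s : ((nerve K q).obj e).sec z) :
    unnerve (((nerve K q).obj e).res f s) = q.map f ≫ unnerve s := rfl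

@[simp] lemma unnerve_app_map {e e' : E} (g : e ⟶ e') {z : Z} (s : ((nerve K q).obj e).sec z) :
    unnerve (app ((nerve K q).map g) z s) = unnerve s ≫ g := rfl

lemma hom_nerve_ext {e : E} {η θ : F ⟶ (nerve K q).obj e}
    (h : ∀ (z : Z) (s : F.sec z), unnerve (app η z s) = unnerve (app θ z s)) : η = θ :=
  hom_ext' h

end Nerve

/-! ### Cocompleteness -/

/-- Colimits of presheaves are computed objectwise, so the maps into `F.obj (op y)` from the diagram
are jointly epimorphic. Linearity of `F` can be tested after precomposing with them, where
naturality reduces it to linearity of the presheaves in the diagram. -/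
instance isClosedUnderColimitsOfShape (J : Type v₁) [Category.{v₂} J] :
    (isLinearPresheaf K Z).IsClosedUnderColimitsOfShape J where
  colimitsOfShape_le := by
    rintro F ⟨p⟩
    have ext : ∀ {y : Z} {M : ModuleCat.{u} K} {a b : F.obj (op y) ⟶ M},
        (∀ j, (p.ι.app j).app (op y) ≫ a = (p.ι.app j).app (op y) ≫ b) → a = b :=
      fun {y} _ _ _ h =>
        (isColimitOfPreserves ((evaluation _ _).obj (op y)) p.isColimit).hom_ext h
    constructor
    · intro x y f g
      refine ext fun j => ?_
      have h := (p.prop_diag_obj j).1 f g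
      have n := (p.ι.app j).naturality
      simp only [Functor.const_obj_obj] at n
      rw [Preadditive.comp_add, ← n, ← n, ← n, h, Preadditive.add_comp]
    · intro x y r f
      refine ext fun j => ?_
      have h := (p.prop_diag_obj j).2 r f
      have n := (p.ι.app j).naturality
      simp only [Functor.const_obj_obj] at n
      rw [Linear.comp_smul, ← n, ← n, h, Linear.smul_comp]

instance : HasColimits (FreeCocompletion K Z) where
  has_colimits_of_shape _ _ := inferInstance

end FreeCocompletion

namespace FreeCocompletion

variable {K : Type u} [Field K]
variable {Z : Type u} [SmallCategory Z] [Preadditive Z] [Linear K Z]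

/-! ### Weighted colimits and the density of the representables -/

/-- Relations between the sections of a presheaf, over an object. -/
inductive SecRel (F : FreeCocompletion K Z) : Z → Type u
  | add {z : Z} (s t : F.sec z) : SecRel F z
  | smul {z : Z} (r : K) (s : F.sec z) : SecRel F z
  | res {y z : Z} (f : y ⟶ z) (s : F.sec z) : SecRel F y

namespace SecRel

variable {F : FreeCocompletion K Z} {E : Type w} [Category.{u} E]

/-- The left hand side of a relation, evaluated in a family of morphisms. -/
def lhs {q : Z ⥤ E} {S : E} (ι : ∀ z, F.sec z → (q.obj z ⟶ S)) :
    ∀ {z : Z}, SecRel F z → (q.obj z ⟶ S)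
  | _, add s t => ι _ (s + t)
  | _, smul r s => ι _ (r • s)
  | _, res f s => ι _ (F.res f s)

lemma lhs_comp {q : Z ⥤ E} {S S' : E} (ι : ∀ z, F.sec z → (q.obj z ⟶ S)) (g : S ⟶ S') {z : Z}
    (r : SecRel F z) : lhs ι r ≫ g = lhs (fun z s => ι z s ≫ g) r := by
  cases r <;> rfl

variable [Preadditive E] [Linear K E]

/-- The right hand side of a relation, evaluated in a family of morphisms. -/
def rhs {q : Z ⥤ E} {S : E} (ι : ∀ z, F.sec z → (q.obj z ⟶ S)) :
    ∀ {z : Z}, SecRel F z → (q.obj z ⟶ S)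
  | _, add s t => ι _ s + ι _ t
  | _, smul r s => r • ι _ s
  | _, res f s => q.map f ≫ ι _ s

lemma rhs_comp {q : Z ⥤ E} {S S' : E} (ι : ∀ z, F.sec z → (q.obj z ⟶ S)) (g : S ⟶ S') {z : Z}
    (r : SecRel F z) : rhs ι r ≫ g = rhs (fun z s => ι z s ≫ g) r := by
  cases r with
  | add s t => exact Preadditive.add_comp _ _ _ _ _ _
  | smul r s => exact Linear.smul_comp _ _ _ _ _ _
  | res f s => exact Category.assoc _ _ _

/-- A family of morphisms satisfying the relations, as a morphism to a nerve. -/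
def toNerve {q : Z ⥤ E} [q.Additive] [q.Linear K] {S : E} (ι : ∀ z, F.sec z → (q.obj z ⟶ S))
    (h : ∀ {z : Z} (r : SecRel F z), lhs ι r = rhs ι r) : F ⟶ (nerve K q).obj S :=
  mkHom (fun z =>
    { toFun := fun s => ennerve (ι z s)
      map_add' := fun s t => congrArg ennerve (h (add s t))
      map_smul' := fun r s => congrArg ennerve (h (smul r s)) })
    (fun f s => congrArg ennerve (h (res f s)))

@[simp] lemma unnerve_toNerve {q : Z ⥤ E} [q.Additive] [q.Linear K] {S : E}
    (ι : ∀ z, F.sec z → (q.obj z ⟶ S)) (h : ∀ {z : Z} (r : SecRel F z), lhs ι r = rhs ι r) (z : Z)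
    (s : F.sec z) :
    unnerve (app (toNerve ι h) z s) = ι z s := rfl

/-- Together with `toNerve` this identifies maps from `F` to a nerve with families satisfying the
section relations, that is, with cocones under the presentation of the weighted colimit. -/
lemma lhs_eq_rhs {q : Z ⥤ E} [q.Additive] [q.Linear K] {S : E} (η : F ⟶ (nerve K q).obj S)
    {z : Z} (r : SecRel F z) :
    lhs (fun z s => unnerve (app η z s)) r = rhs (fun z s => unnerve (app η z s)) r := by
  cases r with
  | add s t => exact (congrArg unnerve (map_add (app η z) s t)).trans (map_add unnerve _ _)
  | smul r s => exact (congrArg unnerve (map_smul (app η z) r s)).trans (map_smul unnerve _ _)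
  | res f s => exact congrArg unnerve (app_res η f s)

end SecRel

section Weighted

variable {E : Type w} [Category.{u} E] [Preadditive E] [Linear K E] [HasColimits E]
variable (q : Z ⥤ E) (F : FreeCocompletion K Z)

open SecRel

/-- The generators of the weighted colimit. -/
noncomputable abbrev secCoproduct : E := ∐ fun g : Σ z, F.sec z => q.obj g.1

/-- The inclusion of a generator. -/
noncomputable abbrev secι (z : Z) (s : F.sec z) : q.obj z ⟶ secCoproduct q F :=
  Sigma.ι (fun g : Σ z, F.sec z => q.obj g.1) ⟨z, s⟩

/-- The left hand sides of all relations. -/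
noncomputable abbrev secLhs : (∐ fun r : Σ z, SecRel F z => q.obj r.1) ⟶ secCoproduct q F :=
  Sigma.desc (fun r => lhs (secι q F) r.2)

/-- The right hand sides of all relations. -/
noncomputable abbrev secRhs : (∐ fun r : Σ z, SecRel F z => q.obj r.1) ⟶ secCoproduct q F :=
  Sigma.desc (fun r => rhs (secι q F) r.2)

/-- The colimit of `q` weighted by `F`. -/
noncomputable abbrev weightedColimit : E := coequalizer (secLhs q F) (secRhs q F)

variable [q.Additive] [q.Linear K]

/-- The universal family of morphisms to the weighted colimit. -/
noncomputable def weightedUnit : F ⟶ (nerve K q).obj (weightedColimit q F) :=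
  toNerve (fun z s => secι q F z s ≫ coequalizer.π _ _) (fun {z} r => by
    rw [← lhs_comp, ← rhs_comp]
    have h := Sigma.ι (fun r : Σ z, SecRel F z => q.obj r.1) ⟨z, r⟩ ≫=
      coequalizer.condition (secLhs q F) (secRhs q F)
    simpa using h)

lemma unnerve_weightedUnit (z : Z) (s : F.sec z) :
    unnerve (app (weightedUnit q F) z s) =
      secι q F z s ≫ coequalizer.π (secLhs q F) (secRhs q F) := rfl

/-- The weighted colimit represents `e ↦ Hom(F, nerve e)`: a map out of the coequalizer is a family
on generators that respects the relations. This objectwise representability is all that is needed to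
construct a left adjoint of the nerve. -/
lemma bijective_weightedUnit (e : E) : Function.Bijective
    (fun f : weightedColimit q F ⟶ e => weightedUnit q F ≫ (nerve K q).map f) := by
  constructor
  · intro f g h
    refine coequalizer.hom_ext (Sigma.hom_ext _ _ fun ⟨z, s⟩ => ?_)
    have h' := congrArg (fun η => unnerve (app η z s)) h
    simpa [unnerve_weightedUnit] using h'
  · intro η
    refine ⟨coequalizer.desc (Sigma.desc fun g => unnerve (app η g.1 g.2))
      (Sigma.hom_ext _ _ fun ⟨_, r⟩ => ?_), ?_⟩
    · have h := lhs_eq_rhs η r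
      simpa [lhs_comp, rhs_comp] using h
    · refine hom_nerve_ext fun z s => ?_
      simp [unnerve_weightedUnit]

/-- The linear cocontinuous extension of a linear functor `q : Z ⥤ E`. -/
noncomputable def extension : FreeCocompletion K Z ⥤ E :=
  Adjunction.leftAdjointOfEquiv (G := nerve K q) (F_obj := weightedColimit q)
    (fun F e => Equiv.ofBijective _ (bijective_weightedUnit q F e))
    (fun _ _ _ _ _ => by simp)

/-- The extension of `q` is left adjoint to its nerve. -/
noncomputable def extensionAdj : extension q ⊣ nerve K q :=
  Adjunction.adjunctionOfEquivLeft _ _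

end Weighted

section Density

variable {E : Type w} [Category.{u} E] [Preadditive E] [Linear K E]

open SecRel

variable (F : FreeCocompletion K Z)

/-- The presentation of a presheaf by generators. -/
noncomputable def presπ : secCoproduct (yoneda K Z) F ⟶ F :=
  Sigma.desc (fun g => ofSec g.2)

lemma secι_presπ (z : Z) (s : F.sec z) : secι (yoneda K Z) F z s ≫ presπ F = ofSec s := by
  exact Sigma.ι_desc _ _

/-- There is one case for each kind of relation, and each says that `ofSec` carries the operation on
sections to the corresponding operation on morphisms. -/
lemma presπ_condition :
    secLhs (yoneda K Z) F ≫ presπ F = secRhs (yoneda K Z) F ≫ presπ F := by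
  refine Sigma.hom_ext _ _ fun ⟨_, r⟩ => ?_
  simp only [colimit.ι_desc_assoc, Cofan.mk_ι_app, lhs_comp, rhs_comp, secι_presπ]
  cases r with
  | add s t => exact ofSec_add s t
  | smul r s => exact ofSec_smul r s
  | res f s => exact (ofSec_ofHom_comp_ofSec f s).symm

/-- Evaluation at the identities, from the nerve of the Yoneda embedding to the identity. -/
def evalNerve (G : FreeCocompletion K Z) : (nerve K (yoneda K Z)).obj G ⟶ G :=
  mkHom (fun z =>
    { toFun := fun s => app (unnerve s) z (ofHom (𝟙 z))
      map_add' := fun _ _ => rfl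
      map_smul' := fun _ _ => rfl })
    (fun {y z} f s => by
      change app (unnerve s) y (app (ofSec (ofHom f)) y (ofHom (𝟙 y))) =
        G.res f (app (unnerve s) z (ofHom (𝟙 z)))
      rw [← app_res]
      simp [res_ofHom])

/-- A section of the nerve of the Yoneda embedding is itself a morphism out of a representable, and
evaluating it at the identity recovers that morphism. -/
lemma ofSec_evalNerve {G : FreeCocompletion K Z} {z : Z}
    (s : ((nerve K (yoneda K Z)).obj G).sec z) :
    ofSec s ≫ evalNerve G = unnerve s := by
  rw [ofSec_comp]
  exact ofSec_app (unnerve s)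

lemma hom_ext_ofSec {G : FreeCocompletion K Z} {η θ : F ⟶ G}
    (h : ∀ (z : Z) (s : F.sec z), ofSec s ≫ η = ofSec s ≫ θ) : η = θ := by
  refine hom_ext' fun z s => ?_
  have h' := congrArg (fun κ => app κ z (ofHom (𝟙 z))) (h z s)
  simpa using h'

/-- A presheaf is presented by its sections and their relations. -/
noncomputable def presIsColimit : IsColimit (Cofork.ofπ (presπ F) (presπ_condition F)) :=
  Cofork.IsColimit.mk' _ fun c => by
    have h : ∀ {z : Z} (r : SecRel F z), lhs (fun z s => secι (yoneda K Z) F z s ≫ c.π) r =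
        rhs (fun z s => secι (yoneda K Z) F z s ≫ c.π) r := fun {z} r => by
      rw [← lhs_comp, ← rhs_comp]
      have h := Sigma.ι (fun r : Σ z, SecRel F z => (yoneda K Z).obj r.1) ⟨z, r⟩ ≫= c.condition
      simpa using h
    -- The legs of the cofork on the generators satisfy the section relations, so they form a map to
    -- the nerve of the Yoneda embedding; evaluation at identities brings it back to the target
    -- presheaf.
    refine ⟨toNerve _ h ≫ evalNerve _, Sigma.hom_ext _ _ fun ⟨z, s⟩ => ?_, fun {m} hm => ?_⟩
    · change secι (yoneda K Z) F z s ≫ presπ F ≫ _ = _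
      rw [← Category.assoc, secι_presπ, ← Category.assoc, ofSec_comp, ofSec_evalNerve,
        unnerve_toNerve]
    · refine hom_ext_ofSec F fun z s => ?_
      rw [← Category.assoc (ofSec s), ofSec_comp _ (toNerve _ _), ofSec_evalNerve, unnerve_toNerve,
        ← hm, ← secι_presπ, Category.assoc]
      rfl

end Density

/-! ### Linear cocontinuous functors out of the free cocompletion -/

section Cocont

variable {E : Type w} [Category.{u} E] [Preadditive E] [Linear K E]
variable {F : FreeCocompletion K Z}

open SecRel

section

variable {H : FreeCocompletion K Z ⥤ E} (hH : isLinearCocontinuous K _ _ H)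

include hH

/-- `H` preserves both the coequalizer presenting `F` and the coproduct of its generators, so the
images of the sections are jointly epimorphic. -/
lemma cocont_hom_ext {e : E} {f g : H.obj F ⟶ e}
    (h : ∀ (z : Z) (s : F.sec z), H.map (ofSec s) ≫ f = H.map (ofSec s) ≫ g) : f = g := by
  have := hH.2.2
  refine Cofork.IsColimit.hom_ext (isColimitCoforkMapOfIsColimit H _ (presIsColimit F)) ?_
  refine Cofan.IsColimit.hom_ext (isColimitOfHasCoproductOfPreservesColimit H _) _ _
    fun ⟨z, s⟩ => ?_
  have h' := h z s
  rw [← secι_presπ, H.map_comp, Category.assoc, Category.assoc] at h'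
  exact h'

/-- The existence half of the same preservation statement: the image under `H` of the presentation
of `F` is still a presentation of `H.obj F`. -/
lemma exists_cocont_desc {e : E} (a : ∀ z, F.sec z → (H.obj (rep K z) ⟶ e))
    (ha : ∀ {z : Z} (r : SecRel F z),
      lhs (q := yoneda K Z ⋙ H) a r = rhs (q := yoneda K Z ⋙ H) a r) :
    ∃ f : H.obj F ⟶ e, ∀ (z : Z) (s : F.sec z), H.map (ofSec s) ≫ f = a z s := by
  have := hH.2.2
  let hc := isColimitOfHasCoproductOfPreservesColimit H
    (fun g : Σ z, F.sec z => (yoneda K Z).obj g.1)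
  let hr := isColimitOfHasCoproductOfPreservesColimit H
    (fun r : Σ z, SecRel F z => (yoneda K Z).obj r.1)
  let d := Cofan.IsColimit.desc hc (fun g => a g.1 g.2)
  have hd : ∀ z s, H.map (secι (yoneda K Z) F z s) ≫ d = a z s := fun z s =>
    Cofan.IsColimit.fac hc _ (⟨z, s⟩ : Σ z, F.sec z)
  have w : H.map (secLhs (yoneda K Z) F) ≫ d = H.map (secRhs (yoneda K Z) F) ≫ d := by
    -- The coproduct indexed by the relations is preserved as well, so each relation can be checked
    -- alone. Linearity of `H` matches the image of a sum or multiple of generators with the sum or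
    -- multiple of their images.
    refine Cofan.IsColimit.hom_ext hr _ _ fun ⟨_, r⟩ => ?_
    let ιr := Sigma.ι (fun r : Σ z, SecRel F z => (yoneda K Z).obj r.1) ⟨_, r⟩
    change H.map ιr ≫ _ = H.map ιr ≫ _
    rw [← H.map_comp_assoc, ← H.map_comp_assoc,
      Sigma.ι_desc (fun r : Σ z, SecRel F z => lhs (secι (yoneda K Z) F) r.2),
      Sigma.ι_desc (fun r : Σ z, SecRel F z => rhs (secι (yoneda K Z) F) r.2)]
    have h := ha r
    cases r with
    | add s t =>
      simp only [lhs, rhs, hH.1, Preadditive.add_comp, hd] at h ⊢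
      exact h
    | smul r s =>
      simp only [lhs, rhs, hH.2.1, Linear.smul_comp, hd] at h ⊢
      exact h
    | res f s =>
      simp only [lhs, rhs, H.map_comp, Category.assoc, hd] at h ⊢
      exact h
  refine ⟨Cofork.IsColimit.desc (isColimitCoforkMapOfIsColimit H _ (presIsColimit F)) d w,
    fun z s => ?_⟩
  rw [← secι_presπ, H.map_comp, Category.assoc, ← hd]
  exact congrArg _ (Cofork.IsColimit.π_desc' (isColimitCoforkMapOfIsColimit H _ (presIsColimit F))
    d w)

end

end Cocont

end FreeCocompletion

namespace FreeCocompletion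

variable {K : Type u} [Field K]
variable {Z : Type u} [SmallCategory Z] [Preadditive Z] [Linear K Z]
variable {E : Type w} [Category.{u} E] [Preadditive E] [Linear K E]

open SecRel

/-- The inverse at `F` is assembled from the inverses at the representables through the presentation
of `H'.obj F`; both composites are identities because they are so on sections. -/
lemma isIso_app_of_isIso_app_rep {H H' : FreeCocompletion K Z ⥤ E}
    (hH : isLinearCocontinuous K _ _ H) (hH' : isLinearCocontinuous K _ _ H') (α : H ⟶ H')
    (hα : ∀ z, IsIso (α.app (rep K z))) (F : FreeCocompletion K Z) : IsIso (α.app F) := by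
  obtain ⟨β, hβ⟩ := exists_cocont_desc (F := F) hH'
    (fun z s => inv (α.app (rep K z)) ≫ H.map (ofSec s)) (fun r => by
      cases r with
      | add s t => simp [lhs, rhs, ofSec_add, hH.1]
      | smul r s => simp [lhs, rhs, ofSec_smul, hH.2.1]
      | res f s =>
        simp only [lhs, rhs, ← ofSec_ofHom_comp_ofSec f s, H.map_comp, Functor.comp_map,
          IsIso.inv_comp_eq]
        rw [← α.naturality_assoc]
        simp)
  refine ⟨β, cocont_hom_ext hH fun z s => ?_, cocont_hom_ext hH' fun z s => ?_⟩
  · rw [α.naturality_assoc, hβ]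
    simp
  · rw [reassoc_of% hβ z s, α.naturality]
    simp

/-- A natural transformation between the restrictions to representables of linear functors, the
first of which is cocontinuous, extends. -/
lemma exists_extend_natTrans {H H' : FreeCocompletion K Z ⥤ E}
    (hH : isLinearCocontinuous K _ _ H) (hH' : isLinearCocontinuous K _ _ H')
    (a : ∀ z, H.obj (rep K z) ⟶ H'.obj (rep K z))
    (nat : ∀ {y z : Z} (f : y ⟶ z), H.map ((yoneda K Z).map f) ≫ a z =
      a y ≫ H'.map ((yoneda K Z).map f)) :
    ∃ α : H ⟶ H', ∀ z, α.app (rep K z) = a z := by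
  have h (F : FreeCocompletion K Z) := exists_cocont_desc (F := F) hH
    (fun z s => a z ≫ H'.map (ofSec s)) (fun r => by
      cases r with
      | add s t => simp [lhs, rhs, ofSec_add, hH'.1]
      | smul r s => simp [lhs, rhs, ofSec_smul, hH'.2.1]
      | res f s =>
        simp only [lhs, rhs, ← ofSec_ofHom_comp_ofSec f s, H'.map_comp, Functor.comp_map]
        rw [← Category.assoc, ← nat f, Category.assoc])
  choose α hα using h
  refine ⟨{ app := α, naturality := fun F G η => ?_ }, fun z => ?_⟩
  -- The components are chosen independently for each presheaf; naturality follows from their being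
  -- determined on sections.
  · refine cocont_hom_ext hH fun z s => ?_
    rw [← H.map_comp_assoc, ofSec_comp, hα, reassoc_of% hα F z s, ← H'.map_comp, ofSec_comp]
  -- On a representable the prescribed component is recovered by testing on the universal section,
  -- which classifies the identity.
  · have h := hα (rep K z) z (ofHom (𝟙 z))
    have e : ofSec (ofHom (𝟙 z)) = 𝟙 (rep K z) := (yoneda K Z).map_id z
    rw [e, H.map_id, H'.map_id, Category.id_comp, Category.comp_id] at h
    exact h

/-- A linear functor is cocontinuous if it turns the presentation of each presheaf by its sections
and their relations into a presentation. -/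
lemma isLinearCocontinuous_of_desc (H : FreeCocompletion K Z ⥤ E)
    (h_add : ∀ ⦃F G : FreeCocompletion K Z⦄ (f g : F ⟶ G), H.map (f + g) = H.map f + H.map g)
    (h_smul : ∀ ⦃F G : FreeCocompletion K Z⦄ (r : K) (f : F ⟶ G), H.map (r • f) = r • H.map f)
    (h_ext : ∀ {F : FreeCocompletion K Z} {e : E} {f g : H.obj F ⟶ e},
      (∀ (z : Z) (s : F.sec z), H.map (ofSec s) ≫ f = H.map (ofSec s) ≫ g) → f = g)
    (h_desc : ∀ {F : FreeCocompletion K Z} {e : E} (a : ∀ z, F.sec z → (H.obj (rep K z) ⟶ e)),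
      (∀ {z : Z} (r : SecRel F z), lhs (q := yoneda K Z ⋙ H) a r = rhs (q := yoneda K Z ⋙ H) a r) →
      ∃ f : H.obj F ⟶ e, ∀ (z : Z) (s : F.sec z), H.map (ofSec s) ≫ f = a z s) :
    isLinearCocontinuous K _ _ H := by
  refine ⟨h_add, h_smul, ?_⟩
  have : H.Additive := ⟨fun {_ _ f g} => h_add f g⟩
  have : H.Linear K := ⟨fun f r => h_smul r f⟩
  let η (F : FreeCocompletion K Z) : F ⟶ (nerve K (yoneda K Z ⋙ H)).obj (H.obj F) :=
    toNerve (fun z s => H.map (ofSec s)) (fun r => by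
      cases r with
      | add s t => simp [lhs, rhs, ofSec_add]
      | smul r s => simp [lhs, rhs, ofSec_smul, h_smul]
      | res f s =>
        simp only [lhs, rhs, ← ofSec_ofHom_comp_ofSec f s, H.map_comp, Functor.comp_map])
  have hη (F : FreeCocompletion K Z) (z : Z) (s : F.sec z) :
    unnerve (app (η F) z s) = H.map (ofSec s) := rfl
  -- The two presentation hypotheses are injectivity and surjectivity here. They make the nerve of
  -- the restriction of `H` to representables a right adjoint of `H`, whence cocontinuity for
  -- colimits of every shape.
  have hb (F : FreeCocompletion K Z) (e : E) : Function.Bijective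
      (fun f : H.obj F ⟶ e => η F ≫ (nerve K (yoneda K Z ⋙ H)).map f) := by
    constructor
    · intro f g h
      refine h_ext fun z s => ?_
      have h' := congrArg (fun η => unnerve (app η z s)) h
      simpa [hη] using h'
    · intro θ
      obtain ⟨f, hf⟩ := h_desc _ (lhs_eq_rhs θ)
      refine ⟨f, hom_nerve_ext fun z s => ?_⟩
      simpa [hη] using hf z s
  have adj : H ⊣ nerve K (yoneda K Z ⋙ H) := Adjunction.mkOfHomEquiv
    { homEquiv := fun F e => Equiv.ofBijective _ (hb F e)
      homEquiv_naturality_left_symm := fun {F' F e} f g => by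
        rw [Equiv.symm_apply_eq]
        obtain ⟨g, rfl⟩ := (Equiv.ofBijective _ (hb F e)).surjective g
        rw [Equiv.symm_apply_apply]
        refine hom_nerve_ext fun z s => ?_
        simp [hη, ← Category.assoc, ← H.map_comp]
      homEquiv_naturality_right := fun {F e e'} f g => by simp }
  exact adj.leftAdjoint_preservesColimits

/-! ### Structure maps and universal property of the extension of a linear functor -/

section Extension

variable (q : Z ⥤ E) [q.Additive] [q.Linear K] [HasColimits E]

/-- The structure maps of the weighted colimit. -/
noncomputable def extι {F : FreeCocompletion K Z} {z : Z} (s : F.sec z) :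
    q.obj z ⟶ (extension q).obj F :=
  unnerve (app ((extensionAdj q).unit.app F) z s)

lemma extι_add {F : FreeCocompletion K Z} {z : Z} (s t : F.sec z) :
    extι q (s + t) = extι q s + extι q t := by
  simp only [extι]
  exact (congrArg unnerve (map_add (app _ z) s t)).trans (map_add unnerve _ _)

lemma extι_smul {F : FreeCocompletion K Z} {z : Z} (r : K) (s : F.sec z) :
    extι q (r • s) = r • extι q s := by
  simp only [extι]
  exact (congrArg unnerve (map_smul (app _ z) r s)).trans (map_smul unnerve _ _)

lemma extι_res {F : FreeCocompletion K Z} {y z : Z} (f : y ⟶ z) (s : F.sec z) :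
    extι q (F.res f s) = q.map f ≫ extι q s :=
  congrArg unnerve (app_res ((extensionAdj q).unit.app F) f s)

lemma extι_map {F G : FreeCocompletion K Z} (η : F ⟶ G) {z : Z} (s : F.sec z) :
    extι q s ≫ (extension q).map η = extι q (app η z s) :=
  congrArg (fun θ => unnerve (app θ z s)) ((extensionAdj q).unit.naturality η).symm

/-- A map out of the extension is determined by its transpose under the nerve adjunction, and the
transpose is composition with the structure maps. -/
lemma extension_hom_ext {F : FreeCocompletion K Z} {e : E} {f g : (extension q).obj F ⟶ e}
    (h : ∀ (z : Z) (s : F.sec z), extι q s ≫ f = extι q s ≫ g) : f = g := by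
  refine ((extensionAdj q).homEquiv F e).injective (hom_nerve_ext fun z s => ?_)
  simp only [Adjunction.homEquiv_unit, app_comp]
  exact h z s

lemma exists_extension_desc {F : FreeCocompletion K Z} {e : E} (η : F ⟶ (nerve K q).obj e) :
    ∃ f : (extension q).obj F ⟶ e, ∀ (z : Z) (s : F.sec z),
      extι q s ≫ f = unnerve (app η z s) := by
  obtain ⟨f, rfl⟩ := ((extensionAdj q).homEquiv F e).surjective η
  exact ⟨f, fun z s => by simp [Adjunction.homEquiv_unit, extι]⟩

lemma isLinearCocontinuous_extension : isLinearCocontinuous K _ _ (extension (K := K) q) := by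
  refine ⟨fun F G f g => extension_hom_ext q fun z s => ?_,
    fun F G r f => extension_hom_ext q fun z s => ?_,
    (extensionAdj q).leftAdjoint_preservesColimits⟩
  · rw [Preadditive.comp_add, extι_map, extι_map, extι_map, app_add, extι_add]
  · rw [Linear.comp_smul, extι_map, extι_map, app_smul, extι_smul]

/-- The extension restricts to `q` along the Yoneda embedding. The inverse is the transpose of the
action of `q` on morphisms, seen as a map from the representable to the nerve of `q.obj z`. -/
lemma isIso_extι_id (z : Z) : IsIso (extι q (ofHom (K := K) (𝟙 z))) := by
  obtain ⟨f, hf⟩ := exists_extension_desc q (F := rep K z) (e := q.obj z)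
    (toNerve (fun y s => q.map (toHom s)) (fun r => by
      cases r with
      | add s t => simp [lhs, rhs]
      | smul r s => simp [lhs, rhs, q.map_smul]
      | res f s => simp [lhs, rhs]))
  refine ⟨f, ?_, extension_hom_ext q fun y s => ?_⟩
  · rw [hf, unnerve_toNerve, toHom_ofHom, q.map_id]
  · rw [reassoc_of% hf, unnerve_toNerve, ← extι_res, ← eq_res, Category.comp_id]

end Extension

end FreeCocompletion

namespace Day

open FreeCocompletion SecRel

/-! ### Day convolution as a functor -/

variable {K : Type u} [Field K]
variable {B C D : Type u} [SmallCategory B] [SmallCategory C] [SmallCategory D]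
variable [Preadditive B] [Preadditive C] [Preadditive D] [Linear K B] [Linear K C] [Linear K D]
variable (T : B ⥤ C ⥤ D)

variable (K) in
/-- Day convolution along `T` as a functor of two variables. -/
noncomputable abbrev convFunctor :
    FreeCocompletion K B ⥤ FreeCocompletion K C ⥤ FreeCocompletion K D where
  obj F :=
    { obj := fun G => conv T F G
      map := fun θ => map T (𝟙 F) θ
      map_id := fun G => map_id
      map_comp := fun θ θ' => conv_hom_ext (by simp) }
  map η :=
    { app := fun G => map T η (𝟙 G)
      naturality := fun G G' θ => conv_hom_ext (by simp) }
  map_id F := by ext1; funext G; exact map_id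
  map_comp η η' := by ext1; funext G; exact conv_hom_ext (by simp)

/-- On generators, morphisms act only on the two sections, and the coend is linear in each of these
by its relators. -/
instance isBilinear_convFunctor : IsBilinear K (convFunctor K T) where
  map_add_left _ _ _ := conv_hom_ext (by simp)
  map_smul_left _ _ _ := conv_hom_ext (by simp)
  map_add_right _ _ _ _ _ := conv_hom_ext (by simp)
  map_smul_right _ _ _ _ _ := conv_hom_ext (by simp)

/-- A coend generator `φ ⊗ s ⊗ t` is the image, under the map classifying `s`, of `φ ⊗ 𝟙 ⊗ t` over a
representable. The presentation of `F` by its sections therefore induces a presentation of the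
convolution, and `isLinearCocontinuous_of_desc` applies. -/
lemma isLinearCocontinuous_convFunctor_flip_obj (G : FreeCocompletion K C) :
    isLinearCocontinuous K _ _ ((convFunctor K T).flip.obj G) := by
  refine isLinearCocontinuous_of_desc _
    (fun _ _ f g => IsBilinear.map_add_left (K := K) (T := convFunctor K T) f g G)
    (fun _ _ r f => IsBilinear.map_smul_left (K := K) (T := convFunctor K T) r f G) ?_ ?_
  · intro F H f g h
    refine conv_hom_ext fun {d b c} φ s t => ?_
    have h' := congrArg (fun η => app η d (cmk (F := rep K b) φ (ofHom (𝟙 b)) t)) (h b s)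
    simpa using h'
  · intro F H a ha
    let m : ∀ d, TriMap T F G d (H.sec d) := fun d =>
      -- This value is forced by evaluating the desired map at that image. The three kinds of
      -- section relations satisfied by `a` give additivity, homogeneity and dinaturality in the
      -- first variable; in the second they already hold in the convolution.
      { f := fun {b c} φ s t => app (a b s) d (cmk (F := rep K b) φ (ofHom (𝟙 b)) t)
        add_left := fun {b c} φ s s' t => by
          have h : a b (s + s') = a b s + a b s' := ha (.add s s')
          rw [h, app_add]
        smul_left := fun {b c} r φ s t => by
          have h : a b (r • s) = r • a b s := ha (.smul r s)
          rw [h, app_smul]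
        dinat_left := fun {b b' c} g φ s t => by
          have h : a b (F.res g s) = map T (ofSec (ofHom g)) (𝟙 G) ≫ a b' s := ha (.res g s)
          rw [h, app_comp, app_map_cmk, app_ofSec, toHom_ofHom, res_ofHom, Category.id_comp,
            ← Category.comp_id g, ← res_ofHom g (𝟙 b'), cmk_res_left, app_id, Category.comp_id] }
    have nat : ∀ {d d' : D} (h : d ⟶ d') {b : B} {c : C} (φ : d' ⟶ (T.obj b).obj c) (s : F.sec b)
        (t : G.sec c), (m d).f (h ≫ φ) s t = H.res h ((m d').f φ s t) := by simp [m, ← app_res]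
    refine ⟨desc m nat, fun b s => conv_hom_ext fun {d b' c} φ f t => ?_⟩
    have h : a b' (F.res (toHom f) s) = map T (ofSec (ofHom (toHom f))) (𝟙 G) ≫ a b s :=
      ha (.res (toHom f) s)
    change app (desc m nat) d (app (map T (ofSec s) (𝟙 G)) d (cmk φ f t)) = _
    rw [app_map_cmk, app_desc]
    simp only [m]
    rw [app_ofSec, h, app_comp, app_map_cmk, app_ofSec, toHom_ofHom,
      res_ofHom, Category.id_comp, ofHom_toHom, app_id, app_id]

lemma isLinearCocontinuous_convFunctor_obj (F : FreeCocompletion K B) :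
    isLinearCocontinuous K _ _ ((convFunctor K T).obj F) := by
  refine isLinearCocontinuous_of_desc _
    (fun _ _ f g => IsBilinear.map_add_right (K := K) (T := convFunctor K T) F f g)
    (fun _ _ r f => IsBilinear.map_smul_right (K := K) (T := convFunctor K T) F r f) ?_ ?_
  · intro G H f g h
    refine conv_hom_ext fun {d b c} φ s t => ?_
    have h' := congrArg (fun η => app η d (cmk (G := rep K c) φ s (ofHom (𝟙 c)))) (h c t)
    simpa using h'
  · intro G H a ha
    let m : ∀ d, TriMap T F G d (H.sec d) := fun d =>
      -- The mirror image of the argument in the first variable: now the second section is replaced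
      -- by an identity, and its relations supply the axioms in the second variable.
      { f := fun {b c} φ s t => app (a c t) d (cmk (G := rep K c) φ s (ofHom (𝟙 c)))
        add_right := fun {b c} φ s t t' => by
          have h : a c (t + t') = a c t + a c t' := ha (.add t t')
          rw [h, app_add]
        smul_right := fun {b c} r φ s t => by
          have h : a c (r • t) = r • a c t := ha (.smul r t)
          rw [h, app_smul]
        dinat_right := fun {b c c'} g φ s t => by
          have h : a c (G.res g t) = map T (𝟙 F) (ofSec (ofHom g)) ≫ a c' t := ha (.res g t)
          rw [h, app_comp, app_map_cmk, app_ofSec, toHom_ofHom, res_ofHom, Category.id_comp,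
            ← Category.comp_id g, ← res_ofHom g (𝟙 c'), cmk_res_right, app_id, Category.comp_id] }
    have nat : ∀ {d d' : D} (h : d ⟶ d') {b : B} {c : C} (φ : d' ⟶ (T.obj b).obj c) (s : F.sec b)
        (t : G.sec c), (m d).f (h ≫ φ) s t = H.res h ((m d').f φ s t) := by simp [m, ← app_res]
    refine ⟨desc m nat, fun c t => conv_hom_ext fun {d b c'} φ s f => ?_⟩
    have h : a c' (G.res (toHom f) t) = map T (𝟙 F) (ofSec (ofHom (toHom f))) ≫ a c t :=
      ha (.res (toHom f) t)
    change app (desc m nat) d (app (map T (𝟙 F) (ofSec t)) d (cmk φ s f)) = _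
    rw [app_map_cmk, app_desc]
    simp only [m]
    rw [app_ofSec, h, app_comp, app_map_cmk, app_ofSec, toHom_ofHom,
      res_ofHom, Category.id_comp, ofHom_toHom, app_id, app_id]

/-- The canonical map from the presheaf represented by `T(b, c)` to the Day convolution of
represented presheaves. -/
noncomputable def repHom (b : B) (c : C) :
    rep K ((T.obj b).obj c) ⟶ conv T (rep K b) (rep K c) :=
  ofSec (cmk (𝟙 _) (ofHom (𝟙 b)) (ofHom (𝟙 c)))

lemma app_repHom {b : B} {c : C} {d : D} (f : d ⟶ (T.obj b).obj c) :
    app (repHom (K := K) T b c) d (ofHom f) = cmk f (ofHom (𝟙 b)) (ofHom (𝟙 c)) := by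
  rw [repHom, app_ofSec, toHom_ofHom, res_cmk, Category.comp_id]

/-- The co-Yoneda normal form: dinaturality absorbs both sections into the morphism, leaving
identities in the two representable slots. -/
lemma cmk_rep {b b' : B} {c c' : C} {d : D} (φ : d ⟶ (T.obj b').obj c') (f : (rep K b).sec b')
    (g : (rep K c).sec c') : cmk φ f g =
      cmk (φ ≫ (T.map (toHom f)).app c' ≫ (T.obj b).map (toHom g)) (ofHom (K := K) (𝟙 b))
        (ofHom (K := K) (𝟙 c)) := by
  conv_lhs => rw [eq_res f, eq_res g]
  rw [cmk_res_left, cmk_res_right, Category.assoc]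

/-- A section of a Day convolution given by a generator, as a composition. -/
lemma ofSec_cmk {F : FreeCocompletion K B} {G : FreeCocompletion K C} {b : B} {c : C} {d : D}
    (φ : d ⟶ (T.obj b).obj c) (s : F.sec b) (t : G.sec c) :
    ofSec (cmk φ s t) = ofSec (ofHom φ) ≫ repHom T b c ≫ map T (ofSec s) (ofSec t) := by
  refine rep_hom_ext ?_
  rw [app_ofSec, toHom_ofHom, res_id, app_comp, app_comp, app_ofSec, toHom_ofHom, res_ofHom,
    Category.id_comp, app_repHom, app_map_cmk, app_ofSec, app_ofSec, toHom_ofHom, toHom_ofHom,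
    res_id, res_id]

lemma repHom_naturality {b b' : B} {c c' : C} (f : b ⟶ b') (g : c ⟶ c') :
    ofSec (ofHom ((T.map f).app c ≫ (T.obj b').map g)) ≫ repHom (K := K) T b' c' =
      repHom T b c ≫ map T (ofSec (ofHom f)) (ofSec (ofHom g)) := by
  refine rep_hom_ext ?_
  simp only [app_comp, app_ofSec, app_repHom, app_map_cmk, toHom_ofHom, res_ofHom,
    Category.id_comp]
  rw [cmk_rep T _ (ofHom f)]
  simp

variable [IsBilinear K T]

/-- The inverse of the canonical map `repHom`. -/
noncomputable def repInv (b : B) (c : C) :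
    conv T (rep K b) (rep K c) ⟶ rep K ((T.obj b).obj c) :=
  desc (fun d =>
    { f := fun {b' c'} φ f g => ofHom (φ ≫ (T.map (toHom f)).app c' ≫ (T.obj b).map (toHom g))
      add_left := by simp [IsBilinear.map_add_left (K := K)]
      smul_left := by simp [IsBilinear.map_smul_left (K := K)]
      add_right := by simp [IsBilinear.map_add_right (K := K)]
      smul_right := by simp [IsBilinear.map_smul_right (K := K)] })
    (by simp [res_ofHom])

lemma app_repInv {b b' : B} {c c' : C} {d : D} (φ : d ⟶ (T.obj b').obj c') (f : (rep K b).sec b')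
    (g : (rep K c).sec c') : app (repInv T b c) d (cmk φ f g) =
      ofHom (φ ≫ (T.map (toHom f)).app c' ≫ (T.obj b).map (toHom g)) :=
  app_desc _ _ _ _ _

/-- Day convolution extends `T` along the Yoneda embeddings. Bilinearity of `T` makes the inverse
well defined on the coend, and `cmk_rep` shows that it is an inverse. -/
instance isIso_repHom (b : B) (c : C) : IsIso (repHom (K := K) T b c) := by
  refine ⟨repInv T b c, rep_hom_ext ?_, conv_hom_ext fun φ f g => ?_⟩
  · rw [app_comp, app_repHom, app_repInv, app_id]
    simp
  · rw [app_comp, app_repInv, app_repHom, app_id, cmk_rep T φ f g]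

end Day

open MonoidalLeftAction MonoidalRightAction

/-! ### Linear functors out of the naive balanced tensor product -/

section NaiveBalancedFunctor

variable (K : Type u) [Field K] (A X Y : Type u)
variable [SmallCategory A] [SmallCategory X] [SmallCategory Y]
variable [Preadditive X] [Preadditive Y] [Linear K X] [Linear K Y]
variable [MonoidalCategory A] [MonoidalRightAction A X] [MonoidalLeftAction A Y]
variable (E : Type w) [Category.{u} E] [Preadditive E] [Linear K E]

/-- A bilinear functor of two variables with a balancing isomorphism. -/
structure NaiveBalancedFunctor where
  /-- the functor of two variables -/
  functor : X ⥤ Y ⥤ E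
  bilinear : IsBilinear K functor
  /-- the balancing isomorphism -/
  bal : ∀ (x : X) (a : A) (y : Y),
    (functor.obj (x ⊙ᵣ a)).obj y ≅ (functor.obj x).obj (a ⊙ₗ y)
  bal_nat : ∀ {x x' : X} {a a' : A} {y y' : Y} (f : x ⟶ x') (g : a ⟶ a') (h : y ⟶ y'),
    ((functor.map (f ⊙ᵣₘ g)).app y ≫ (functor.obj (x' ⊙ᵣ a')).map h) ≫ (bal x' a' y').hom =
      (bal x a y).hom ≫ (functor.map f).app (a ⊙ₗ y) ≫ (functor.obj x').map (g ⊙ₗₘ h)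
  pentagon : ∀ (x : X) (a b : A) (y : Y),
    (bal (x ⊙ᵣ a) b y).hom ≫ (bal x a (b ⊙ₗ y)).hom =
      (functor.map (αᵣ x a b).inv).app y ≫ (bal x (a ⊗ b) y).hom ≫
        (functor.obj x).map (αₗ a b y).hom
  triangle : ∀ (x : X) (y : Y),
    (bal x (𝟙_ A) y).hom ≫ (functor.obj x).map (λₗ y).hom = (functor.map (ρᵣ x).hom).app y

namespace NaiveBalancedFunctor

open NaiveTensor NaiveBalancedTensor

variable {K A X Y E}
variable (B : NaiveBalancedFunctor K A X Y E)

/-- The value on an object of the naive tensor product. -/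
abbrev objMap (p : NaiveTensor K X Y) : E := (B.functor.obj p.fst).obj p.snd

/-- The value on a morphism of the naive tensor product. -/
noncomputable def tensorMap (p q : NaiveTensor K X Y) : (p ⟶ q) →ₗ[K] (B.objMap p ⟶ B.objMap q) :=
  TensorProduct.lift (LinearMap.mk₂ K
    (fun (f : p.fst ⟶ q.fst) (g : p.snd ⟶ q.snd) =>
      (B.functor.map f).app p.snd ≫ (B.functor.obj q.fst).map g)
    (fun f f' g => by rw [B.bilinear.map_add_left, Preadditive.add_comp])
    (fun r f g => by rw [B.bilinear.map_smul_left, Linear.smul_comp])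
    (fun f g g' => by rw [B.bilinear.map_add_right, Preadditive.comp_add])
    (fun r f g => by rw [B.bilinear.map_smul_right, Linear.comp_smul]))

lemma tensorMap_tmul {x x' : X} {y y' : Y} (f : x ⟶ x') (g : y ⟶ y') :
    B.tensorMap ⟨x, y⟩ ⟨x', y'⟩ (tmul f g) =
      (B.functor.map f).app y ≫ (B.functor.obj x').map g :=
  TensorProduct.lift.tmul _ _

lemma tensorMap_tmul_id {x x' : X} (f : x ⟶ x') (y : Y) :
    B.tensorMap ⟨x, y⟩ ⟨x', y⟩ (tmul f (𝟙 y)) = (B.functor.map f).app y := by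
  simp [tensorMap_tmul]

lemma tensorMap_id_tmul (x : X) {y y' : Y} (g : y ⟶ y') :
    B.tensorMap ⟨x, y⟩ ⟨x, y'⟩ (tmul (𝟙 x) g) = (B.functor.obj x).map g := by
  simp [tensorMap_tmul]

lemma tensorMap_id (p : NaiveTensor K X Y) : B.tensorMap p p (𝟙 p) = 𝟙 _ := by
  refine (B.tensorMap_tmul (𝟙 p.fst) (𝟙 p.snd)).trans ?_
  simp

/-- Both sides are bilinear in the two morphisms, so pure tensors suffice; there the identity is
functoriality in each variable together with the interchange law. -/
lemma tensorMap_comp {p q r : NaiveTensor K X Y} (f : p ⟶ q) (g : q ⟶ r) :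
    B.tensorMap p r (f ≫ g) = B.tensorMap p q f ≫ B.tensorMap q r g := by
  change B.tensorMap p r (compMap p q r f g) = _
  induction f using TensorProduct.induction_on with
  | zero => rw [map_zero, LinearMap.zero_apply, map_zero]; exact zero_comp.symm
  | add x y hx hy =>
    rw [map_add, LinearMap.add_apply, map_add, hx, hy]
    exact (Preadditive.add_comp _ _ _ _ _ _).symm.trans
      (congrArg (· ≫ _) (map_add (B.tensorMap p q) x y).symm)
  | tmul f₁ f₂ =>
    induction g using TensorProduct.induction_on with
    | zero => rw [map_zero, map_zero, map_zero, comp_zero]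
    | add x y hx hy => rw [map_add, map_add, hx, hy, map_add, Preadditive.comp_add]
    | tmul g₁ g₂ =>
      rw [compMap_tmul]
      refine (B.tensorMap_tmul _ _).trans ?_
      refine Eq.trans ?_ (congrArg₂ CategoryStruct.comp (B.tensorMap_tmul _ _).symm
        (B.tensorMap_tmul _ _).symm)
      simp

/-- The value on a formal expression. -/
noncomputable def wordMap : ∀ {p q : NaiveTensor K X Y}, Word K A X Y p q →
    (B.objMap p ⟶ B.objMap q)
  | _, _, .of f => B.tensorMap _ _ f
  | _, _, .bal x a y => (B.bal x a y).hom
  | _, _, .balInv x a y => (B.bal x a y).inv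
  | _, _, .comp f g => wordMap f ≫ wordMap g
  | _, _, .add f g => wordMap f + wordMap g
  | _, _, .smul c f => c • wordMap f

/-- The structural relations hold because `E` is a linear category and `tensorMap` a linear functor.
Those on the new morphisms are invertibility, naturality, pentagon and triangle of the balancing of
`B`. -/
lemma wordMap_eq {p q : NaiveTensor K X Y} {f g : Word K A X Y p q} (h : Rel f g) :
    B.wordMap f = B.wordMap g := by
  induction h with
  | refl f => rfl
  | symm _ ih => exact ih.symm
  | trans _ _ ih ih' => exact ih.trans ih'
  | comp_congr _ _ ih ih' => simp only [wordMap, ih, ih']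
  | add_congr _ _ ih ih' => simp only [wordMap, ih, ih']
  | smul_congr c _ ih => simp only [wordMap, ih]
  | id_comp f => simp only [wordMap, tensorMap_id, Category.id_comp]
  | comp_id f => simp only [wordMap, tensorMap_id, Category.comp_id]
  | assoc f g h => simp only [wordMap, Category.assoc]
  | add_assoc f g h => simp only [wordMap, add_assoc]
  | add_comm f g => simp only [wordMap, add_comm]
  | zero_add f => simp only [wordMap, map_zero, zero_add]
  | neg_add f => simp only [wordMap, map_zero, neg_smul, one_smul, neg_add_cancel]
  | one_smul f => simp only [wordMap, one_smul]
  | mul_smul c c' f => simp only [wordMap, mul_smul]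
  | smul_add c f g => simp only [wordMap, smul_add]
  | add_smul c c' f => simp only [wordMap, add_smul]
  | add_comp f f' g => simp only [wordMap, Preadditive.add_comp]
  | comp_add f g g' => simp only [wordMap, Preadditive.comp_add]
  | smul_comp c f g => simp only [wordMap, Linear.smul_comp]
  | comp_smul c f g => simp only [wordMap, Linear.comp_smul]
  | of_comp f g => simp only [wordMap, tensorMap_comp]
  | of_add f g => simp only [wordMap, map_add]
  | of_smul c f => simp only [wordMap, map_smul]
  | bal_balInv x a y => simp only [wordMap, tensorMap_id, Iso.hom_inv_id]
  | balInv_bal x a y => simp only [wordMap, tensorMap_id, Iso.inv_hom_id]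
  | bal_nat f g h =>
    simp only [wordMap, tensorMap_tmul]
    exact B.bal_nat f g h
  | pentagon x a b y =>
    simp only [wordMap, tensorMap_tmul_id, tensorMap_id_tmul]
    exact B.pentagon x a b y
  | unit x y =>
    simp only [wordMap, tensorMap_tmul_id, tensorMap_id_tmul]
    exact B.triangle x y

/-- The linear functor out of the naive balanced tensor product determined by a balanced
functor. -/
noncomputable def lift : NaiveBalancedTensor K A X Y ⥤ E where
  obj p := B.objMap p.obj
  map {p q} f := _root_.Quotient.lift (s := setoid K A X Y p.obj q.obj) B.wordMap
    (fun _ _ h => B.wordMap_eq h) f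
  map_id p := B.tensorMap_id p.obj
  map_comp f g := by
    obtain ⟨f, rfl⟩ := homMk_surjective f
    obtain ⟨g, rfl⟩ := homMk_surjective g
    rfl

instance : B.lift.Additive where
  map_add {_ _ f g} := by
    obtain ⟨f, rfl⟩ := homMk_surjective f
    obtain ⟨g, rfl⟩ := homMk_surjective g
    rfl

instance : B.lift.Linear K where
  map_smul f r := by
    obtain ⟨f, rfl⟩ := homMk_surjective f
    rfl

end NaiveBalancedFunctor

/-! ### Generating morphisms of the naive balanced tensor product -/

namespace NaiveBalancedTensor

open NaiveTensor

variable {K A X Y}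

lemma tmul_comp {x x' x'' : X} {y y' y'' : Y} (f : x ⟶ x') (g : y ⟶ y') (f' : x' ⟶ x'')
    (g' : y' ⟶ y'') :
    tmul (K := K) f g ≫ tmul f' g' = tmul (f ≫ f') (g ≫ g') :=
  compMap_tmul (p := ⟨x, y⟩) (q := ⟨x', y'⟩) (r := ⟨x'', y''⟩) f g f' g'

/-- The morphism `f ⊗ g` of the naive balanced tensor product. -/
noncomputable def tens {x x' : X} {y y' : Y} (f : x ⟶ x') (g : y ⟶ y') :
    (⟨⟨x, y⟩⟩ : NaiveBalancedTensor K A X Y) ⟶ ⟨⟨x', y'⟩⟩ := homMk (.of (tmul f g))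

lemma tens_comp {x x' x'' : X} {y y' y'' : Y} (f : x ⟶ x') (g : y ⟶ y') (f' : x' ⟶ x'')
    (g' : y' ⟶ y'') :
    tens (K := K) (A := A) f g ≫ tens f' g' = tens (f ≫ f') (g ≫ g') :=
  have h : Rel (A := A) (.of (tmul (K := K) (f ≫ f') (g ≫ g'))) (.comp (.of (tmul f g))
      (.of (tmul f' g'))) := by
    rw [← tmul_comp]
    exact Rel.of_comp _ _
  (homMk_eq (p := ⟨⟨x, y⟩⟩) (q := ⟨⟨x'', y''⟩⟩) h).symm

lemma tens_add_left {x x' : X} {y y' : Y} (f f' : x ⟶ x') (g : y ⟶ y') :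
    tens (K := K) (A := A) (f + f') g = tens f g + tens f' g :=
  (congrArg (fun h => homMk (.of h)) (TensorProduct.add_tmul f f' g)).trans
    (homMk_eq (Rel.of_add (tmul f g) (tmul f' g)))

lemma tens_add_right {x x' : X} {y y' : Y} (f : x ⟶ x') (g g' : y ⟶ y') :
    tens (K := K) (A := A) f (g + g') = tens f g + tens f g' :=
  (congrArg (fun h => homMk (.of h)) (TensorProduct.tmul_add f g g')).trans
    (homMk_eq (Rel.of_add (tmul f g) (tmul f g')))

lemma tens_smul_left {x x' : X} {y y' : Y} (r : K) (f : x ⟶ x') (g : y ⟶ y') :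
    tens (K := K) (A := A) (r • f) g = r • tens f g :=
  (congrArg (fun h => homMk (.of h)) (TensorProduct.smul_tmul' r f g).symm).trans
    (homMk_eq (Rel.of_smul r (tmul f g)))

lemma tens_smul_right {x x' : X} {y y' : Y} (r : K) (f : x ⟶ x') (g : y ⟶ y') :
    tens (K := K) (A := A) f (r • g) = r • tens f g :=
  (congrArg (fun h => homMk (.of h)) (TensorProduct.tmul_smul r f g)).trans
    (homMk_eq (Rel.of_smul r (tmul f g)))

variable (K A X Y) in
/-- The canonical functor of two variables to the naive balanced tensor product. -/
noncomputable abbrev incl : X ⥤ Y ⥤ NaiveBalancedTensor K A X Y where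
  obj x :=
    { obj := fun y => ⟨⟨x, y⟩⟩
      map := fun g => tens (𝟙 x) g
      map_id := fun y => rfl
      map_comp := fun g g' => by rw [tens_comp, Category.id_comp] }
  map f :=
    { app := fun y => tens f (𝟙 y)
      naturality := fun y y' g => by simp [tens_comp] }
  map_id x := rfl
  map_comp f f' := by
    ext y
    exact (congrArg _ (Category.id_comp (𝟙 y)).symm).trans (tens_comp f (𝟙 y) f' (𝟙 y)).symm

instance isBilinear_incl : IsBilinear K (incl K A X Y) where
  map_add_left f g y := tens_add_left f g (𝟙 y)
  map_smul_left r f y := tens_smul_left r f (𝟙 y)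
  map_add_right x _ _ f g := tens_add_right (𝟙 x) f g
  map_smul_right x _ _ r f := tens_smul_right r (𝟙 x) f

lemma tens_eq {x x' : X} {y y' : Y} (f : x ⟶ x') (g : y ⟶ y') :
    tens (K := K) (A := A) f g =
      ((incl K A X Y).map f).app y ≫ ((incl K A X Y).obj x').map g := by
  simp [tens_comp]

/-- The canonical balancing isomorphism of the naive balanced tensor product. -/
noncomputable def balIso (x : X) (a : A) (y : Y) :
    (⟨⟨x ⊙ᵣ a, y⟩⟩ : NaiveBalancedTensor K A X Y) ≅ ⟨⟨x, a ⊙ₗ y⟩⟩ where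
  hom := homMk (.bal x a y)
  inv := homMk (.balInv x a y)
  hom_inv_id := homMk_eq (Rel.bal_balInv x a y)
  inv_hom_id := homMk_eq (Rel.balInv_bal x a y)

lemma balIso_nat {x x' : X} {a a' : A} {y y' : Y} (f : x ⟶ x') (g : a ⟶ a') (h : y ⟶ y') :
    tens (K := K) (f ⊙ᵣₘ g) h ≫ (balIso x' a' y').hom = (balIso x a y).hom ≫ tens f (g ⊙ₗₘ h) :=
  homMk_eq (Rel.bal_nat f g h)

lemma balIso_pentagon (x : X) (a b : A) (y : Y) :
    (balIso (K := K) (x ⊙ᵣ a) b y).hom ≫ (balIso x a (b ⊙ₗ y)).hom =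
      tens (αᵣ x a b).inv (𝟙 y) ≫ (balIso x (a ⊗ b) y).hom ≫ tens (𝟙 x) (αₗ a b y).hom :=
  homMk_eq (Rel.pentagon x a b y)

lemma balIso_triangle (x : X) (y : Y) :
    (balIso (K := K) x (𝟙_ A) y).hom ≫ tens (𝟙 x) (λₗ y).hom = tens (ρᵣ x).hom (𝟙 y) :=
  homMk_eq (Rel.unit x y)

/-- A family of morphisms which is compatible with the generating morphisms of the naive balanced
tensor product is natural. -/
lemma naturality_of_generators {E : Type w} [Category.{u} E] [Preadditive E] [Linear K E]
    (q q' : NaiveBalancedTensor K A X Y ⥤ E) [q.Additive] [q.Linear K] [q'.Additive] [q'.Linear K]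
    (a : ∀ p, q.obj p ⟶ q'.obj p)
    (h_tens : ∀ {x x' : X} {y y' : Y} (f : x ⟶ x') (g : y ⟶ y'),
      q.map (tens f g) ≫ a ⟨⟨x', y'⟩⟩ = a ⟨⟨x, y⟩⟩ ≫ q'.map (tens f g))
    (h_bal : ∀ (x : X) (c : A) (y : Y),
      q.map (balIso x c y).hom ≫ a ⟨⟨x, c ⊙ₗ y⟩⟩ = a ⟨⟨x ⊙ᵣ c, y⟩⟩ ≫ q'.map (balIso x c y).hom)
    {p p' : NaiveBalancedTensor K A X Y} (f : p ⟶ p') : q.map f ≫ a p' = a p ≫ q'.map f := by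
  obtain ⟨w, rfl⟩ := homMk_surjective f
  -- Unpacking the endpoints makes the indices of the word free variables, as induction on it
  -- requires.
  obtain ⟨p⟩ := p
  obtain ⟨p'⟩ := p'
  change Word K A X Y p p' at w
  induction w with
  | @of p p' f =>
    -- A morphism of the naive tensor product is a sum of pure tensors; additivity of both functors
    -- reduces the claim to `h_tens`.
    induction f using TensorProduct.induction_on with
    | zero =>
      change q.map (0 : (⟨p⟩ : NaiveBalancedTensor K A X Y) ⟶ ⟨p'⟩) ≫ _ =
        _ ≫ q'.map (0 : (⟨p⟩ : NaiveBalancedTensor K A X Y) ⟶ ⟨p'⟩)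
      rw [q.map_zero, q'.map_zero, zero_comp, comp_zero]
    | tmul f g => exact h_tens f g
    | add f g hf hg =>
      have e : (homMk (.of (f + g)) : (⟨p⟩ : NaiveBalancedTensor K A X Y) ⟶ ⟨p'⟩) =
        homMk (.of f) + homMk (.of g) := homMk_eq (Rel.of_add _ _)
      refine (congrArg (fun h => q.map h ≫ _) e).trans
        (Eq.trans ?_ (congrArg (fun h => _ ≫ q'.map h) e).symm)
      rw [q.map_add, q'.map_add, Preadditive.add_comp, Preadditive.comp_add, hf, hg]
  | bal x c y => exact h_bal x c y
  | balInv x c y =>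
    -- Compatibility with an isomorphism implies compatibility with its inverse, so the inverse
    -- generators need no separate hypothesis.
    change q.map (balIso x c y).inv ≫ _ = _ ≫ q'.map (balIso x c y).inv
    rw [← Functor.mapIso_inv, ← Functor.mapIso_inv, Iso.inv_comp_eq, ← Category.assoc,
      Iso.eq_comp_inv]
    exact (h_bal x c y).symm
  | comp f g hf hg =>
    change q.map (homMk f ≫ homMk g) ≫ _ = _ ≫ q'.map (homMk f ≫ homMk g)
    rw [q.map_comp, q'.map_comp, Category.assoc, hg, ← Category.assoc, hf, Category.assoc]
  | add f g hf hg =>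
    change q.map (homMk f + homMk g) ≫ _ = _ ≫ q'.map (homMk f + homMk g)
    rw [q.map_add, q'.map_add, Preadditive.add_comp, Preadditive.comp_add, hf, hg]
  | smul c f hf =>
    change q.map (c • homMk f) ≫ _ = _ ≫ q'.map (c • homMk f)
    rw [q.map_smul, q'.map_smul, Linear.smul_comp, Linear.comp_smul, hf]

end NaiveBalancedTensor

end NaiveBalancedFunctor

/-! ### The canonical balanced functor -/

namespace NaiveBalancedTensor

open FreeCocompletion Day

variable (K : Type u) [Field K] (A X Y : Type u)
variable [SmallCategory A] [SmallCategory X] [SmallCategory Y]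
variable [Preadditive X] [Preadditive Y] [Linear K X] [Linear K Y]
variable [MonoidalCategory A] [MonoidalRightAction A X] [MonoidalLeftAction A Y]

variable {K A X Y}

lemma balIso_nat₁ {x x' : X} (f : x ⟶ x') (a : A) (y : Y) :
    tens (K := K) (f ⊵ᵣ a) (𝟙 y) ≫ (balIso x' a y).hom =
      (balIso x a y).hom ≫ tens f (𝟙 (a ⊙ₗ y)) := by
  simpa using balIso_nat (K := K) f (𝟙 a) (𝟙 y)

lemma balIso_nat₂ (x : X) {a a' : A} (g : a ⟶ a') (y : Y) :
    tens (K := K) (x ⊴ᵣ g) (𝟙 y) ≫ (balIso x a' y).hom =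
      (balIso x a y).hom ≫ tens (𝟙 x) (g ⊵ₗ y) := by
  simpa using balIso_nat (K := K) (𝟙 x) g (𝟙 y)

lemma balIso_nat₃ (x : X) (a : A) {y y' : Y} (h : y ⟶ y') :
    tens (K := K) (𝟙 (x ⊙ᵣ a)) h ≫ (balIso x a y').hom =
      (balIso x a y).hom ≫ tens (𝟙 x) (a ⊴ₗ h) := by
  simpa using balIso_nat (K := K) (𝟙 x) (𝟙 a) h

/-- The pentagon of the Day balancing, evaluated on a generator of the threefold convolution.
Naturality of the adjoined isomorphism in `X` moves `χ` past it, and the pentagon relation finishes.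
-/
lemma incl_pentagon_aux {e : NaiveBalancedTensor K A X Y} {x b₁ c₁ : X} {c₂ b₂ : A} {b₃ : Y}
    (φ : e ⟶ ⟨⟨x, b₃⟩⟩) (ψ : x ⟶ b₁ ⊙ᵣ b₂) (χ : b₁ ⟶ c₁ ⊙ᵣ c₂) :
    (φ ≫ tens (ψ ≫ χ ⊵ᵣ b₂ ≫ (αᵣ c₁ c₂ b₂).inv) (𝟙 b₃) ≫ (balIso c₁ (c₂ ⊗ b₂) b₃).hom) ≫
      tens (𝟙 c₁) (𝟙 ((c₂ ⊗ b₂) ⊙ₗ b₃) ≫ (𝟙 (c₂ ⊗ b₂)) ⊵ₗ b₃ ≫ (αₗ c₂ b₂ b₃).hom) =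
      (φ ≫ tens ψ (𝟙 b₃) ≫ (balIso b₁ b₂ b₃).hom) ≫ tens χ (𝟙 (b₂ ⊙ₗ b₃)) ≫
        (balIso c₁ c₂ (b₂ ⊙ₗ b₃)).hom := by
  have h : tens (K := K) (ψ ≫ χ ⊵ᵣ b₂ ≫ (αᵣ c₁ c₂ b₂).inv) (𝟙 b₃) =
      tens ψ (𝟙 b₃) ≫ tens (χ ⊵ᵣ b₂) (𝟙 b₃) ≫ tens (A := A) (αᵣ c₁ c₂ b₂).inv (𝟙 b₃) := by
    simp [tens_comp]
  have n := balIso_nat₁ (K := K) χ b₂ b₃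
  have p := balIso_pentagon (K := K) c₁ c₂ b₂ b₃
  simp only [MonoidalLeftAction.id_actionHomLeft, Category.id_comp, h, Category.assoc]
  rw [← reassoc_of% n, ← p]

/-- The triangle of the Day balancing on a generator: naturality in the variable of `A` carries `s`
to the unit object, where the unit relation applies. -/
lemma incl_triangle_aux {e : NaiveBalancedTensor K A X Y} {x b₁ : X} {b₂ : A} {b₃ : Y}
    (φ : e ⟶ ⟨⟨x, b₃⟩⟩) (ψ : x ⟶ b₁ ⊙ᵣ b₂) (s : b₂ ⟶ 𝟙_ A) :
    (φ ≫ tens ψ (𝟙 b₃) ≫ (balIso b₁ b₂ b₃).hom) ≫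
      tens (𝟙 b₁) (𝟙 (b₂ ⊙ₗ b₃) ≫ s ⊵ₗ b₃ ≫ (λₗ b₃).hom) =
      φ ≫ tens (ψ ≫ b₁ ⊴ᵣ s ≫ (ρᵣ b₁).hom) (𝟙 b₃) := by
  have n := balIso_nat₂ (K := K) b₁ s b₃
  have p := balIso_triangle (K := K) (A := A) b₁ b₃
  have h : tens (K := K) (A := A) (ψ ≫ b₁ ⊴ᵣ s ≫ (ρᵣ b₁).hom) (𝟙 b₃) =
      tens ψ (𝟙 b₃) ≫ tens (b₁ ⊴ᵣ s) (𝟙 b₃) ≫ tens (ρᵣ b₁).hom (𝟙 b₃) := by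
    simp [tens_comp]
  have h' : tens (K := K) (A := A) (𝟙 b₁) (𝟙 (b₂ ⊙ₗ b₃) ≫ s ⊵ₗ b₃ ≫ (λₗ b₃).hom) =
      tens (𝟙 b₁) (s ⊵ₗ b₃) ≫ tens (𝟙 b₁) (λₗ b₃).hom := by
    simp [tens_comp]
  rw [h, h', ← p]
  simp only [Category.assoc]
  rw [reassoc_of% n]

variable (K A X Y) in
/-- The balancing isomorphisms of the naive balanced tensor product, as associativity
isomorphisms. -/
noncomputable def inclAssoc : Assoc (rightActionBifunctor A X) (incl K A X Y)
    (leftActionBifunctor A Y) (incl K A X Y) where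
  iso x a y := balIso x a y
  nat₁ f a y := balIso_nat₁ f a y
  nat₂ x _ _ f y := balIso_nat₂ x f y
  nat₃ x a _ _ f := balIso_nat₃ x a f

variable [Preadditive A] [Linear K A]
variable [MonoidalPreadditive A] [MonoidalLinear K A]
variable [LinearRightAction K A X] [LinearLeftAction K A Y]

variable (K A X Y) in
/-- The canonical balanced functor to the free cocompletion of the naive balanced tensor product,
given by Day convolution. -/
noncomputable def balancedConv : BalancedFunctor K (FreeCocompletion K A) (FreeCocompletion K X)
    (FreeCocompletion K Y) (FreeCocompletion K (NaiveBalancedTensor K A X Y)) where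
  functor := convFunctor K (incl K A X Y)
  bilinear := inferInstance
  cocont_left G := (isLinearCocontinuous_convFunctor_flip_obj _ G).2.2
  cocont_right F := (isLinearCocontinuous_convFunctor_obj _ F).2.2
  bal F C G := (inclAssoc K A X Y).convIso F C G
  bal_nat {F F' C C' G G'} f g h := by
    change (map _ (map _ f g) (𝟙 G) ≫ map _ (𝟙 _) h) ≫ (inclAssoc K A X Y).hom F' C' G' =
      (inclAssoc K A X Y).hom F C G ≫ map _ f (𝟙 _) ≫ map _ (𝟙 F') (map _ g h)
    rw [← map_comp, ← map_comp, Category.comp_id, Category.id_comp, Category.comp_id,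
      Category.id_comp, Assoc.hom_naturality]
  pentagon F C D G := by
    change (inclAssoc K A X Y).hom _ D G ≫ (inclAssoc K A X Y).hom F C _ =
      map _ ((rightAssoc A X).hom F C D) (𝟙 G) ≫ (inclAssoc K A X Y).hom F _ G ≫
      map _ (𝟙 F) ((leftAssoc A Y).hom C D G)
    symm
    apply Assoc.ext_left
    intro e x b₃ φ b₁ b₂ ψ P s₂ s₃
    -- The first factor is itself the convolution `F ⊛ C`, so a further induction is needed to reach
    -- generators with a section in each of the four slots.
    induction P using cind with
    | @h_mk c₁ c₂ χ s t =>
      simp only [app_comp, app_map_cmk, Assoc.app_hom, app_id]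
      rw [cmk_cmk_right (s₁ := s)]
      exact congrArg (fun κ => cmk κ s _) (incl_pentagon_aux φ ψ χ)
    | h_zero => simp
    | h_add x y hx hy => simp only [cmk_add_left, map_add, hx, hy]
  triangle F G := by
    change (inclAssoc K A X Y).hom F _ G ≫ map _ (𝟙 F) (leftUnitHom _ _ (leftActionUnit A Y) G) =
      map _ (rightUnitHom _ _ (rightActionUnit A X) F) (𝟙 G)
    apply Assoc.ext_left
    intro e x b₃ φ b₁ b₂ ψ s₁ s₂ s₃
    simp only [app_comp, app_map_cmk, Assoc.app_hom, app_id, app_rightUnitHom, app_leftUnitHom,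
      cmk_res_left, cmk_res_right]
    exact congrArg (fun κ => cmk κ s₁ s₃) (incl_triangle_aux φ ψ (toHom s₂))

end NaiveBalancedTensor

/-! ### Testing morphisms on sections of Day convolutions -/

namespace Day

open FreeCocompletion

section

variable {K : Type u} [Field K]
variable {B C D : Type u} [SmallCategory B] [SmallCategory C] [SmallCategory D]
variable [Preadditive B] [Preadditive C] [Preadditive D] [Linear K B] [Linear K C] [Linear K D]
variable {T : B ⥤ C ⥤ D}
variable {E : Type w} [Category.{u} E] [Preadditive E] [Linear K E]

lemma map_eq_comp {F F' : FreeCocompletion K B} {G G' : FreeCocompletion K C} (η : F ⟶ F')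
    (θ : G ⟶ G') : map T η θ = map T η (𝟙 G) ≫ map T (𝟙 F') θ := by
  rw [← map_comp, Category.comp_id, Category.id_comp]

instance isIso_map {F F' : FreeCocompletion K B} {G G' : FreeCocompletion K C} (η : F ⟶ F')
    (θ : G ⟶ G') [IsIso η] [IsIso θ] : IsIso (map T η θ) :=
  ⟨map T (inv η) (inv θ), by rw [← map_comp, IsIso.hom_inv_id, IsIso.hom_inv_id, map_id],
    by rw [← map_comp, IsIso.inv_hom_id, IsIso.inv_hom_id, map_id]⟩

/-- Morphisms out of the image of a Day convolution under a linear cocontinuous functor are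
determined on the images of pairs of sections. -/
lemma cocont_conv_hom_ext {H : FreeCocompletion K D ⥤ E} (hH : isLinearCocontinuous K _ _ H)
    {F : FreeCocompletion K B} {G : FreeCocompletion K C} {e : E} {f g : H.obj (conv T F G) ⟶ e}
    (h : ∀ {b : B} {c : C} (s : F.sec b) (t : G.sec c),
      H.map (map T (ofSec s) (ofSec t)) ≫ f = H.map (map T (ofSec s) (ofSec t)) ≫ g) : f = g := by
  refine cocont_hom_ext hH fun d x => ?_
  induction x using cind with
  | h_mk φ s t =>
    rw [ofSec_cmk, H.map_comp, H.map_comp, Category.assoc, Category.assoc, Category.assoc,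
      Category.assoc, h]
  | h_zero =>
    -- The zero section is written as a multiple by `0`, so that homogeneity of `H` makes its image
    -- vanish.
    have e : ofSec (0 : (conv T F G).sec d) = (0 : K) • ofSec (0 : (conv T F G).sec d) := by
      rw [← ofSec_smul, smul_zero]
    rw [e, hH.2.1, zero_smul, zero_comp, zero_comp]
  | h_add x y hx hy =>
    rw [ofSec_add, hH.1, Preadditive.add_comp, Preadditive.add_comp, hx, hy]

end

section

variable {K : Type u} [Field K]
variable {B₁ B₂ B₃ B₁₂ B₂₃ D : Type u} [SmallCategory B₁] [SmallCategory B₂] [SmallCategory B₃]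
variable [SmallCategory B₁₂] [SmallCategory B₂₃] [SmallCategory D]
variable [Preadditive B₁] [Preadditive B₂] [Preadditive B₃] [Preadditive B₁₂] [Preadditive B₂₃]
variable [Preadditive D] [Linear K B₁] [Linear K B₂] [Linear K B₃] [Linear K B₁₂] [Linear K B₂₃]
variable [Linear K D]
variable {S : B₁ ⥤ B₂ ⥤ B₁₂} {T : B₁₂ ⥤ B₃ ⥤ D} {U : B₂ ⥤ B₃ ⥤ B₂₃} {V : B₁ ⥤ B₂₃ ⥤ D}

/-- Morphisms out of the image of an iterated Day convolution under a linear cocontinuous functor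
are determined on the images of triples of sections. -/
lemma cocont_conv_conv_hom_ext {E : Type w} [Category.{u} E] [Preadditive E] [Linear K E]
    {H : FreeCocompletion K D ⥤ E} (hH : isLinearCocontinuous K _ _ H)
    {F₁ : FreeCocompletion K B₁} {F₂ : FreeCocompletion K B₂} {F₃ : FreeCocompletion K B₃} {e : E}
    {f g : H.obj (conv T (conv S F₁ F₂) F₃) ⟶ e}
    (h : ∀ {b₁ : B₁} {b₂ : B₂} {b₃ : B₃} (s₁ : F₁.sec b₁) (s₂ : F₂.sec b₂) (s₃ : F₃.sec b₃),
      H.map (map T (map S (ofSec s₁) (ofSec s₂)) (ofSec s₃)) ≫ f =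
        H.map (map T (map S (ofSec s₁) (ofSec s₂)) (ofSec s₃)) ≫ g) : f = g := by
  refine cocont_conv_hom_ext hH fun {x b₃} P s₃ => ?_
  induction P using cind with
  | h_mk φ s t =>
    -- A section of the inner convolution given by a generator factors through the convolution of
    -- the two classifying maps by `ofSec_cmk`, which brings in the hypothesis on triples.
    have e : map T (ofSec (cmk φ s t)) (ofSec s₃) = map T (ofSec (ofHom φ) ≫ repHom S _ _) (𝟙 _) ≫
        map T (map S (ofSec s) (ofSec t)) (ofSec s₃) := by
      rw [← map_comp, ofSec_cmk, Category.assoc, Category.id_comp]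
    rw [e, H.map_comp, Category.assoc, Category.assoc, h]
  | h_zero =>
    have e : ofSec (0 : (conv S F₁ F₂).sec x) = (0 : K) • ofSec (0 : (conv S F₁ F₂).sec x) := by
      rw [← ofSec_smul, smul_zero]
    have e' : map T (ofSec (0 : (conv S F₁ F₂).sec x)) (𝟙 (rep K b₃)) =
        (0 : K) • map T (ofSec (0 : (conv S F₁ F₂).sec x)) (𝟙 (rep K b₃)) := by
      conv_lhs => rw [e]
      exact IsBilinear.map_smul_left (K := K) (T := convFunctor K T) _ _ _
    rw [map_eq_comp, e', H.map_comp, hH.2.1, zero_smul, zero_comp, zero_comp, zero_comp]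
  | h_add P P' hP hP' =>
    have e : map T (ofSec (P + P')) (ofSec s₃) = map T (ofSec P) (ofSec s₃) +
        map T (ofSec P') (ofSec s₃) := by
      rw [map_eq_comp, map_eq_comp (ofSec P), map_eq_comp (ofSec P'), ← Preadditive.add_comp,
        ofSec_add]
      exact congrArg (· ≫ _) (IsBilinear.map_add_left (K := K) (T := convFunctor K T) _ _ _)
    rw [e, hH.1, Preadditive.add_comp, Preadditive.add_comp, hP, hP']

/-- The associativity isomorphism of Day convolution on represented presheaves. -/
lemma Assoc.repHom_comp_hom [IsBilinear K T] (a : Assoc S T U V) (b₁ : B₁) (b₂ : B₂) (b₃ : B₃) :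
    repHom (K := K) T ((S.obj b₁).obj b₂) b₃ ≫ map T (repHom S b₁ b₂) (𝟙 _) ≫
      a.hom (rep K b₁) (rep K b₂) (rep K b₃) =
    ofSec (ofHom (a.iso b₁ b₂ b₃).hom) ≫ repHom V b₁ ((U.obj b₂).obj b₃) ≫
      map V (𝟙 _) (repHom U b₂ b₃) := by
  refine rep_hom_ext ?_
  simp only [app_comp, app_ofSec, app_repHom, app_map_cmk, toHom_ofHom, res_ofHom,
    Category.id_comp, app_id, Assoc.app_hom, CategoryTheory.Functor.map_id, NatTrans.id_app]

end

end Day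

/-! ### Composition with the canonical balanced functor is fully faithful -/

namespace NaiveBalancedTensor

open FreeCocompletion Day

variable {K : Type u} [Field K] {A X Y : Type u}
variable [SmallCategory A] [SmallCategory X] [SmallCategory Y]
variable [Preadditive A] [Preadditive X] [Preadditive Y] [Linear K A] [Linear K X] [Linear K Y]
variable [MonoidalCategory A] [MonoidalPreadditive A] [MonoidalLinear K A]
variable [MonoidalRightAction A X] [LinearRightAction K A X]
variable [MonoidalLeftAction A Y] [LinearLeftAction K A Y]
variable {E : Type w} [Category.{u} E] [Preadditive E] [Linear K E]

variable {G G' : CocontFunctor K (FreeCocompletion K (NaiveBalancedTensor K A X Y)) E}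

/-- The components of a morphism between balanced functors obtained by composition. -/
def convApp (θ : (balancedConv K A X Y).postcomp G ⟶ (balancedConv K A X Y).postcomp G')
    (F : FreeCocompletion K X) (H : FreeCocompletion K Y) :
    G.obj.obj (conv (incl K A X Y) F H) ⟶ G'.obj.obj (conv (incl K A X Y) F H) :=
  (θ.hom.app F).app H

section

variable (θ : (balancedConv K A X Y).postcomp G ⟶ (balancedConv K A X Y).postcomp G')

/-- Joint naturality follows from naturality in each variable by factoring the map through a change
of one variable at a time. -/
lemma convApp_naturality {F F' : FreeCocompletion K X} {H H' : FreeCocompletion K Y} (f : F ⟶ F')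
    (h : H ⟶ H') :
    G.obj.map (map (incl K A X Y) f h) ≫ convApp θ F' H' =
      convApp θ F H ≫ G'.obj.map (map (incl K A X Y) f h) := by
  have n₁ : G.obj.map (map (incl K A X Y) f (𝟙 H)) ≫ convApp θ F' H =
      convApp θ F H ≫ G'.obj.map (map (incl K A X Y) f (𝟙 H)) :=
    congrArg (fun τ => τ.app H) (θ.hom.naturality f)
  have n₂ : G.obj.map (map (incl K A X Y) (𝟙 F') h) ≫ convApp θ F' H' =
      convApp θ F' H ≫ G'.obj.map (map (incl K A X Y) (𝟙 F') h) :=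
    (θ.hom.app F').naturality h
  rw [map_eq_comp, G.obj.map_comp, G'.obj.map_comp, Category.assoc, n₂, reassoc_of% n₁]

lemma convApp_bal (F : FreeCocompletion K X) (C : FreeCocompletion K A)
    (H : FreeCocompletion K Y) :
    convApp θ (conv (rightActionBifunctor A X) F C) H ≫
        G'.obj.map ((inclAssoc K A X Y).hom F C H) =
      G.obj.map ((inclAssoc K A X Y).hom F C H) ≫
        convApp θ F (conv (leftActionBifunctor A Y) C H) :=
  θ.comm F C H

end

/-- The canonical map from a represented presheaf to a Day convolution of represented
presheaves. -/
noncomputable def inclRep (x : X) (y : Y) :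
    rep K (⟨⟨x, y⟩⟩ : NaiveBalancedTensor K A X Y) ⟶ conv (incl K A X Y) (rep K x) (rep K y) :=
  repHom (incl K A X Y) x y

instance (x : X) (y : Y) : IsIso (inclRep (K := K) (A := A) x y) :=
  inferInstanceAs (IsIso (repHom (incl K A X Y) x y))

lemma inclRep_naturality {x x' : X} {y y' : Y} (f : x ⟶ x') (g : y ⟶ y') :
    ofSec (ofHom (tens f g)) ≫ inclRep (K := K) (A := A) x' y' =
      inclRep x y ≫ map (incl K A X Y) (ofSec (ofHom f)) (ofSec (ofHom g)) := by
  rw [tens_eq]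
  exact repHom_naturality (incl K A X Y) f g

/-- The canonical map from a represented presheaf to the right action on represented
presheaves. -/
noncomputable def rightRep (x : X) (c : A) :
    rep K (x ⊙ᵣ c) ⟶ conv (rightActionBifunctor A X) (rep K x) (rep K c) :=
  repHom (rightActionBifunctor A X) x c

/-- The canonical map from a represented presheaf to the left action on represented
presheaves. -/
noncomputable def leftRep (c : A) (y : Y) :
    rep K (c ⊙ₗ y) ⟶ conv (leftActionBifunctor A Y) (rep K c) (rep K y) :=
  repHom (leftActionBifunctor A Y) c y

instance (x : X) (c : A) : IsIso (rightRep (K := K) x c) :=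
  inferInstanceAs (IsIso (repHom (rightActionBifunctor A X) x c))

instance (c : A) (y : Y) : IsIso (leftRep (K := K) c y) :=
  inferInstanceAs (IsIso (repHom (leftActionBifunctor A Y) c y))

/-- Under the identification of representables with convolutions of representables, the Day
balancing is the Yoneda image of the adjoined isomorphism. This is how compatibility with balancings
becomes naturality on the naive balanced tensor product. -/
lemma inclRep_bal (x : X) (c : A) (y : Y) :
    inclRep (K := K) (x ⊙ᵣ c) y ≫ map (incl K A X Y) (rightRep x c) (𝟙 _) ≫
        (inclAssoc K A X Y).hom (rep K x) (rep K c) (rep K y) =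
      ofSec (ofHom (balIso x c y).hom) ≫ inclRep x (c ⊙ₗ y) ≫
        map (incl K A X Y) (𝟙 _) (leftRep c y) :=
  (inclAssoc K A X Y).repHom_comp_hom x c y

/-- Every representable is isomorphic, through `inclRep`, to a convolution, so agreement on
convolutions forces agreement on representables and then everywhere by cocontinuity. -/
instance faithful_postcompFunctor : ((balancedConv K A X Y).postcompFunctor E).Faithful where
  map_injective {G G'} η η' h := by
    have h' (F : FreeCocompletion K X) (H : FreeCocompletion K Y) :
        η.hom.app (conv (incl K A X Y) F H) = η'.hom.app (conv (incl K A X Y) F H) :=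
      congrArg (fun τ : BalancedFunctor.Hom _ _ => (τ.hom.app F).app H) h
    have h'' (p : NaiveBalancedTensor K A X Y) : η.hom.app (rep K p) = η'.hom.app (rep K p) := by
      obtain ⟨⟨x, y⟩⟩ := p
      have n := η.hom.naturality (inclRep x y)
      rw [h', η'.hom.naturality (inclRep x y)] at n
      exact ((cancel_mono _).1 n).symm
    apply ObjectProperty.hom_ext
    ext F
    refine cocont_hom_ext G.property fun z s => ?_
    rw [η.hom.naturality, η'.hom.naturality, h'']

/-- The components of `θ` at pairs of representables are transported along `inclRep` to a family on
the representables of the naive balanced tensor product, which is shown to be natural and then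
extended. -/
lemma exists_natTrans_of_hom
    (θ : (balancedConv K A X Y).postcomp G ⟶ (balancedConv K A X Y).postcomp G') :
    ∃ α : G.obj ⟶ G'.obj, ∀ (F : FreeCocompletion K X) (H : FreeCocompletion K Y),
      α.app (conv (incl K A X Y) F H) = convApp θ F H := by
  have : G.obj.Additive := ⟨fun {_ _ f g} => G.property.1 f g⟩
  have : G.obj.Linear K := ⟨fun f r => G.property.2.1 r f⟩
  have : G'.obj.Additive := ⟨fun {_ _ f g} => G'.property.1 f g⟩
  have : G'.obj.Linear K := ⟨fun f r => G'.property.2.1 r f⟩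
  obtain ⟨a, ha⟩ : ∃ a : ∀ p : NaiveBalancedTensor K A X Y,
      G.obj.obj (rep K p) ⟶ G'.obj.obj (rep K p), ∀ (x : X) (y : Y),
      a ⟨⟨x, y⟩⟩ ≫ G'.obj.map (inclRep x y) =
        G.obj.map (inclRep x y) ≫ convApp θ (rep K x) (rep K y) :=
    ⟨fun p => G.obj.map (inclRep p.obj.fst p.obj.snd) ≫ convApp θ _ _ ≫
      inv (G'.obj.map (inclRep p.obj.fst p.obj.snd)), by simp⟩
  have h_tens : ∀ {x x' : X} {y y' : Y} (f : x ⟶ x') (g : y ⟶ y'),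
      G.obj.map (ofSec (ofHom (tens f g))) ≫ a ⟨⟨x', y'⟩⟩ =
        a ⟨⟨x, y⟩⟩ ≫ G'.obj.map (ofSec (ofHom (tens f g))) := by
    intro x x' y y' f g
    rw [← cancel_mono (G'.obj.map (inclRep x' y')), Category.assoc, Category.assoc, ha,
      ← G'.obj.map_comp, inclRep_naturality, ← G.obj.map_comp_assoc, inclRep_naturality,
      G.obj.map_comp, G'.obj.map_comp, Category.assoc, convApp_naturality, reassoc_of% ha x y]
  have h_bal : ∀ (x : X) (c : A) (y : Y),
      G.obj.map (ofSec (ofHom (balIso x c y).hom)) ≫ a ⟨⟨x, c ⊙ₗ y⟩⟩ =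
        a ⟨⟨x ⊙ᵣ c, y⟩⟩ ≫ G'.obj.map (ofSec (ofHom (balIso x c y).hom)) := by
    intro x c y
    have n := inclRep_bal (K := K) x c y
    -- After passing to convolutions by an invertible map, `inclRep_bal` replaces the adjoined
    -- isomorphism by the Day balancing, and the claim becomes the compatibility of `θ` with
    -- balancings.
    rw [← cancel_mono (G'.obj.map (inclRep x (c ⊙ₗ y) ≫
        map (incl K A X Y) (𝟙 _) (leftRep c y))),
      Category.assoc, Category.assoc, ← G'.obj.map_comp, ← n, G'.obj.map_comp, G'.obj.map_comp,
      G'.obj.map_comp, reassoc_of% ha (x ⊙ᵣ c) y, reassoc_of% ha x (c ⊙ₗ y),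
      ← convApp_naturality, ← reassoc_of% convApp_naturality θ, convApp_bal,
      ← G.obj.map_comp_assoc, ← G.obj.map_comp_assoc, ← G.obj.map_comp_assoc,
      ← G.obj.map_comp_assoc, Category.assoc, Category.assoc, n]
  obtain ⟨α, hα⟩ := exists_extend_natTrans G.property G'.property a
    (fun f => naturality_of_generators (yoneda K _ ⋙ G.obj) (yoneda K _ ⋙ G'.obj) a h_tens h_bal f)
  refine ⟨α, fun F H => ?_⟩
  -- Both sides are natural, so testing on pairs of sections reduces the claim to convolutions of
  -- two representables, where cancelling the image of `inclRep` leaves the definition of the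
  -- family.
  refine cocont_conv_hom_ext G.property fun {x y} s t => ?_
  rw [α.naturality, convApp_naturality]
  refine congrArg (· ≫ _) ?_
  have h := α.naturality (inclRep (K := K) (A := A) x y)
  rw [hα, ha, cancel_epi] at h
  exact h

instance full_postcompFunctor : ((balancedConv K A X Y).postcompFunctor E).Full where
  map_surjective {G G'} θ := by
    obtain ⟨α, hα⟩ := exists_natTrans_of_hom θ
    refine ⟨ObjectProperty.homMk α, BalancedFunctor.Hom.ext ?_⟩
    ext F H
    exact hα F H

end NaiveBalancedTensor

/-! ### Unit constraints of Day convolution on representables -/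

namespace Day

open FreeCocompletion

variable {K : Type u} [Field K] {A Y : Type u} [SmallCategory A] [SmallCategory Y]
variable [Preadditive A] [Preadditive Y] [Linear K A] [Linear K Y]

lemma repHom_comp_leftUnitHom (T : A ⥤ Y ⥤ Y) [IsBilinear K T] (e : A) (l : LeftUnit T e) (y : Y) :
    repHom (K := K) T e y ≫ leftUnitHom T e l (rep K y) = ofSec (ofHom (l.iso y).hom) := by
  refine rep_hom_ext ?_
  rw [app_comp, app_repHom, app_leftUnitHom, toHom_ofHom, res_ofHom, app_ofSec, res_ofHom,
    toHom_ofHom, T.map_id, NatTrans.id_app, Category.id_comp, Category.id_comp, Category.comp_id]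

lemma repHom_comp_rightUnitHom (T : Y ⥤ A ⥤ Y) [IsBilinear K T] (e : A) (l : RightUnit T e)
    (y : Y) :
    repHom (K := K) T y e ≫ rightUnitHom T e l (rep K y) = ofSec (ofHom (l.iso y).hom) := by
  refine rep_hom_ext ?_
  rw [app_comp, app_repHom, app_rightUnitHom, toHom_ofHom, res_ofHom, app_ofSec, res_ofHom,
    toHom_ofHom, (T.obj y).map_id, Category.id_comp, Category.id_comp, Category.comp_id]

end Day

/-! ### Balanced functors on categories of presheaves -/

namespace BalancedFunctor

open FreeCocompletion Day NaiveBalancedTensor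

/-- A morphism of balanced functors with invertible components is invertible. -/
lemma isIso_of_isIso_app {K : Type u} [Field K] {C : Type v₁} [Category.{u} C]
    [MonoidalCategory C] {X : Type v₂} [Category.{u} X] [Preadditive X] [Linear K X]
    [MonoidalRightAction C X] {Y : Type v₃} [Category.{u} Y] [Preadditive Y] [Linear K Y]
    [MonoidalLeftAction C Y] {E : Type w} [Category.{u} E] [Preadditive E] [Linear K E]
    {P Q : BalancedFunctor K C X Y E} (η : P ⟶ Q)
    (h : ∀ x y, IsIso ((η.hom.app x).app y)) : IsIso η := by
  have h₁ (x : X) : IsIso (η.hom.app x) := NatIso.isIso_of_isIso_app _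
  have h₂ : IsIso η.hom := NatIso.isIso_of_isIso_app _
  refine ⟨{ hom := inv η.hom, comm := fun x c y => ?_ }, Hom.ext (IsIso.hom_inv_id η.hom),
    Hom.ext (IsIso.inv_hom_id η.hom)⟩
  rw [NatIso.isIso_inv_app, NatIso.isIso_inv_app, NatIso.isIso_inv_app, NatIso.isIso_inv_app,
    IsIso.inv_comp_eq, ← Category.assoc, IsIso.eq_comp_inv]
  exact (η.comm x c y).symm

variable {K : Type u} [Field K] {A X Y : Type u}
variable [SmallCategory A] [SmallCategory X] [SmallCategory Y]
variable [Preadditive A] [Preadditive X] [Preadditive Y] [Linear K A] [Linear K X] [Linear K Y]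
variable [MonoidalCategory A] [MonoidalPreadditive A] [MonoidalLinear K A]
variable [MonoidalRightAction A X] [LinearRightAction K A X]
variable [MonoidalLeftAction A Y] [LinearLeftAction K A Y]
variable {E : Type w} [Category.{u} E] [Preadditive E] [Linear K E]
variable (Q : BalancedFunctor K (FreeCocompletion K A) (FreeCocompletion K X)
  (FreeCocompletion K Y) E)

lemma isLinearCocontinuous_obj (F : FreeCocompletion K X) :
    isLinearCocontinuous K _ _ (Q.functor.obj F) :=
  ⟨fun _ _ f g => Q.bilinear.map_add_right F f g, fun _ _ r f => Q.bilinear.map_smul_right F r f,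
    Q.cocont_right F⟩

lemma isLinearCocontinuous_flip_obj (H : FreeCocompletion K Y) :
    isLinearCocontinuous K _ _ (Q.functor.flip.obj H) :=
  ⟨fun _ _ f g => Q.bilinear.map_add_left f g H, fun _ _ r f => Q.bilinear.map_smul_left r f H,
    Q.cocont_left H⟩

/-- The value of a balanced functor on a pair of presheaves. -/
abbrev val (F : FreeCocompletion K X) (H : FreeCocompletion K Y) : E := (Q.functor.obj F).obj H

/-- The value of a balanced functor on a pair of morphisms. -/
def valMap {F F' : FreeCocompletion K X} {H H' : FreeCocompletion K Y} (f : F ⟶ F') (h : H ⟶ H') :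
    Q.val F H ⟶ Q.val F' H' :=
  (Q.functor.map f).app H ≫ (Q.functor.obj F').map h

section

variable {F F' F'' : FreeCocompletion K X} {H H' H'' : FreeCocompletion K Y}

lemma valMap_id_right (f : F ⟶ F') : Q.valMap f (𝟙 H) = (Q.functor.map f).app H := by
  simp [valMap]

lemma valMap_id_left (h : H ⟶ H') : Q.valMap (𝟙 F) h = (Q.functor.obj F).map h := by
  simp [valMap]

lemma valMap_id : Q.valMap (𝟙 F) (𝟙 H) = 𝟙 _ := by simp [valMap]

lemma valMap_comp (f : F ⟶ F') (f' : F' ⟶ F'') (h : H ⟶ H') (h' : H' ⟶ H'') :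
    Q.valMap (f ≫ f') (h ≫ h') = Q.valMap f h ≫ Q.valMap f' h' := by
  simp [valMap]

lemma valMap_comp_left (f : F ⟶ F') (f' : F' ⟶ F'') :
    Q.valMap (f ≫ f') (𝟙 H) = Q.valMap f (𝟙 H) ≫ Q.valMap f' (𝟙 H) := by
  simp [valMap]

lemma valMap_comp_right (h : H ⟶ H') (h' : H' ⟶ H'') :
    Q.valMap (𝟙 F) (h ≫ h') = Q.valMap (𝟙 F) h ≫ Q.valMap (𝟙 F) h' := by
  simp [valMap]

lemma valMap_exchange (f : F ⟶ F') (h : H ⟶ H') :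
    Q.valMap (𝟙 F) h ≫ Q.valMap f (𝟙 H') = Q.valMap f (𝟙 H) ≫ Q.valMap (𝟙 F') h := by
  rw [← valMap_comp, ← valMap_comp, Category.id_comp, Category.comp_id, Category.id_comp,
    Category.comp_id]

instance (f : F ⟶ F') (h : H ⟶ H') [IsIso f] [IsIso h] : IsIso (Q.valMap f h) := by
  unfold valMap
  infer_instance

lemma valMap_add_left (f f' : F ⟶ F') (h : H ⟶ H') :
    Q.valMap (f + f') h = Q.valMap f h + Q.valMap f' h := by
  rw [valMap, Q.bilinear.map_add_left, Preadditive.add_comp, valMap, valMap]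

lemma valMap_smul_left (r : K) (f : F ⟶ F') (h : H ⟶ H') :
    Q.valMap (r • f) h = r • Q.valMap f h := by
  rw [valMap, Q.bilinear.map_smul_left, Linear.smul_comp, valMap]

lemma valMap_add_right (f : F ⟶ F') (h h' : H ⟶ H') :
    Q.valMap f (h + h') = Q.valMap f h + Q.valMap f h' := by
  rw [valMap, Q.bilinear.map_add_right, Preadditive.comp_add, valMap, valMap]

lemma valMap_smul_right (r : K) (f : F ⟶ F') (h : H ⟶ H') :
    Q.valMap f (r • h) = r • Q.valMap f h := by
  rw [valMap, Q.bilinear.map_smul_right, Linear.comp_smul, valMap]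

end

/-- The balancing isomorphism of a balanced functor on free cocompletions. -/
def valBal (F : FreeCocompletion K X) (C : FreeCocompletion K A) (H : FreeCocompletion K Y) :
    Q.val (conv (rightActionBifunctor A X) F C) H ≅ Q.val F (conv (leftActionBifunctor A Y) C H) :=
  Q.bal F C H

section

variable {F F' : FreeCocompletion K X} {C C' : FreeCocompletion K A} {H H' : FreeCocompletion K Y}

lemma valBal_naturality (f : F ⟶ F') (g : C ⟶ C') (h : H ⟶ H') :
    Q.valMap (map (rightActionBifunctor A X) f g) h ≫ (Q.valBal F' C' H').hom =
      (Q.valBal F C H).hom ≫ Q.valMap f (map (leftActionBifunctor A Y) g h) :=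
  Q.bal_nat f g h

lemma valBal_pentagon (F : FreeCocompletion K X) (C D : FreeCocompletion K A)
    (H : FreeCocompletion K Y) :
    (Q.valBal (conv _ F C) D H).hom ≫ (Q.valBal F C (conv _ D H)).hom =
      Q.valMap ((rightAssoc A X).hom F C D) (𝟙 H) ≫ (Q.valBal F (conv _ C D) H).hom ≫
        Q.valMap (𝟙 F) ((leftAssoc A Y).hom C D H) := by
  rw [valMap_id_left, valMap_id_right]
  exact Q.pentagon F C D H

lemma valBal_triangle (F : FreeCocompletion K X) (H : FreeCocompletion K Y) :
    (Q.valBal F (rep K (𝟙_ A)) H).hom ≫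
        Q.valMap (𝟙 F) (leftUnitHom _ _ (leftActionUnit A Y) H) =
      Q.valMap (rightUnitHom _ _ (rightActionUnit A X) F) (𝟙 H) := by
  rw [valMap_id_left, valMap_id_right]
  exact Q.triangle F H

end

/-! ### Restriction to represented presheaves -/

lemma rightRep_naturality {x x' : X} {c c' : A} (f : x ⟶ x') (g : c ⟶ c') :
    ofSec (ofHom (f ⊙ᵣₘ g)) ≫ rightRep (K := K) x' c' =
      rightRep x c ≫ map (rightActionBifunctor A X) (ofSec (ofHom f)) (ofSec (ofHom g)) := by
  rw [MonoidalRightAction.actionHom_def]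
  exact repHom_naturality (rightActionBifunctor A X) f g

lemma leftRep_naturality {c c' : A} {y y' : Y} (g : c ⟶ c') (h : y ⟶ y') :
    ofSec (ofHom (g ⊙ₗₘ h)) ≫ leftRep (K := K) c' y' =
      leftRep c y ≫ map (leftActionBifunctor A Y) (ofSec (ofHom g)) (ofSec (ofHom h)) := by
  rw [MonoidalLeftAction.actionHom_def]
  exact repHom_naturality (leftActionBifunctor A Y) g h

lemma rightRep_assoc (x : X) (a b : A) :
    rightRep (K := K) (x ⊙ᵣ a) b ≫ map (rightActionBifunctor A X) (rightRep x a) (𝟙 _) ≫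
        (rightAssoc A X).hom (rep K x) (rep K a) (rep K b) =
      ofSec (ofHom (αᵣ x a b).inv) ≫ rightRep x (a ⊗ b) ≫
        map (rightActionBifunctor A X) (𝟙 _) (repHom (curriedTensor A) a b) :=
  (rightAssoc A X).repHom_comp_hom x a b

lemma leftRep_assoc (a b : A) (y : Y) :
    leftRep (K := K) (a ⊗ b) y ≫
        map (leftActionBifunctor A Y) (repHom (curriedTensor A) a b) (𝟙 _) ≫
        (leftAssoc A Y).hom (rep K a) (rep K b) (rep K y) =
      ofSec (ofHom (αₗ a b y).hom) ≫ leftRep a (b ⊙ₗ y) ≫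
        map (leftActionBifunctor A Y) (𝟙 _) (leftRep b y) :=
  (leftAssoc A Y).repHom_comp_hom a b y

lemma rightRep_unit (x : X) :
    rightRep (K := K) x (𝟙_ A) ≫ rightUnitHom _ _ (rightActionUnit A X) (rep K x) =
      ofSec (ofHom (ρᵣ x).hom) :=
  repHom_comp_rightUnitHom _ _ (rightActionUnit A X) x

lemma leftRep_unit (y : Y) :
    leftRep (K := K) (𝟙_ A) y ≫ leftUnitHom _ _ (leftActionUnit A Y) (rep K y) =
      ofSec (ofHom (λₗ y).hom) :=
  repHom_comp_leftUnitHom _ _ (leftActionUnit A Y) y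

/-- The balancing isomorphism on represented presheaves. -/
noncomputable def repBal (x : X) (a : A) (y : Y) :
    Q.val (rep K (x ⊙ᵣ a)) (rep K y) ≅ Q.val (rep K x) (rep K (a ⊙ₗ y)) :=
  asIso (Q.valMap (rightRep x a) (𝟙 _)) ≪≫ Q.valBal _ _ _ ≪≫
    (asIso (Q.valMap (𝟙 _) (leftRep a y))).symm

/-- This characterises `repBal` without inverses. In the coherence proofs below, one composes with
the invertible `leftRep` maps and rewrites with this equation. -/
lemma repBal_hom_comp (x : X) (a : A) (y : Y) :
    (Q.repBal x a y).hom ≫ Q.valMap (𝟙 _) (leftRep a y) =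
      Q.valMap (rightRep x a) (𝟙 _) ≫ (Q.valBal _ _ _).hom := by
  simp [repBal]

lemma repBal_naturality {x x' : X} {a a' : A} {y y' : Y} (f : x ⟶ x') (g : a ⟶ a') (h : y ⟶ y') :
    Q.valMap (ofSec (ofHom (f ⊙ᵣₘ g))) (ofSec (ofHom h)) ≫ (Q.repBal x' a' y').hom =
      (Q.repBal x a y).hom ≫ Q.valMap (ofSec (ofHom f)) (ofSec (ofHom (g ⊙ₗₘ h))) := by
  rw [← cancel_mono (Q.valMap (𝟙 _) (leftRep a' y')), Category.assoc, Category.assoc,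
    repBal_hom_comp, ← Category.assoc, ← valMap_comp, rightRep_naturality, ← valMap_comp,
    leftRep_naturality, Category.comp_id, Category.comp_id]
  -- Inserted identities separate the change to convolution form from the given morphisms, so that
  -- the naturality square of the balancing of `Q` appears.
  conv_lhs => rw [← Category.id_comp (ofSec (ofHom h)), valMap_comp]
  conv_rhs => rw [← Category.id_comp (ofSec (ofHom f)), valMap_comp]
  rw [reassoc_of% repBal_hom_comp, Category.assoc, valBal_naturality]

/-- Composing with an invertible map turns the target into an iterated convolution. `leftRep_assoc`
and `rightRep_assoc` then exchange the associators of `Y` and `X` with those of Day convolution, and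
the claim becomes the pentagon of `Q` at representables. -/
lemma repBal_pentagon (x : X) (a b : A) (y : Y) :
    (Q.repBal (x ⊙ᵣ a) b y).hom ≫ (Q.repBal x a (b ⊙ₗ y)).hom =
      Q.valMap (ofSec (ofHom (αᵣ x a b).inv)) (𝟙 _) ≫ (Q.repBal x (a ⊗ b) y).hom ≫
        Q.valMap (𝟙 _) (ofSec (ofHom (αₗ a b y).hom)) := by
  rw [← cancel_mono (Q.valMap (𝟙 _) (leftRep a (b ⊙ₗ y) ≫
    map (leftActionBifunctor A Y) (𝟙 _) (leftRep b y)))]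
  simp only [Category.assoc]
  rw [← valMap_comp_right, ← leftRep_assoc, valMap_comp_right, valMap_comp_right,
    valMap_comp_right, reassoc_of% repBal_hom_comp, reassoc_of% repBal_hom_comp,
    ← reassoc_of% Q.valBal_naturality, ← valBal_naturality, map_id, ← reassoc_of% Q.valMap_exchange,
    reassoc_of% repBal_hom_comp,
    -- The identity of a convolution is expressed as a convolution of identities, the form that
    -- naturality of the balancing produces.
    ← map_id (T := leftActionBifunctor A Y) (F := rep K b) (G := rep K y),
    ← reassoc_of% Q.valBal_naturality, valBal_pentagon,
    ← reassoc_of% Q.valMap_comp_left, ← reassoc_of% Q.valMap_comp_left,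
    ← reassoc_of% Q.valMap_comp_left, ← reassoc_of% Q.valMap_comp_left, Category.assoc,
    rightRep_assoc, Category.assoc]

/-- The unit constraints of the actions factor through those of Day convolution, which reduces the
claim to the triangle of `Q`. -/
lemma repBal_triangle (x : X) (y : Y) :
    (Q.repBal x (𝟙_ A) y).hom ≫ Q.valMap (𝟙 _) (ofSec (ofHom (λₗ y).hom)) =
      Q.valMap (ofSec (ofHom (ρᵣ x).hom)) (𝟙 _) := by
  rw [← leftRep_unit, ← rightRep_unit, valMap_comp_right, valMap_comp_left,
    reassoc_of% repBal_hom_comp, valBal_triangle]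

/-- The restriction of a balanced functor to represented presheaves. -/
noncomputable def restrict : NaiveBalancedFunctor K A X Y E where
  functor :=
    { obj := fun x => yoneda K Y ⋙ Q.functor.obj (rep K x)
      map := fun f => Functor.whiskerLeft (yoneda K Y) (Q.functor.map ((yoneda K X).map f))
      map_id := fun x => by rw [(yoneda K X).map_id, Q.functor.map_id]; rfl
      map_comp := fun f g => by rw [(yoneda K X).map_comp, Q.functor.map_comp]; rfl }
  bilinear :=
    { map_add_left := fun f g y => by
        have h : (yoneda K X).map (f + g) = (yoneda K X).map f + (yoneda K X).map g :=
          (yoneda K X).map_add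
        exact (congrArg (fun η => (Q.functor.map η).app (rep K y)) h).trans
          (Q.bilinear.map_add_left _ _ _)
      map_smul_left := fun r f y => by
        have h : (yoneda K X).map (r • f) = r • (yoneda K X).map f := (yoneda K X).map_smul r f
        exact (congrArg (fun η => (Q.functor.map η).app (rep K y)) h).trans
          (Q.bilinear.map_smul_left _ _ _)
      map_add_right := fun x _ _ f g => by
        have h : (yoneda K Y).map (f + g) = (yoneda K Y).map f + (yoneda K Y).map g :=
          (yoneda K Y).map_add
        exact (congrArg (Q.functor.obj (rep K x)).map h).trans (Q.bilinear.map_add_right _ _ _)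
      map_smul_right := fun x _ _ r f => by
        have h : (yoneda K Y).map (r • f) = r • (yoneda K Y).map f := (yoneda K Y).map_smul r f
        exact (congrArg (Q.functor.obj (rep K x)).map h).trans (Q.bilinear.map_smul_right _ _ _) }
  bal := Q.repBal
  bal_nat f g h := Q.repBal_naturality f g h
  pentagon x a b y := by
    have h := Q.repBal_pentagon x a b y
    rw [valMap_id_left, valMap_id_right] at h
    exact h
  triangle x y := by
    have h := Q.repBal_triangle x y
    rw [valMap_id_left, valMap_id_right] at h
    exact h

end BalancedFunctor

namespace BalancedFunctor

open FreeCocompletion Day NaiveBalancedTensor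

/-! ### Extension of a balanced functor along the canonical balanced functor -/

variable {K : Type u} [Field K] {A X Y : Type u}
variable [SmallCategory A] [SmallCategory X] [SmallCategory Y]
variable [Preadditive A] [Preadditive X] [Preadditive Y] [Linear K A] [Linear K X] [Linear K Y]
variable [MonoidalCategory A] [MonoidalPreadditive A] [MonoidalLinear K A]
variable [MonoidalRightAction A X] [LinearRightAction K A X]
variable [MonoidalLeftAction A Y] [LinearLeftAction K A Y]
variable {E : Type w} [Category.{u} E] [Preadditive E] [Linear K E]
variable (Q : BalancedFunctor K (FreeCocompletion K A) (FreeCocompletion K X)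
  (FreeCocompletion K Y) E)

/-- The linear functor on the naive balanced tensor product determined by a balanced functor. -/
noncomputable abbrev naiveLift : NaiveBalancedTensor K A X Y ⥤ E := Q.restrict.lift

/-- The value of `naiveLift` on a morphism, with target expressed by the balanced functor. -/
noncomputable def naiveMap {p : NaiveBalancedTensor K A X Y} {x : X} {y : Y} (φ : p ⟶ ⟨⟨x, y⟩⟩) :
    Q.naiveLift.obj p ⟶ Q.val (rep K x) (rep K y) := Q.naiveLift.map φ

section

variable {p p' : NaiveBalancedTensor K A X Y} {x x' : X} {y y' : Y}

lemma naiveMap_comp (ψ : p' ⟶ p) (φ : p ⟶ ⟨⟨x, y⟩⟩) :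
    Q.naiveMap (ψ ≫ φ) = Q.naiveLift.map ψ ≫ Q.naiveMap φ :=
  Q.naiveLift.map_comp ψ φ

lemma naiveMap_add (φ φ' : p ⟶ ⟨⟨x, y⟩⟩) :
    Q.naiveMap (φ + φ') = Q.naiveMap φ + Q.naiveMap φ' :=
  Q.naiveLift.map_add

lemma naiveMap_smul (r : K) (φ : p ⟶ ⟨⟨x, y⟩⟩) : Q.naiveMap (r • φ) = r • Q.naiveMap φ :=
  Q.naiveLift.map_smul r φ

/-- The lift acts on pure tensors through `Q` itself; this is the source of dinaturality of the
comparison map. -/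
lemma naiveMap_comp_tens (φ : p ⟶ ⟨⟨x, y⟩⟩) (f : x ⟶ x') (g : y ⟶ y') :
    Q.naiveMap (φ ≫ tens f g) =
      Q.naiveMap φ ≫ Q.valMap (ofSec (ofHom f)) (ofSec (ofHom g)) :=
  (Q.naiveLift.map_comp φ (tens f g)).trans
    (congrArg (Q.naiveMap φ ≫ ·) (Q.restrict.tensorMap_tmul f g))

end

variable [HasColimits E]

/-- The linear cocontinuous functor determined by a balanced functor. -/
noncomputable abbrev lan : FreeCocompletion K (NaiveBalancedTensor K A X Y) ⥤ E :=
  extension Q.naiveLift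

/-- By adjunction, a map out of the extension at a convolution is a map from the convolution to a
nerve, that is, a trilinear dinatural family. The family first applies the lift to `φ`, then applies
`Q` to the maps classifying the two sections. -/
lemma exists_lanHom (F : FreeCocompletion K X) (H : FreeCocompletion K Y) :
    ∃ τ : Q.lan.obj (conv (incl K A X Y) F H) ⟶ Q.val F H,
      ∀ {p : NaiveBalancedTensor K A X Y} {x : X} {y : Y} (φ : p ⟶ ⟨⟨x, y⟩⟩) (s : F.sec x)
        (t : H.sec y), extι Q.naiveLift (cmk (T := incl K A X Y) φ s t) ≫ τ =
          Q.naiveMap φ ≫ Q.valMap (ofSec s) (ofSec t) := by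
  let m : ∀ p, TriMap (incl K A X Y) F H p (((nerve K Q.naiveLift).obj (Q.val F H)).sec p) :=
    fun p =>
    { f := fun {x y} φ s t => ennerve (Q.naiveMap φ ≫ Q.valMap (ofSec s) (ofSec t))
      add_hom := fun φ φ' s t => by rw [naiveMap_add, Preadditive.add_comp, map_add]
      smul_hom := fun r φ s t => by rw [naiveMap_smul, Linear.smul_comp, map_smul]
      add_left := fun φ s s' t => by
        rw [ofSec_add, valMap_add_left, Preadditive.comp_add, map_add]
      smul_left := fun r φ s t => by
        rw [ofSec_smul, valMap_smul_left, Linear.comp_smul, map_smul]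
      add_right := fun φ s t t' => by
        rw [ofSec_add, valMap_add_right, Preadditive.comp_add, map_add]
      smul_right := fun r φ s t => by
        rw [ofSec_smul, valMap_smul_right, Linear.comp_smul, map_smul]
      dinat_left := fun {x x' y} g φ s t => by
        have h : ofSec (ofHom (𝟙 y)) = 𝟙 (rep K y) := (yoneda K Y).map_id y
        rw [naiveMap_comp_tens, h, Category.assoc, ← valMap_comp, ofSec_ofHom_comp_ofSec,
          Category.id_comp]
      dinat_right := fun {x y y'} g φ s t => by
        have h : ofSec (ofHom (𝟙 x)) = 𝟙 (rep K x) := (yoneda K X).map_id x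
        rw [naiveMap_comp_tens, h, Category.assoc, ← valMap_comp, ofSec_ofHom_comp_ofSec,
          Category.id_comp] }
  have nat : ∀ {p p' : NaiveBalancedTensor K A X Y} (h : p ⟶ p') {x : X} {y : Y}
      (φ : p' ⟶ ((incl K A X Y).obj x).obj y) (s : F.sec x) (t : H.sec y),
      (m p).f (h ≫ φ) s t = ((nerve K Q.naiveLift).obj (Q.val F H)).res h ((m p').f φ s t) :=
    fun {p p'} h {x y} φ s t => congrArg ennerve
      ((congrArg (· ≫ _) (Q.naiveMap_comp h φ)).trans (Category.assoc _ _ _))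
  obtain ⟨τ, hτ⟩ := exists_extension_desc Q.naiveLift (desc m nat)
  refine ⟨τ, fun {p x y} φ s t => (hτ _ _).trans ?_⟩
  rw [app_desc]
  rfl

/-- The comparison of a balanced functor with the composite of Day convolution and the linear
cocontinuous functor determined by it. -/
noncomputable def lanHom (F : FreeCocompletion K X) (H : FreeCocompletion K Y) :
    Q.lan.obj (conv (incl K A X Y) F H) ⟶ Q.val F H :=
  (Q.exists_lanHom F H).choose

section

variable {F F' : FreeCocompletion K X} {H H' : FreeCocompletion K Y}

lemma extι_cmk_lanHom {p : NaiveBalancedTensor K A X Y} {x : X} {y : Y} (φ : p ⟶ ⟨⟨x, y⟩⟩)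
    (s : F.sec x) (t : H.sec y) :
    extι Q.naiveLift (cmk (T := incl K A X Y) φ s t) ≫ Q.lanHom F H =
      Q.naiveMap φ ≫ Q.valMap (ofSec s) (ofSec t) :=
  (Q.exists_lanHom F H).choose_spec φ s t

/-- On a pair of representables the relevant sections are identities, so the factor contributed by
`Q` disappears and only the lift of `φ` remains. -/
lemma extι_lanHom_rep {p : NaiveBalancedTensor K A X Y} {x : X} {y : Y} (φ : p ⟶ ⟨⟨x, y⟩⟩) :
    extι Q.naiveLift (ofHom φ) ≫ Q.lan.map (inclRep x y) ≫ Q.lanHom (rep K x) (rep K y) =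
      Q.naiveMap φ := by
  have h : app (inclRep (K := K) (A := A) x y) p (ofHom φ) =
      cmk (T := incl K A X Y) φ (ofHom (𝟙 x)) (ofHom (𝟙 y)) := app_repHom _ _
  have hx : ofSec (ofHom (𝟙 x)) = 𝟙 (rep K x) := (yoneda K X).map_id x
  have hy : ofSec (ofHom (𝟙 y)) = 𝟙 (rep K y) := (yoneda K Y).map_id y
  rw [← Category.assoc, extι_map, h, extι_cmk_lanHom, hx, hy, valMap_id, Category.comp_id]

lemma lanHom_naturality (f : F ⟶ F') (h : H ⟶ H') :
    Q.lan.map (map (incl K A X Y) f h) ≫ Q.lanHom F' H' = Q.lanHom F H ≫ Q.valMap f h := by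
  refine extension_hom_ext _ fun p s => ?_
  rw [← Category.assoc, extι_map, ← Category.assoc]
  induction s using cind with
  | h_mk φ s t =>
    rw [app_map_cmk, extι_cmk_lanHom, extι_cmk_lanHom, Category.assoc, ← valMap_comp, ofSec_comp,
      ofSec_comp]
  | h_zero =>
    have e {G : FreeCocompletion K (NaiveBalancedTensor K A X Y)} :
        extι Q.naiveLift (0 : G.sec p) = 0 := by
      rw [← zero_smul K (0 : G.sec p), extι_smul, zero_smul]
    rw [map_zero, e, e, zero_comp, zero_comp, zero_comp]
  | h_add x y hx hy =>
    rw [map_add, extι_add, extι_add, Preadditive.add_comp, Preadditive.add_comp,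
      Preadditive.add_comp, hx, hy]

end

lemma extι_lanHom_rep_id (x : X) (y : Y) :
    extι Q.naiveLift (ofHom (𝟙 (⟨⟨x, y⟩⟩ : NaiveBalancedTensor K A X Y))) ≫
      Q.lan.map (inclRep x y) ≫ Q.lanHom (rep K x) (rep K y) = 𝟙 (Q.val (rep K x) (rep K y)) :=
  (Q.extι_lanHom_rep (𝟙 (⟨⟨x, y⟩⟩ : NaiveBalancedTensor K A X Y))).trans
    (Q.naiveLift.map_id ⟨⟨x, y⟩⟩)

/-- In the composite of `extι_lanHom_rep_id`, which is an identity, the other two factors are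
invertible. -/
lemma isIso_lanHom_rep (x : X) (y : Y) : IsIso (Q.lanHom (rep K x) (rep K y)) := by
  have h₁ := isIso_extι_id (K := K) Q.naiveLift ⟨⟨x, y⟩⟩
  have h₂ : IsIso (extι Q.naiveLift (ofHom (𝟙 (⟨⟨x, y⟩⟩ : NaiveBalancedTensor K A X Y))) ≫
      Q.lan.map (inclRep x y) ≫ Q.lanHom (rep K x) (rep K y)) := by
    rw [extι_lanHom_rep_id]
    exact IsIso.id (Q.val (rep K x) (rep K y))
  have h₃ := IsIso.of_isIso_comp_left (extι Q.naiveLift (ofHom (𝟙 (⟨⟨x, y⟩⟩ :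
    NaiveBalancedTensor K A X Y)))) (Q.lan.map (inclRep x y) ≫ Q.lanHom (rep K x) (rep K y))
  exact IsIso.of_isIso_comp_left (Q.lan.map (inclRep x y)) _

/-- After cancelling an invertible structure map, the statement is that the lift sends the adjoined
isomorphism to `repBal`, which holds by construction. -/
lemma lanHom_rep_bal (x : X) (c : A) (y : Y) :
    Q.lan.map (ofSec (ofHom (balIso x c y).hom)) ≫ Q.lan.map (inclRep x (c ⊙ₗ y)) ≫
        Q.lanHom (rep K x) (rep K (c ⊙ₗ y)) =
      Q.lan.map (inclRep (x ⊙ᵣ c) y) ≫ Q.lanHom (rep K (x ⊙ᵣ c)) (rep K y) ≫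
        (Q.repBal x c y).hom := by
  have h₁ := isIso_extι_id (K := K) Q.naiveLift ⟨⟨x ⊙ᵣ c, y⟩⟩
  rw [← cancel_epi (extι Q.naiveLift (ofHom (𝟙 (⟨⟨x ⊙ᵣ c, y⟩⟩ : NaiveBalancedTensor K A X Y))))]
  have h₂ := Q.extι_lanHom_rep_id (x ⊙ᵣ c) y
  have h₃ : extι Q.naiveLift (ofHom (𝟙 (⟨⟨x ⊙ᵣ c, y⟩⟩ : NaiveBalancedTensor K A X Y))) ≫
      Q.lan.map (ofSec (ofHom (balIso x c y).hom)) =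
        extι Q.naiveLift (ofHom (balIso x c y).hom) := by
    rw [extι_map, app_ofSec, toHom_ofHom, res_ofHom, Category.id_comp]
  rw [reassoc_of% h₃, extι_lanHom_rep, reassoc_of% h₂]
  exact (Category.id_comp (Q.repBal x c y).hom).symm

/-- The preceding identity is transported from representables to convolutions of representables,
using `inclRep_bal` on the source side and `repBal_hom_comp` on the side of `Q`. -/
lemma lanHom_bal_rep (x : X) (c : A) (y : Y) :
    Q.lan.map ((inclAssoc K A X Y).hom (rep K x) (rep K c) (rep K y)) ≫
        Q.lanHom (rep K x) (conv (leftActionBifunctor A Y) (rep K c) (rep K y)) =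
      Q.lanHom (conv (rightActionBifunctor A X) (rep K x) (rep K c)) (rep K y) ≫
        (Q.valBal (rep K x) (rep K c) (rep K y)).hom := by
  have n := inclRep_bal (K := K) x c y
  rw [← cancel_epi (Q.lan.map (inclRep (x ⊙ᵣ c) y ≫ map (incl K A X Y) (rightRep x c) (𝟙 _))),
    ← Q.lan.map_comp_assoc, Category.assoc, n, Q.lan.map_comp, Q.lan.map_comp, Q.lan.map_comp,
    Category.assoc, Category.assoc, Category.assoc, lanHom_naturality,
    reassoc_of% Q.lanHom_naturality, ← repBal_hom_comp, reassoc_of% Q.lanHom_rep_bal x c y]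

/-- Both sides are natural in all three presheaves, and maps out of the image of a threefold
convolution are tested on triples of sections, so the representable case suffices. -/
lemma lanHom_bal (F : FreeCocompletion K X) (C : FreeCocompletion K A)
    (H : FreeCocompletion K Y) :
    Q.lanHom (conv (rightActionBifunctor A X) F C) H ≫ (Q.valBal F C H).hom =
      Q.lan.map ((inclAssoc K A X Y).hom F C H) ≫
        Q.lanHom F (conv (leftActionBifunctor A Y) C H) := by
  refine cocont_conv_conv_hom_ext (isLinearCocontinuous_extension Q.naiveLift)
    fun s₁ s₂ s₃ => ?_
  rw [reassoc_of% Q.lanHom_naturality, valBal_naturality, ← Q.lan.map_comp_assoc,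
    Assoc.hom_naturality, Q.lan.map_comp, Category.assoc, lanHom_naturality,
    ← Category.assoc, ← Category.assoc, lanHom_bal_rep]

/-- The linear cocontinuous functor determined by a balanced functor, as a bundled functor. -/
noncomputable abbrev cocontLan :
    CocontFunctor K (FreeCocompletion K (NaiveBalancedTensor K A X Y)) E :=
  ⟨Q.lan, isLinearCocontinuous_extension Q.naiveLift⟩

/-- The comparison maps `lanHom`, as a morphism of balanced functors. -/
noncomputable def lanBalancedHom : (balancedConv K A X Y).postcomp Q.cocontLan ⟶ Q :=
  Hom.mk
    { app := fun F =>
        { app := fun H => Q.lanHom F H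
          naturality := fun H H' h => by
            have n := Q.lanHom_naturality (𝟙 F) h
            rw [valMap_id_left] at n
            exact n }
      naturality := fun F F' f => by
        ext H
        have n := Q.lanHom_naturality f (𝟙 H)
        rw [valMap_id_right] at n
        exact n }
    (fun F C H => Q.lanHom_bal F C H)

/-- Separate cocontinuity propagates invertibility from pairs of representables: first the second
variable is freed, with the first still representable, then the first. -/
lemma isIso_lanHom (F : FreeCocompletion K X) (H : FreeCocompletion K Y) :
    IsIso (Q.lanHom F H) := by
  have h₁ (x : X) (H : FreeCocompletion K Y) : IsIso (Q.lanHom (rep K x) H) :=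
    isIso_app_of_isIso_app_rep (isLinearCocontinuous_obj _ (rep K x))
      (Q.isLinearCocontinuous_obj (rep K x)) (Q.lanBalancedHom.hom.app (rep K x))
      (fun y => Q.isIso_lanHom_rep x y) H
  exact isIso_app_of_isIso_app_rep (isLinearCocontinuous_flip_obj _ H)
    (Q.isLinearCocontinuous_flip_obj H)
    ((flipFunctor _ _ _).map Q.lanBalancedHom.hom |>.app H) (fun x => h₁ x H) F

instance : IsIso Q.lanBalancedHom := isIso_of_isIso_app _ fun F H => Q.isIso_lanHom F H


/-- The preimage of a balanced functor is the cocontinuous extension of its lift; the comparison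
maps form the required isomorphism. -/
instance essSurj_postcompFunctor : ((balancedConv K A X Y).postcompFunctor E).EssSurj where
  mem_essImage Q := ⟨Q.cocontLan,
    ⟨asIso (X := (balancedConv K A X Y).postcomp Q.cocontLan) Q.lanBalancedHom⟩⟩

instance isEquivalence_postcompFunctor :
    ((balancedConv K A X Y).postcompFunctor E).IsEquivalence where

variable (K A X Y) in
lemma isBalancedTensorProduct_balancedConv :
    IsBalancedTensorProduct.{u, u + 1, w} (balancedConv K A X Y) where
  cocomplete := inferInstance
  universal _ := inferInstance

end BalancedFunctor

/-! ### Uniqueness of balanced tensor products -/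

section Uniqueness

variable {K : Type u} [Field K]
variable {W : Type v} [Category.{u} W] [Preadditive W] [Linear K W]
variable {W' : Type w} [Category.{u} W'] [Preadditive W'] [Linear K W']

namespace CocontFunctor

variable (K W) in
/-- The identity functor. -/
abbrev id : CocontFunctor K W W :=
  ⟨𝟭 W, fun _ _ _ _ => rfl, fun _ _ _ _ => rfl, inferInstance⟩

/-- Composition of linear cocontinuous functors. -/
abbrev comp {W'' : Type v₁} [Category.{u} W''] [Preadditive W''] [Linear K W'']
    (G : CocontFunctor K W W') (G' : CocontFunctor K W' W'') : CocontFunctor K W W'' :=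
  ⟨G.obj ⋙ G'.obj, fun _ _ f g => by simp [G.property.1, G'.property.1],
    fun _ _ r f => by simp [G.property.2.1, G'.property.2.1],
    have := G.property.2.2
    have := G'.property.2.2
    inferInstance⟩

end CocontFunctor

namespace BalancedFunctor

variable {C : Type v₁} [Category.{u} C] [MonoidalCategory C]
variable {X : Type v₂} [Category.{u} X] [Preadditive X] [Linear K X] [MonoidalRightAction C X]
variable {Y : Type v₃} [Category.{u} Y] [Preadditive Y] [Linear K Y] [MonoidalLeftAction C Y]

/-- Composition with a linear cocontinuous functor, on morphisms of balanced functors. -/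
def postcompMap {P P' : BalancedFunctor K C X Y W} (η : P ⟶ P') (G : CocontFunctor K W W') :
    P.postcomp G ⟶ P'.postcomp G :=
  Hom.mk (Functor.whiskerRight η.hom ((Functor.whiskeringRight Y W W').obj G.obj))
    (fun x c y => by
      have h := congrArg G.obj.map (η.comm x c y)
      rw [G.obj.map_comp, G.obj.map_comp] at h
      exact h)

/-- Composition with a linear cocontinuous functor, on isomorphisms of balanced functors. -/
def postcompIso {P P' : BalancedFunctor K C X Y W} (e : P ≅ P') (G : CocontFunctor K W W') :
    P.postcomp G ≅ P'.postcomp G where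
  hom := postcompMap e.hom G
  inv := postcompMap e.inv G
  hom_inv_id := Hom.ext <| by
    ext x y
    have h : (e.hom.hom.app x).app y ≫ (e.inv.hom.app x).app y = 𝟙 _ :=
      congrArg (fun τ : Hom _ _ => (τ.hom.app x).app y) e.hom_inv_id
    exact (G.obj.map_comp _ _).symm.trans ((congrArg G.obj.map h).trans (G.obj.map_id _))
  inv_hom_id := Hom.ext <| by
    ext x y
    have h : (e.inv.hom.app x).app y ≫ (e.hom.hom.app x).app y = 𝟙 _ :=
      congrArg (fun τ : Hom _ _ => (τ.hom.app x).app y) e.inv_hom_id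
    exact (G.obj.map_comp _ _).symm.trans ((congrArg G.obj.map h).trans (G.obj.map_id _))

/-- If `G` and `G'` exchange balanced functors `P` and `Q` and composition with `P` is fully
faithful, then `G ⋙ G'` is isomorphic to the identity. -/
lemma nonempty_comp_iso_id (P : BalancedFunctor K C X Y W) (Q : BalancedFunctor K C X Y W')
    [(P.postcompFunctor W).Full] [(P.postcompFunctor W).Faithful]
    {G : CocontFunctor K W W'} {G' : CocontFunctor K W' W} (e : P.postcomp G ≅ Q)
    (e' : Q.postcomp G' ≅ P) : Nonempty (G.obj ⋙ G'.obj ≅ 𝟭 W) := by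
  -- Composing `P` with `G` and then `G'` agrees definitionally with composing it with `G.comp G'`,
  -- and composing with the identity gives back `P`. Full faithfulness then reflects the
  -- isomorphism.
  have i : (P.postcompFunctor W).obj (G.comp G') ≅ (P.postcompFunctor W).obj (.id K W) :=
    postcompIso e G' ≪≫ e'
  exact ⟨(ObjectProperty.ι _).mapIso ((P.postcompFunctor W).preimageIso i)⟩

end BalancedFunctor

end Uniqueness

end LinCat

/-! ### Free cocompletion takes naive balanced tensor products to balanced tensor products -/

theorem mainTheorem10 {K : Type u} [Field K] {A X Y : Type u}
    [SmallCategory A] [Preadditive A] [Linear K A]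
    [MonoidalCategory A] [MonoidalPreadditive A] [MonoidalLinear K A]
    [SmallCategory X] [Preadditive X] [Linear K X]
    [MonoidalRightAction A X] [LinCat.LinearRightAction K A X]
    [SmallCategory Y] [Preadditive Y] [Linear K Y]
    [MonoidalLeftAction A Y] [LinCat.LinearLeftAction K A Y] :
    ∃ P : LinCat.BalancedFunctor K (LinCat.FreeCocompletion K A)
        (LinCat.FreeCocompletion K X) (LinCat.FreeCocompletion K Y)
        (LinCat.FreeCocompletion K (LinCat.NaiveBalancedTensor K A X Y)),
      LinCat.BalancedFunctor.IsBalancedTensorProduct.{u, u + 1, w} P ∧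
      ∀ (W : Type (u + 1)) [LargeCategory W] [Preadditive W] [Linear K W]
        (Q : LinCat.BalancedFunctor K (LinCat.FreeCocompletion K A)
          (LinCat.FreeCocompletion K X) (LinCat.FreeCocompletion K Y) W),
        LinCat.BalancedFunctor.IsBalancedTensorProduct.{u, u + 1, u + 1} Q →
          ∃ G : LinCat.CocontFunctor K
              (LinCat.FreeCocompletion K (LinCat.NaiveBalancedTensor K A X Y)) W,
            G.obj.IsEquivalence ∧ Nonempty (P.postcomp G ≅ Q) := by
  refine ⟨LinCat.NaiveBalancedTensor.balancedConv K A X Y,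
    LinCat.BalancedFunctor.isBalancedTensorProduct_balancedConv K A X Y, fun W _ _ _ Q hQ => ?_⟩
  have := hQ.cocomplete
  -- The universal property of `Q` is used twice: at `W`, for full faithfulness, and at the free
  -- cocompletion, to obtain a functor back. Both categories have their objects in `Type (u + 1)`,
  -- where that property is assumed.
  have := hQ.universal W
  have := hQ.universal (LinCat.FreeCocompletion K (LinCat.NaiveBalancedTensor K A X Y))
  let e := ((LinCat.NaiveBalancedTensor.balancedConv K A X Y).postcompFunctor W).objObjPreimageIso Q
  let e' := (Q.postcompFunctor (LinCat.FreeCocompletion K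
    (LinCat.NaiveBalancedTensor K A X Y))).objObjPreimageIso
      (LinCat.NaiveBalancedTensor.balancedConv K A X Y)
  -- Each composite of the two induced functors preserves one of the universal balanced functors up
  -- to isomorphism, and so is isomorphic to an identity functor.
  obtain ⟨i⟩ := LinCat.BalancedFunctor.nonempty_comp_iso_id _ _ e e'
  obtain ⟨i'⟩ := LinCat.BalancedFunctor.nonempty_comp_iso_id _ _ e' e
  exact ⟨_, (CategoryTheory.Equivalence.mk _ _ i.symm i').isEquivalence_functor, ⟨e⟩⟩
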